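/- Let $k$ be a field and let $H=(H,\Delta,\varepsilon,\Phi,\alpha,\beta,S)$ be a finite-dimensional quasi-Hopf algebra over $k$. That is, $H$ is a unital associative $k$-algebra, $\Delta:H\to H\otimes H$ and $\varepsilon:H\to k$ are algebra maps, $\Phi=\sum X^1\otimes X^2\otimes X^3\in H^{\otimes 3}$ is invertible with inverse $\Phi^{-1}=\sum x^1\otimes x^2\otimes x^3$, $S:H\to H$ is a (unital, linear) anti-algebra map, $\alpha,\beta\in H$, and for all $h\in H$ (writing $\Delta(h)=\sum h_1\otimes h_2$): $$(\mathrm{id}\otimes\Delta)(\Delta(h))=\Phi\,(\Delta\otimes\mathrm{id})(\Delta(h))\,\Phi^{-1},\qquad (\mathrm{id}\otimes\varepsilon)(\Delta(h))=h=(\varepsilon\otimes\mathrm{id})(\Delta(h)),$$ $$(1\otimes\Phi)(\mathrm{id}\otimes\Delta\otimes\mathrm{id})(\Phi)(\Phi\otimes1)=(\mathrm{id}\otimes\mathrm{id}\otimes\Delta)(\Phi)(\Delta\otimes\mathrm{id}\otimes\mathrm{id})(\Phi),\qquad (\mathrm{id}\otimes\varepsilon\otimes\mathrm{id})(\Phi)=1\otimes1,$$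 $$\sum S(h_1)\alpha h_2=\varepsilon(h)\alpha,\quad \sum h_1\beta S(h_2)=\varepsilon(h)\beta,\quad \sum X^1\beta S(X^2)\alpha X^3=1,\quad \sum S(x^1)\alpha x^2\beta S(x^3)=1.$$ Summation signs are omitted below where tensor components are written. Put $$\gamma=S(X^2x^1_{(2)})\,\alpha X^3x^2\otimes S(X^1x^1_{(1)})\,\alpha x^3\quad\text{where } \Delta(x^1)=x^1_{(1)}\otimes x^1_{(2)},$$ $$f=f^1\otimes f^2=(S\otimes S)(\Delta^{\mathrm{cop}}(x^1))\;\gamma\;\Delta(x^2\beta S(x^3)),\qquad \Delta^{\mathrm{cop}}(h)=h_2\otimes h_1.$$ The antipode $S$ is bijective, so that one may further put $$p_L=\tilde p^1\otimes\tilde p^2=X^2S^{-1}(X^1\beta)\otimes X^3,\qquad \tilde V=\tilde V^1\otimes\tilde V^2=S(\tilde p^2)f^1\otimes S(\tilde p^1)f^2 .$$ Let $\mathcal H_1(H)$ (the first Heisenberg double of $H$) be the vector space $H\otimes H^*$, with $a\otimes\xi$ written $a\#\xi$ and with the (in general nonassociative) bilinear product $$(a\#\xi)(b\#\nu)=a\,b_1x^1\,\#\,(\xi\leftharpoonup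 b_2x^2)*(\nu\leftharpoonup x^3),$$ where $(\xi\leftharpoonup h)(a)=\xi(ha)$ and $(\xi*\nu)(h)=\xi(h_1)\nu(h_2)$. Tensor powers of $\mathcal H_1(H)$ carry the componentwise product. For $R=\sum r'\otimes r''\in\mathcal H_1(H)^{\otimes2}$, $R_{12},R_{13},R_{23}\in\mathcal H_1(H)^{\otimes 3}$ denote $R$ placed in the indicated factors, with $1\#\varepsilon$ in the remaining one. Let $\{e_i\}_{i\in I}$ be a basis of $H$ and $\{e^i\}_{i\in I}$ the dual basis, and set $$\bar W=\sum_{i} e_i\#\varepsilon\otimes 1\#e^i,\qquad \hat W=\sum_{i} S(\tilde V^2e_i)\#\varepsilon\otimes\tilde V^1\#e^i\quad\in\mathcal H_1(H)^{\otimes 2},$$ $$(\bar\Phi^{-1})^{321}=x^3\#\varepsilon\otimes x^2\#\varepsilon\otimes x^1\#\varepsilon,\qquad \bar\Phi_S=S(X^1)\#\varepsilon\otimes S(X^2)\#\varepsilon\otimes S(X^3)\#\varepsilon\quad\in\mathcal H_1(H)^{\otimes 3}.$$ **Theorem.** The quasi-Hopf equation $$\bar W_{23}\bar W_{13}\bar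 W_{12}=(\bar\Phi^{-1})^{321}\,\bar W_{12}\bar W_{23}$$ and the quasi-pentagon equation $$\hat W_{12}\hat W_{13}\hat W_{23}=\hat W_{23}\hat W_{12}\,\bar\Phi_S$$ hold in $\mathcal H_1(H)^{\otimes 3}$, and each of the four triple products occurring in them does not depend on the bracketing. -/

import Mathlib

open scoped TensorProduct

noncomputable section

/-- A quasi-bialgebra `(H, Δ, ε, Φ)` over `k`. Threefold and fourfold tensor powers are bracketed to
the right, `H ⊗ (H ⊗ H)` and `H ⊗ (H ⊗ (H ⊗ H))`; the associator is a unit of the algebra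
`H ⊗ (H ⊗ H)`. -/
class QuasiBialgebra (k H : Type*) [Field k] [Ring H] [Algebra k H] where
  /-- the coproduct `Δ` -/
  comul : H →ₐ[k] H ⊗[k] H
  /-- the counit `ε` -/
  counit : H →ₐ[k] k
  /-- the associator `Φ` -/
  associator : (H ⊗[k] (H ⊗[k] H))ˣ
  /-- `(id ⊗ Δ)(Δ(h)) = Φ (Δ ⊗ id)(Δ(h)) Φ⁻¹` -/
  coassoc : ∀ h : H,
    Algebra.TensorProduct.map (AlgHom.id k H) comul (comul h) =
      (associator : H ⊗[k] (H ⊗[k] H)) *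
        Algebra.TensorProduct.assoc k k k H H H
          (Algebra.TensorProduct.map comul (AlgHom.id k H) (comul h)) *
        ((associator⁻¹ : (H ⊗[k] (H ⊗[k] H))ˣ) : H ⊗[k] (H ⊗[k] H))
  /-- `(id ⊗ ε)(Δ(h)) = h` -/
  counit_right : ∀ h : H,
    TensorProduct.rid k H (TensorProduct.map LinearMap.id counit.toLinearMap (comul h)) = h
  /-- `(ε ⊗ id)(Δ(h)) = h` -/
  counit_left : ∀ h : H,
    TensorProduct.lid k H (TensorProduct.map counit.toLinearMap LinearMap.id (comul h)) = h
  /-- `(1 ⊗ Φ) (id ⊗ Δ ⊗ id)(Φ) (Φ ⊗ 1) = (id ⊗ id ⊗ Δ)(Φ) (Δ ⊗ id ⊗ id)(Φ)` -/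
  pentagon :
    ((1 : H) ⊗ₜ[k] (associator : H ⊗[k] (H ⊗[k] H))) *
        Algebra.TensorProduct.map (AlgHom.id k H)
          ((Algebra.TensorProduct.assoc k k k H H H).toAlgHom.comp
            (Algebra.TensorProduct.map comul (AlgHom.id k H)))
          (associator : H ⊗[k] (H ⊗[k] H)) *
        Algebra.TensorProduct.map (AlgHom.id k H)
          (Algebra.TensorProduct.map (AlgHom.id k H)
            (Algebra.TensorProduct.includeLeft : H →ₐ[k] H ⊗[k] H))
          (associator : H ⊗[k] (H ⊗[k] H)) =
      Algebra.TensorProduct.map (AlgHom.id k H)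
          (Algebra.TensorProduct.map (AlgHom.id k H) comul)
          (associator : H ⊗[k] (H ⊗[k] H)) *
        Algebra.TensorProduct.assoc k k k H H (H ⊗[k] H)
          (Algebra.TensorProduct.map comul (AlgHom.id k (H ⊗[k] H))
            (associator : H ⊗[k] (H ⊗[k] H)))
  /-- `(id ⊗ ε ⊗ id)(Φ) = 1 ⊗ 1` -/
  counit_assoc :
    TensorProduct.map LinearMap.id
        ((TensorProduct.lid k H).toLinearMap ∘ₗ
          TensorProduct.map counit.toLinearMap LinearMap.id)
        (associator : H ⊗[k] (H ⊗[k] H)) = 1 ⊗ₜ[k] 1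

/-- A quasi-Hopf algebra `(H, Δ, ε, Φ, α, β, S)` over `k`. The antipode is a unital
anti-multiplicative linear map; it is not assumed to be bijective. -/
class QuasiHopfAlgebra (k H : Type*) [Field k] [Ring H] [Algebra k H]
    extends QuasiBialgebra k H where
  /-- the antipode `S` -/
  antipode : H →ₗ[k] H
  /-- the element `α` -/
  α : H
  /-- the element `β` -/
  β : H
  antipode_one : antipode 1 = 1
  antipode_mul : ∀ a b : H, antipode (a * b) = antipode b * antipode a
  /-- `∑ S(h₁) α h₂ = ε(h) α` -/
  antipode_left : ∀ h : H,
    LinearMap.mul' k H (TensorProduct.map antipode (LinearMap.mulLeft k α) (comul h)) =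
      counit h • α
  /-- `∑ h₁ β S(h₂) = ε(h) β` -/
  antipode_right : ∀ h : H,
    LinearMap.mul' k H (TensorProduct.map (LinearMap.mulRight k β) antipode (comul h)) =
      counit h • β
  /-- `∑ X¹ β S(X²) α X³ = 1`, where `Φ = ∑ X¹ ⊗ X² ⊗ X³` -/
  antipode_assoc :
    LinearMap.mul' k H
      (TensorProduct.map (LinearMap.mulRight k β)
        (LinearMap.mul' k H ∘ₗ TensorProduct.map antipode (LinearMap.mulLeft k α))
        (associator : H ⊗[k] (H ⊗[k] H))) = 1
  /-- `∑ S(x¹) α x² β S(x³) = 1`, where `Φ⁻¹ = ∑ x¹ ⊗ x² ⊗ x³` -/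
  antipode_assoc_inv :
    LinearMap.mul' k H
      (TensorProduct.map antipode
        (LinearMap.mulLeft k α ∘ₗ LinearMap.mul' k H ∘ₗ
          TensorProduct.map (LinearMap.mulRight k β) antipode)
        ((associator⁻¹ : (H ⊗[k] (H ⊗[k] H))ˣ) : H ⊗[k] (H ⊗[k] H))) = 1

namespace QuasiHopf

open QuasiBialgebra QuasiHopfAlgebra

section Elements

variable (k H : Type*) [Field k] [Ring H] [Algebra k H]

/-- The associator `Φ = ∑ X¹ ⊗ X² ⊗ X³`. -/
def phi [QuasiBialgebra k H] : H ⊗[k] (H ⊗[k] H) :=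
  ((associator : (H ⊗[k] (H ⊗[k] H))ˣ) : H ⊗[k] (H ⊗[k] H))

/-- The inverse associator `Φ⁻¹ = ∑ x¹ ⊗ x² ⊗ x³`. -/
def phiInv [QuasiBialgebra k H] : H ⊗[k] (H ⊗[k] H) :=
  (((associator : (H ⊗[k] (H ⊗[k] H))ˣ)⁻¹ : (H ⊗[k] (H ⊗[k] H))ˣ) : H ⊗[k] (H ⊗[k] H))

/-- `S ⊗ S`. -/
def antipode₂ [QuasiHopfAlgebra k H] : H ⊗[k] H →ₗ[k] H ⊗[k] H :=
  TensorProduct.map antipode antipode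

/-- The linear map `a ⊗ b ↦ S(a) α b`. -/
def antipodeAlpha [QuasiHopfAlgebra k H] : H ⊗[k] H →ₗ[k] H :=
  LinearMap.mul' k H ∘ₗ
    TensorProduct.map antipode (LinearMap.mulLeft k (QuasiHopfAlgebra.α k : H))

/-- The linear map `a ⊗ b ↦ a β S(b)`. -/
def betaAntipode [QuasiHopfAlgebra k H] : H ⊗[k] H →ₗ[k] H :=
  LinearMap.mul' k H ∘ₗ
    TensorProduct.map (LinearMap.mulRight k (QuasiHopfAlgebra.β k : H)) antipode

/-- The opposite coproduct `Δᶜᵒᵖ(h) = ∑ h₂ ⊗ h₁`. -/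
def comulCop [QuasiBialgebra k H] : H →ₗ[k] H ⊗[k] H :=
  (TensorProduct.comm k H H).toLinearMap ∘ₗ
    (comul : H →ₐ[k] H ⊗[k] H).toLinearMap

/-- `γ = ∑ S(X² x¹₂) α X³ x² ⊗ S(X¹ x¹₁) α x³`: the linear map
`a ⊗ b ⊗ c ⊗ d ↦ S(b) α c ⊗ S(a) α d` applied to
`(Φ ⊗ 1) (Δ ⊗ id ⊗ id)(Φ⁻¹) = ∑ X¹ x¹₁ ⊗ X² x¹₂ ⊗ X³ x² ⊗ x³`. -/
def gamma [QuasiHopfAlgebra k H] : H ⊗[k] H :=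
  TensorProduct.map (antipodeAlpha k H) (antipodeAlpha k H)
    (TensorProduct.leftComm k H (H ⊗[k] H) H
      (TensorProduct.map LinearMap.id (TensorProduct.assoc k H H H).symm.toLinearMap
        (Algebra.TensorProduct.map (AlgHom.id k H)
            (Algebra.TensorProduct.map (AlgHom.id k H)
              (Algebra.TensorProduct.includeLeft : H →ₐ[k] H ⊗[k] H))
            (phi k H) *
          Algebra.TensorProduct.assoc k k k H H (H ⊗[k] H)
            (Algebra.TensorProduct.map comul (AlgHom.id k (H ⊗[k] H)) (phiInv k H)))))

/-- The Drinfel'd twist `f = ∑ (S ⊗ S)(Δᶜᵒᵖ(x¹)) γ Δ(x² β S(x³))`. -/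
def drinfeldTwist [QuasiHopfAlgebra k H] : H ⊗[k] H :=
  LinearMap.mul' k (H ⊗[k] H)
    (TensorProduct.map
      (antipode₂ k H ∘ₗ comulCop k H)
      (LinearMap.mulLeft k (gamma k H) ∘ₗ
        (comul : H →ₐ[k] H ⊗[k] H).toLinearMap ∘ₗ betaAntipode k H)
      (phiInv k H))

/-- `S⁻¹`, the inverse of the antipode in the algebra of linear endomorphisms of `H`. (As usual for
`Ring.inverse`, it is set to zero if `S` is not bijective.) -/
def antipodeInv [QuasiHopfAlgebra k H] : H →ₗ[k] H :=
  Ring.inverse (antipode : Module.End k H)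

/-- `p_L = p̃¹ ⊗ p̃² = ∑ X² S⁻¹(X¹ β) ⊗ X³`. -/
def pL [QuasiHopfAlgebra k H] : H ⊗[k] H :=
  TensorProduct.map
    (LinearMap.mul' k H ∘ₗ (TensorProduct.comm k H H).toLinearMap ∘ₗ
      TensorProduct.map
        (antipodeInv k H ∘ₗ LinearMap.mulRight k (QuasiHopfAlgebra.β k : H)) LinearMap.id)
    LinearMap.id
    ((TensorProduct.assoc k H H H).symm (phi k H))

/-- `Ṽ = ∑ S(p̃²) f¹ ⊗ S(p̃¹) f²`, where `f = f¹ ⊗ f²` is the Drinfel'd twist. -/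
def vTilde [QuasiHopfAlgebra k H] : H ⊗[k] H :=
  antipode₂ k H (TensorProduct.comm k H H (pL k H)) * drinfeldTwist k H

end Elements

section Dual

variable {k H : Type*} [Field k] [Ring H] [Algebra k H]

/-- `h ↦ (ξ ↼ h)` for `ξ ∈ H*`, where `(ξ ↼ h)(a) = ξ(h a)`. -/
def hit (ξ : Module.Dual k H) : H →ₗ[k] Module.Dual k H :=
  (LinearMap.mul k H).compr₂ ξ

/-- The convolution product `ξ ⊗ ν ↦ ξ ∗ ν` on `H*`, `(ξ ∗ ν)(h) = ∑ ξ(h₁) ν(h₂)`. -/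
def convolution [QuasiBialgebra k H] :
    Module.Dual k H ⊗[k] Module.Dual k H →ₗ[k] Module.Dual k H :=
  Module.Dual.transpose (comul : H →ₐ[k] H ⊗[k] H).toLinearMap ∘ₗ
    TensorProduct.dualDistrib k H H

/-- The counit as an element of `H*`. -/
def counitDual [QuasiBialgebra k H] : Module.Dual k H :=
  (counit : H →ₐ[k] k).toLinearMap

end Dual

end QuasiHopf

/-- The first Heisenberg double `H₁(H)`: the vector space `H ⊗ H*` with the (in general
nonassociative) product defined below. -/
def HeisenbergDouble (k H : Type*) [Field k] [Ring H] [Algebra k H] : Type _ :=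
  H ⊗[k] Module.Dual k H

namespace HeisenbergDouble

open QuasiBialgebra QuasiHopfAlgebra QuasiHopf

variable {k H : Type*} [Field k] [Ring H] [Algebra k H]

variable [QuasiBialgebra k H]

/-- `(a # ξ)(b # ν) = ∑ a b₁ x¹ # (ξ ↼ b₂ x²) ∗ (ν ↼ x³)`: the linear map
`p ⊗ q ⊗ r ↦ a p # (ξ ↼ q) ∗ (ν ↼ r)` applied to
`(Δ(b) ⊗ 1) Φ⁻¹ = ∑ b₁ x¹ ⊗ b₂ x² ⊗ x³`. -/
def smashMul (a : H) (ξ : Module.Dual k H) (b : H) (ν : Module.Dual k H) :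
    H ⊗[k] Module.Dual k H :=
  TensorProduct.map (LinearMap.mulLeft k a)
    (convolution ∘ₗ TensorProduct.map (hit ξ) (hit ν))
    (Algebra.TensorProduct.assoc k k k H H H (comul b ⊗ₜ[k] (1 : H)) * phiInv k H)

/-- The product of `H₁(H)` as a bilinear map: the bilinear extension of `smashMul`. -/
def mulMap :
    H ⊗[k] Module.Dual k H →ₗ[k] H ⊗[k] Module.Dual k H →ₗ[k] H ⊗[k] Module.Dual k H :=
  TensorProduct.lift (LinearMap.mk₂ k
    (fun a ξ => TensorProduct.lift (LinearMap.mk₂ k (fun b ν => smashMul a ξ b ν)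
      (fun b b' ν => by
        simp [smashMul, TensorProduct.add_tmul, add_mul])
      (fun c b ν => by
        rw [smashMul, map_smul, ← TensorProduct.smul_tmul', map_smul, smul_mul_assoc, map_smul]
        rfl)
      (fun b ν ν' => by
        have h : hit (ν + ν') = hit ν + hit ν' := by ext p q; simp [hit]
        simp [smashMul, h, TensorProduct.map_add_right, LinearMap.comp_add])
      (fun c b ν => by
        have h : hit (c • ν) = c • hit ν := by ext p q; simp [hit]
        simp [smashMul, h, TensorProduct.map_smul_right, LinearMap.comp_smul])))
    (fun a a' ξ => by
      have h : LinearMap.mulLeft k (a + a') = LinearMap.mulLeft k a + LinearMap.mulLeft k a' := by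
        ext; simp [add_mul]
      ext b ν
      simp [smashMul, h, TensorProduct.map_add_left])
    (fun c a ξ => by
      have h : LinearMap.mulLeft k (c • a) = c • LinearMap.mulLeft k a := by
        ext; simp
      ext b ν
      simp [smashMul, h, TensorProduct.map_smul_left])
    (fun a ξ ξ' => by
      have h : hit (ξ + ξ') = hit ξ + hit ξ' := by ext p q; simp [hit]
      ext b ν
      simp [smashMul, h, TensorProduct.map_add_left, TensorProduct.map_add_right,
        LinearMap.comp_add])
    (fun c a ξ => by
      have h : hit (c • ξ) = c • hit ξ := by ext p q; simp [hit]
      ext b ν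
      simp [smashMul, h, TensorProduct.map_smul_left, TensorProduct.map_smul_right,
        LinearMap.comp_smul]))

instance : NonUnitalNonAssocRing (HeisenbergDouble k H) where
  __ := (inferInstance : AddCommGroup (H ⊗[k] Module.Dual k H))
  mul x y := (mulMap (k := k) (H := H) x y : H ⊗[k] Module.Dual k H)
  left_distrib x y z := (mulMap (k := k) (H := H) x).map_add y z
  right_distrib x y z := LinearMap.map_add₂ (mulMap (k := k) (H := H)) x y z
  zero_mul x := LinearMap.map_zero₂ (mulMap (k := k) (H := H)) x
  mul_zero x := (mulMap (k := k) (H := H) x).map_zero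

instance : Module k (HeisenbergDouble k H) :=
  inferInstanceAs (Module k (H ⊗[k] Module.Dual k H))

/-- The element `a # ξ`. -/
def smash (a : H) (ξ : Module.Dual k H) : HeisenbergDouble k H :=
  a ⊗ₜ[k] ξ

/-- `a ↦ a # ξ` as a linear map. -/
def smashLeft (ξ : Module.Dual k H) : H →ₗ[k] HeisenbergDouble k H :=
  (TensorProduct.mk k H (Module.Dual k H)).flip ξ

theorem smash_mul_smash (a : H) (ξ : Module.Dual k H) (b : H) (ν : Module.Dual k H) :
    smash a ξ * smash b ν = (smashMul a ξ b ν : HeisenbergDouble k H) := rfl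

instance : IsScalarTower k (HeisenbergDouble k H) (HeisenbergDouble k H) where
  smul_assoc c x y := LinearMap.map_smul₂ (mulMap (k := k) (H := H)) c x y

instance : SMulCommClass k (HeisenbergDouble k H) (HeisenbergDouble k H) where
  smul_comm c x y := ((mulMap (k := k) (H := H) x).map_smul c y).symm

/-- The element `1 # ε`. -/
def unit : HeisenbergDouble k H := smash 1 counitDual

/-- `x ⊗ y ↦ x ⊗ y ⊗ (1 # ε)`. -/
def leg₁₂ :
    HeisenbergDouble k H ⊗[k] HeisenbergDouble k H →ₗ[k]
      HeisenbergDouble k H ⊗[k] (HeisenbergDouble k H ⊗[k] HeisenbergDouble k H) :=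
  TensorProduct.map LinearMap.id
    ((TensorProduct.mk k (HeisenbergDouble k H) (HeisenbergDouble k H)).flip unit)

/-- `x ⊗ y ↦ x ⊗ (1 # ε) ⊗ y`. -/
def leg₁₃ :
    HeisenbergDouble k H ⊗[k] HeisenbergDouble k H →ₗ[k]
      HeisenbergDouble k H ⊗[k] (HeisenbergDouble k H ⊗[k] HeisenbergDouble k H) :=
  TensorProduct.map LinearMap.id
    (TensorProduct.mk k (HeisenbergDouble k H) (HeisenbergDouble k H) unit)

/-- `x ⊗ y ↦ (1 # ε) ⊗ x ⊗ y`. -/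
def leg₂₃ :
    HeisenbergDouble k H ⊗[k] HeisenbergDouble k H →ₗ[k]
      HeisenbergDouble k H ⊗[k] (HeisenbergDouble k H ⊗[k] HeisenbergDouble k H) :=
  TensorProduct.mk k (HeisenbergDouble k H)
    (HeisenbergDouble k H ⊗[k] HeisenbergDouble k H) unit

/-- The canonical element `W̄ = ∑ᵢ eᵢ # ε ⊗ 1 # eⁱ`, where `eⁱ = e.coord i` is the dual basis. -/
def wBar {ι : Type*} [Fintype ι] (e : Module.Basis ι k H) :
    HeisenbergDouble k H ⊗[k] HeisenbergDouble k H :=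
  ∑ i, smash (e i) counitDual ⊗ₜ[k] smash 1 (e.coord i)

/-- `(Φ̄⁻¹)³²¹ = ∑ x³ # ε ⊗ x² # ε ⊗ x¹ # ε`: here `Φ⁻¹ = ∑ x¹ ⊗ (x² ⊗ x³)` is first sent to
`∑ x³ ⊗ (x² ⊗ x¹)`. -/
def phiBarInv₃₂₁ :
    HeisenbergDouble k H ⊗[k] (HeisenbergDouble k H ⊗[k] HeisenbergDouble k H) :=
  TensorProduct.map (smashLeft counitDual)
    (TensorProduct.map (smashLeft counitDual) (smashLeft counitDual))
    (TensorProduct.assoc k H H H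
      (TensorProduct.comm k H (H ⊗[k] H)
        (TensorProduct.map LinearMap.id (TensorProduct.comm k H H).toLinearMap
          (phiInv k H))))

end HeisenbergDouble

namespace HeisenbergDouble

open QuasiBialgebra QuasiHopfAlgebra QuasiHopf

variable {k H : Type*} [Field k] [Ring H] [Algebra k H] [QuasiHopfAlgebra k H]

/-- `Ŵ = ∑ᵢ S(Ṽ² eᵢ) # ε ⊗ Ṽ¹ # eⁱ`. -/
def wHat {ι : Type*} [Fintype ι] (e : Module.Basis ι k H) :
    HeisenbergDouble k H ⊗[k] HeisenbergDouble k H :=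
  ∑ i, TensorProduct.map
    (smashLeft counitDual ∘ₗ antipode ∘ₗ LinearMap.mulRight k (e i))
    (smashLeft (e.coord i))
    (TensorProduct.comm k H H (vTilde k H))

/-- `Φ̄_S = ∑ S(X¹) # ε ⊗ S(X²) # ε ⊗ S(X³) # ε`. -/
def phiBarS :
    HeisenbergDouble k H ⊗[k] (HeisenbergDouble k H ⊗[k] HeisenbergDouble k H) :=
  TensorProduct.map (smashLeft counitDual ∘ₗ antipode)
    (TensorProduct.map (smashLeft counitDual ∘ₗ antipode) (smashLeft counitDual ∘ₗ antipode))
    (phi k H)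

end HeisenbergDouble

end

/-! Evaluating the functionals in the last two legs at arbitrary `a, b` loses no information and
collapses the dual-basis sums, so both equations become identities in tensor powers of `H`. For `W̄`
the two sides become the same expression in `Φ⁻¹ (1 ⊗ Δ(b))`; beyond the definition of the product
only the counit normalizations of `Φ` enter.

For `Ŵ` the left side becomes a function of `(Ṽ ⊗ 1)(Δ ⊗ id)(Ṽ) Φ⁻¹ (1 ⊗ Δ(b))`, the right side one
of `∑ (1 ⊗ X¹ ⊗ X²)(id ⊗ Δ)(Ṽ Δ(S(X³)))`. Two properties of `Ṽ` match them: the covariance `∑ (1 ⊗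
h₁) Ṽ Δ(S(h₂)) = (S(h) ⊗ 1) Ṽ` (`isCovariant_vElem`), which extracts `b`, and the twisted cocycle
identity `vProd_eq_outerSandwich`.

Covariance follows from `f Δ(S(h)) = (S ⊗ S)(Δᶜᵒᵖ(h)) f`. The cocycle identity comes from a
uniqueness principle (`IsCovariant.eq`): a covariant `T` is determined by its invariant `∑ l(X¹) T
r(S(X²) α X³)`. The invariant of `Ṽ` is `q_L = ∑ S(x¹) α x² ⊗ x³` (`sandwichAlpha_vElem`, which also
needs `f Δ(α) = γ`). Once `Φ` is moved to one side, both sides of the cocycle identity are covariant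
for the same data and have invariant `(id ⊗ Δ)(q_L)`, so no formula for the twisted associator of
`f` is required.

The recurring computation: a contraction built from `S(a) α b` or `a β S(b)` turns a coproduct into
a counit. Rewrite a product of associators by the pentagon; every factor in which a contracted pair
carries a coproduct then becomes a counital contraction of `Φ` or `Φ⁻¹`, hence `1`.

Bijectivity of `S` uses a nonzero left integral, found by a finite-dimensional form of the
fundamental theorem of Hopf modules. Bracketing is harmless because in each leg of each triple
product some entry is the unit `1 # ε` or the leftmost entry is `a # ε`, and left multiplication by
`a # ε` associates. -/

noncomputable section

set_option maxSynthPendingDepth 3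

namespace QuasiHopf

open QuasiBialgebra QuasiHopfAlgebra

/-! ### Reduction to pure tensors in threefold and fourfold tensor products. -/

section Induction

variable {k A B C D : Type*} [CommSemiring k] [AddCommMonoid A] [Module k A] [AddCommMonoid B]
  [Module k B] [AddCommMonoid C] [Module k C] [AddCommMonoid D] [Module k D]

theorem tensor_induction₃ {p : A ⊗[k] (B ⊗[k] C) → Prop} (x : A ⊗[k] (B ⊗[k] C)) (zero : p 0)
    (tmul : ∀ a b c, p (a ⊗ₜ (b ⊗ₜ c))) (add : ∀ x y, p x → p y → p (x + y)) : p x := by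
  induction x using TensorProduct.induction_on with
  | zero => exact zero
  | add x y hx hy => exact add x y hx hy
  | tmul a y =>
    induction y using TensorProduct.induction_on with
    | zero => simpa using zero
    | add x y hx hy => rw [TensorProduct.tmul_add]; exact add _ _ hx hy
    | tmul b c => exact tmul a b c

theorem tensor_induction₄ {p : A ⊗[k] (B ⊗[k] (C ⊗[k] D)) → Prop}
    (x : A ⊗[k] (B ⊗[k] (C ⊗[k] D))) (zero : p 0)
    (tmul : ∀ a b c d, p (a ⊗ₜ (b ⊗ₜ (c ⊗ₜ d)))) (add : ∀ x y, p x → p y → p (x + y)) : p x := by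
  induction x using TensorProduct.induction_on with
  | zero => exact zero
  | add x y hx hy => exact add x y hx hy
  | tmul a y =>
    induction y using tensor_induction₃ with
    | zero => simpa using zero
    | add x y hx hy => rw [TensorProduct.tmul_add]; exact add _ _ hx hy
    | tmul b c d => exact tmul a b c d

end Induction

/-! ### Padding, coproduct and counit maps between tensor powers. -/

section Pad

variable (k H : Type*) [Field k] [Ring H] [Algebra k H]

/-- `x ↦ 1 ⊗ x` on `H ⊗ H ⊗ H`. -/
def padLeft : H ⊗[k] (H ⊗[k] H) →ₐ[k] H ⊗[k] (H ⊗[k] (H ⊗[k] H)) :=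
  Algebra.TensorProduct.includeRight

/-- `x ↦ x ⊗ 1` on `H ⊗ H ⊗ H`. -/
def padRight : H ⊗[k] (H ⊗[k] H) →ₐ[k] H ⊗[k] (H ⊗[k] (H ⊗[k] H)) :=
  Algebra.TensorProduct.map (AlgHom.id k H)
    (Algebra.TensorProduct.map (AlgHom.id k H) Algebra.TensorProduct.includeLeft)

variable {k H}

@[simp] theorem padLeft_apply (x : H ⊗[k] (H ⊗[k] H)) : padLeft k H x = (1 : H) ⊗ₜ[k] x := rfl
@[simp] theorem padRight_tmul (a b c : H) :
    padRight k H (a ⊗ₜ[k] (b ⊗ₜ[k] c)) = a ⊗ₜ (b ⊗ₜ (c ⊗ₜ 1)) := rfl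

end Pad

section Bialgebra

variable (k H : Type*) [Field k] [Ring H] [Algebra k H] [QuasiBialgebra k H]

/-- `Δ ⊗ id` on `H ⊗ H`. -/
def comulLeft : H ⊗[k] H →ₐ[k] H ⊗[k] (H ⊗[k] H) :=
  (Algebra.TensorProduct.assoc k k k H H H).toAlgHom.comp
    (Algebra.TensorProduct.map comul (AlgHom.id k H))

/-- `id ⊗ Δ` on `H ⊗ H`. -/
def comulRight : H ⊗[k] H →ₐ[k] H ⊗[k] (H ⊗[k] H) :=
  Algebra.TensorProduct.map (AlgHom.id k H) comul

/-- `Δ ⊗ id ⊗ id` on `H ⊗ H ⊗ H`. -/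
def comulFst : H ⊗[k] (H ⊗[k] H) →ₐ[k] H ⊗[k] (H ⊗[k] (H ⊗[k] H)) :=
  (Algebra.TensorProduct.assoc k k k H H (H ⊗[k] H)).toAlgHom.comp
    (Algebra.TensorProduct.map comul (AlgHom.id k (H ⊗[k] H)))

/-- `id ⊗ Δ ⊗ id` on `H ⊗ H ⊗ H`. -/
def comulSnd : H ⊗[k] (H ⊗[k] H) →ₐ[k] H ⊗[k] (H ⊗[k] (H ⊗[k] H)) :=
  Algebra.TensorProduct.map (AlgHom.id k H) (comulLeft k H)

/-- `id ⊗ id ⊗ Δ` on `H ⊗ H ⊗ H`. -/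
def comulThd : H ⊗[k] (H ⊗[k] H) →ₐ[k] H ⊗[k] (H ⊗[k] (H ⊗[k] H)) :=
  Algebra.TensorProduct.map (AlgHom.id k H) (comulRight k H)

/-- `ε ⊗ id` on `H ⊗ A`. -/
def counitTensor (A : Type*) [Ring A] [Algebra k A] : H ⊗[k] A →ₐ[k] A :=
  (Algebra.TensorProduct.lid k A).toAlgHom.comp
    (Algebra.TensorProduct.map counit (AlgHom.id k A))

/-- `id ⊗ ε` on `A ⊗ H`. -/
def tensorCounit (A : Type*) [Ring A] [Algebra k A] : A ⊗[k] H →ₐ[k] A :=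
  (Algebra.TensorProduct.rid k k A).toAlgHom.comp
    (Algebra.TensorProduct.map (AlgHom.id k A) counit)

end Bialgebra

/-! ### Counital contractions of the associator. -/

section

variable {k H : Type*} [Field k] [Ring H] [Algebra k H] [QuasiBialgebra k H]

local notation "Δ" => QuasiBialgebra.comul (k := k) (H := H)
local notation "ε" => QuasiBialgebra.counit (k := k) (H := H)
local notation "Φ" => phi k H
local notation "Φi" => phiInv k H

@[simp] theorem comulLeft_tmul (a b : H) :
    comulLeft k H (a ⊗ₜ b) = Algebra.TensorProduct.assoc k k k H H H (Δ a ⊗ₜ b) := rfl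
@[simp] theorem comulRight_tmul (a b : H) : comulRight k H (a ⊗ₜ b) = a ⊗ₜ Δ b := rfl
@[simp] theorem comulFst_tmul (a : H) (b : H ⊗[k] H) : comulFst k H (a ⊗ₜ b) =
    Algebra.TensorProduct.assoc k k k H H (H ⊗[k] H) (Δ a ⊗ₜ b) := rfl
@[simp] theorem comulSnd_tmul (a : H) (b : H ⊗[k] H) :
    comulSnd k H (a ⊗ₜ b) = a ⊗ₜ comulLeft k H b := rfl
@[simp] theorem comulThd_tmul (a : H) (b : H ⊗[k] H) :
    comulThd k H (a ⊗ₜ b) = a ⊗ₜ comulRight k H b := rfl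
@[simp] theorem counitTensor_tmul {A : Type*} [Ring A] [Algebra k A] (a : H) (b : A) :
    counitTensor k H A (a ⊗ₜ b) = ε a • b := by simp [counitTensor]
@[simp] theorem tensorCounit_tmul {A : Type*} [Ring A] [Algebra k A] (a : A) (b : H) :
    tensorCounit k H A (a ⊗ₜ b) = ε b • a := by simp [tensorCounit]

@[simp] theorem phi_mul_phiInv : Φ * Φi = 1 := Units.mul_inv _
@[simp] theorem phiInv_mul_phi : Φi * Φ = 1 := Units.inv_mul _
@[simp] theorem phiInv_mul_phi_mul (x : H ⊗[k] (H ⊗[k] H)) : Φi * (Φ * x) = x :=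
  Units.inv_mul_cancel_left _ _

theorem counitTensor_comul (h : H) : counitTensor k H H (Δ h) = h := counit_left h
theorem tensorCounit_comul (h : H) : tensorCounit k H H (Δ h) = h := counit_right h

theorem comulRight_comul_mul_phi (h : H) :
    comulRight k H (Δ h) * Φ = Φ * comulLeft k H (Δ h) := by
  have := coassoc (k := k) h
  change comulRight k H (Δ h) = Φ * comulLeft k H (Δ h) * Φi at this
  rw [this, mul_assoc, phiInv_mul_phi, mul_one]

theorem phiInv_mul_comulRight_comul (h : H) :
    Φi * comulRight k H (Δ h) = comulLeft k H (Δ h) * Φi := by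
  have := coassoc (k := k) h
  change comulRight k H (Δ h) = Φ * comulLeft k H (Δ h) * Φi at this
  rw [this, mul_assoc Φ, phiInv_mul_phi_mul]

theorem pentagon_phi : padLeft k H Φ * comulSnd k H Φ * padRight k H Φ =
    comulThd k H Φ * comulFst k H Φ := QuasiBialgebra.pentagon

/-- `ε` in the middle factor of `H ⊗ H ⊗ H`. -/
theorem counitTensor_snd_phi :
    Algebra.TensorProduct.map (AlgHom.id k H) (counitTensor k H H) Φ = 1 := counit_assoc

theorem counitTensor_snd_phiInv :
    Algebra.TensorProduct.map (AlgHom.id k H) (counitTensor k H H) Φi = 1 := by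
  have := congrArg (Algebra.TensorProduct.map (AlgHom.id k H) (counitTensor k H H))
    (phi_mul_phiInv (k := k) (H := H))
  rwa [map_mul, counitTensor_snd_phi, one_mul, map_one] at this

theorem counitTensor_comulLeft_assoc (A : Type*) [Ring A] [Algebra k A] (D : H ⊗[k] H) (b : A) :
    counitTensor k H (H ⊗[k] A) (Algebra.TensorProduct.assoc k k k H H A (D ⊗ₜ b)) =
      counitTensor k H H D ⊗ₜ b := by
  induction D using TensorProduct.induction_on with
  | zero => simp
  | tmul x y => simp [TensorProduct.smul_tmul']
  | add x y hx hy => simp [TensorProduct.add_tmul, hx, hy]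

theorem snd_counitTensor_assoc (A : Type*) [Ring A] [Algebra k A] (D : H ⊗[k] H) (b : A) :
    Algebra.TensorProduct.map (AlgHom.id k H) (counitTensor k H A)
      (Algebra.TensorProduct.assoc k k k H H A (D ⊗ₜ b)) =
      tensorCounit k H H D ⊗ₜ b := by
  induction D using TensorProduct.induction_on with
  | zero => simp
  | tmul x y => simp [TensorProduct.smul_tmul']
  | add x y hx hy => simp [TensorProduct.add_tmul, hx, hy]

/-- Apply `ε` to the second factor of the pentagon. The terms with `Δ` on the first or second factor
become `Φ`; the padded and last-coproduct terms become `1` by the middle normalization. Cancelling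
`Φ` leaves `1 ⊗ (ε ⊗ id ⊗ id)(Φ) = 1`. -/
theorem counitTensor_phi : counitTensor k H (H ⊗[k] H) Φ = 1 := by
  let m := Algebra.TensorProduct.map (AlgHom.id k H) (counitTensor k H (H ⊗[k] H))
  have h := congrArg m (pentagon_phi (k := k) (H := H))
  have h2 : ∀ x, m (comulSnd k H x) = x := by
    intro x
    induction x using tensor_induction₃ with
    | zero => simp
    | add x y hx hy => simp [hx, hy]
    | tmul a b c => simp [m, counitTensor_comulLeft_assoc, counitTensor_comul]
  have h3 : ∀ x, m (comulFst k H x) = x := by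
    intro x
    induction x using TensorProduct.induction_on with
    | zero => simp
    | add x y hx hy => simp [hx, hy]
    | tmul a y => simp [m, snd_counitTensor_assoc, tensorCounit_comul]
  have h4 : ∀ x, m (padRight k H x) = Algebra.TensorProduct.map (AlgHom.id k H)
      Algebra.TensorProduct.includeLeft
      (Algebra.TensorProduct.map (AlgHom.id k H) (counitTensor k H H) x) := by
    intro x
    induction x using tensor_induction₃ with
    | zero => simp
    | add x y hx hy => simp [hx, hy]
    | tmul a b c => simp [m]
  have h5 : ∀ x, m (comulThd k H x) = Algebra.TensorProduct.map (AlgHom.id k H) Δ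
      (Algebra.TensorProduct.map (AlgHom.id k H) (counitTensor k H H) x) := by
    intro x
    induction x using tensor_induction₃ with
    | zero => simp
    | add x y hx hy => simp [hx, hy]
    | tmul a b c => simp [m]
  rw [map_mul, map_mul, map_mul, h2, h3, h4, h5, counitTensor_snd_phi, map_one, map_one, mul_one,
    one_mul] at h
  have h6 : m (padLeft k H Φ) = 1 := by
    have := congrArg (· * Φi) h
    simpa [mul_assoc] using this
  have h7 := congrArg (counitTensor k H _) h6
  simpa [m] using h7

/-- The mirror argument: `ε` in the third factor of the pentagon. -/
theorem thd_tensorCounit_phi :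
    Algebra.TensorProduct.map (AlgHom.id k H) (tensorCounit k H H) Φ = 1 := by
  let m := Algebra.TensorProduct.map (AlgHom.id k H)
    (Algebra.TensorProduct.map (AlgHom.id k H) (counitTensor k H H))
  have h := congrArg m (pentagon_phi (k := k) (H := H))
  have h2 : ∀ x, m (comulSnd k H x) = x := by
    intro x
    induction x using tensor_induction₃ with
    | zero => simp
    | add x y hx hy => simp [hx, hy]
    | tmul a b c => simp [m, snd_counitTensor_assoc, tensorCounit_comul]
  have h3 : ∀ x, m (comulThd k H x) = x := by
    intro x
    induction x using tensor_induction₃ with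
    | zero => simp
    | add x y hx hy => simp [hx, hy]
    | tmul a b c => simp [m, counitTensor_comul]
  have h4 : m (padLeft k H Φ) = 1 := by
    simp [m, counitTensor_snd_phi, Algebra.TensorProduct.one_def]
  have h5 : ∀ x, m (comulFst k H x) = comulLeft k H
      (Algebra.TensorProduct.map (AlgHom.id k H) (counitTensor k H H) x) := by
    intro x
    induction x using TensorProduct.induction_on with
    | zero => simp
    | add x y hx hy => simp [hx, hy]
    | tmul a y =>
      simp only [comulFst_tmul, Algebra.TensorProduct.map_tmul, comulLeft_tmul, AlgHom.id_apply]
      generalize Δ a = D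
      induction D using TensorProduct.induction_on with
      | zero => simp
      | add x y hx hy => simp [TensorProduct.add_tmul, hx, hy]
      | tmul b c => simp [m]
  have h6 : ∀ x, m (padRight k H x) = Algebra.TensorProduct.map (AlgHom.id k H)
      Algebra.TensorProduct.includeLeft
      (Algebra.TensorProduct.map (AlgHom.id k H) (tensorCounit k H H) x) := by
    intro x
    induction x using tensor_induction₃ with
    | zero => simp
    | add x y hx hy => simp [hx, hy]
    | tmul a b c => simp [m]
  rw [map_mul, map_mul, map_mul, h2, h3, h4, h5, h6, counitTensor_snd_phi, map_one, mul_one,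
    one_mul] at h
  have h7 := congrArg (fun t => Algebra.TensorProduct.map (AlgHom.id k H) (tensorCounit k H H)
    (Φi * t)) h
  simp only [phiInv_mul_phi_mul, phiInv_mul_phi, map_one] at h7
  rw [← h7]
  generalize Algebra.TensorProduct.map (AlgHom.id k H) (tensorCounit k H H) Φ = D
  induction D using TensorProduct.induction_on with
  | zero => simp
  | add x y hx hy => simp only [map_add]; rw [← hx, ← hy]
  | tmul b c => simp

theorem counitTensor_phiInv : counitTensor k H (H ⊗[k] H) Φi = 1 := by
  have := congrArg (counitTensor k H (H ⊗[k] H)) (phi_mul_phiInv (k := k) (H := H))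
  rwa [map_mul, counitTensor_phi, one_mul, map_one] at this

theorem thd_tensorCounit_phiInv :
    Algebra.TensorProduct.map (AlgHom.id k H) (tensorCounit k H H) Φi = 1 := by
  have := congrArg (Algebra.TensorProduct.map (AlgHom.id k H) (tensorCounit k H H))
    (phi_mul_phiInv (k := k) (H := H))
  rwa [map_mul, thd_tensorCounit_phi, one_mul, map_one] at this

end

end QuasiHopf
end

noncomputable section

set_option maxSynthPendingDepth 3

namespace QuasiHopf

open QuasiBialgebra QuasiHopfAlgebra

section

variable {k H : Type*} [Field k] [Ring H] [Algebra k H] [QuasiBialgebra k H]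

local notation "Δ" => QuasiBialgebra.comul (k := k) (H := H)
local notation "ε" => QuasiBialgebra.counit (k := k) (H := H)
local notation "Φ" => phi k H
local notation "Φi" => phiInv k H

/-! ### Absorption of counital elements by a contraction. -/

section Absorb

variable {B M : Type*} [Ring B] [Algebra k B] [AddCommGroup M] [Module k M]
  (d : H ⊗[k] (H ⊗[k] H) →ₐ[k] B) (C : B →ₗ[k] M)

/-- Here `d` will be a coproduct in one slot and `C` a contraction that turns that coproduct into a
counit. Such a `C` sees `d(Z)` only through the counital contraction of `Z`. -/
theorem map_comul_fst_mul (hC : ∀ h T, C (d (h ⊗ₜ 1) * T) = ε h • C T)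
    (Z : H ⊗[k] (H ⊗[k] H)) (T : B) :
    C (d Z * T) = C (d (1 ⊗ₜ counitTensor k H (H ⊗[k] H) Z) * T) := by
  induction Z using TensorProduct.induction_on with
  | zero => simp
  | add x y hx hy => simp only [map_add, add_mul, TensorProduct.tmul_add, hx, hy]
  | tmul a x =>
    have : a ⊗ₜ[k] x = (a ⊗ₜ 1) * (1 ⊗ₜ x) := by simp
    rw [this, map_mul d, mul_assoc, hC]; simp

theorem map_mul_comul_fst (hC : ∀ h T, C (T * d (h ⊗ₜ 1)) = ε h • C T)
    (Z : H ⊗[k] (H ⊗[k] H)) (T : B) :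
    C (T * d Z) = C (T * d (1 ⊗ₜ counitTensor k H (H ⊗[k] H) Z)) := by
  induction Z using TensorProduct.induction_on with
  | zero => simp
  | add x y hx hy => simp only [map_add, mul_add, TensorProduct.tmul_add, hx, hy]
  | tmul a x =>
    have : a ⊗ₜ[k] x = (1 ⊗ₜ x) * (a ⊗ₜ 1) := by simp
    rw [this, map_mul d, ← mul_assoc, hC]; simp

theorem map_comul_snd_mul (hC : ∀ h T, C (d (1 ⊗ₜ (h ⊗ₜ 1)) * T) = ε h • C T)
    (Z : H ⊗[k] (H ⊗[k] H)) (T : B) :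
    C (d Z * T) = C (d (Algebra.TensorProduct.map (AlgHom.id k H)
      ((Algebra.TensorProduct.includeRight : H →ₐ[k] H ⊗[k] H).comp (counitTensor k H H)) Z)
        * T) := by
  induction Z using tensor_induction₃ with
  | zero => simp
  | add x y hx hy => simp only [map_add, add_mul, hx, hy]
  | tmul a b c =>
    have : a ⊗ₜ[k] (b ⊗ₜ[k] c) = (1 ⊗ₜ (b ⊗ₜ 1)) * (a ⊗ₜ (1 ⊗ₜ c)) := by simp
    rw [this, map_mul d, mul_assoc, hC]; simp

theorem map_mul_comul_snd (hC : ∀ h T, C (T * d (1 ⊗ₜ (h ⊗ₜ 1))) = ε h • C T)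
    (Z : H ⊗[k] (H ⊗[k] H)) (T : B) :
    C (T * d Z) = C (T * d (Algebra.TensorProduct.map (AlgHom.id k H)
      ((Algebra.TensorProduct.includeRight : H →ₐ[k] H ⊗[k] H).comp (counitTensor k H H)) Z)) := by
  induction Z using tensor_induction₃ with
  | zero => simp
  | add x y hx hy => simp only [map_add, mul_add, hx, hy]
  | tmul a b c =>
    have : a ⊗ₜ[k] (b ⊗ₜ[k] c) = (a ⊗ₜ (1 ⊗ₜ c)) * (1 ⊗ₜ (b ⊗ₜ 1)) := by simp
    rw [this, map_mul d, ← mul_assoc, hC]; simp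

theorem map_comul_thd_mul (hC : ∀ h T, C (d (1 ⊗ₜ (1 ⊗ₜ h)) * T) = ε h • C T)
    (Z : H ⊗[k] (H ⊗[k] H)) (T : B) :
    C (d Z * T) = C (d (Algebra.TensorProduct.map (AlgHom.id k H)
      ((Algebra.TensorProduct.includeLeft : H →ₐ[k] H ⊗[k] H).comp (tensorCounit k H H)) Z)
        * T) := by
  induction Z using tensor_induction₃ with
  | zero => simp
  | add x y hx hy => simp only [map_add, add_mul, hx, hy]
  | tmul a b c =>
    have : a ⊗ₜ[k] (b ⊗ₜ[k] c) = (1 ⊗ₜ (1 ⊗ₜ c)) * (a ⊗ₜ (b ⊗ₜ 1)) := by simp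
    rw [this, map_mul d, mul_assoc, hC]
    simp

theorem map_mul_comul_thd (hC : ∀ h T, C (T * d (1 ⊗ₜ (1 ⊗ₜ h))) = ε h • C T)
    (Z : H ⊗[k] (H ⊗[k] H)) (T : B) :
    C (T * d Z) = C (T * d (Algebra.TensorProduct.map (AlgHom.id k H)
      ((Algebra.TensorProduct.includeLeft : H →ₐ[k] H ⊗[k] H).comp (tensorCounit k H H)) Z)) := by
  induction Z using tensor_induction₃ with
  | zero => simp
  | add x y hx hy => simp only [map_add, mul_add, hx, hy]
  | tmul a b c =>
    have : a ⊗ₜ[k] (b ⊗ₜ[k] c) = (a ⊗ₜ (b ⊗ₜ 1)) * (1 ⊗ₜ (1 ⊗ₜ c)) := by simp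
    rw [this, map_mul d, ← mul_assoc, hC]
    simp

/-- The associator and its inverse: the elements all of whose counital contractions are `1`. -/
structure IsCounital (Z : H ⊗[k] (H ⊗[k] H)) : Prop where
  fst : counitTensor k H (H ⊗[k] H) Z = 1
  snd : Algebra.TensorProduct.map (AlgHom.id k H) (counitTensor k H H) Z = 1
  thd : Algebra.TensorProduct.map (AlgHom.id k H) (tensorCounit k H H) Z = 1

theorem isCounital_phi : IsCounital Φ :=
  ⟨counitTensor_phi, counitTensor_snd_phi, thd_tensorCounit_phi⟩

theorem isCounital_phiInv : IsCounital Φi :=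
  ⟨counitTensor_phiInv, counitTensor_snd_phiInv, thd_tensorCounit_phiInv⟩

variable {d C}

/-- With `Z = Φ` or `Φ⁻¹`, this and its five variants delete the outer factors of a pentagon under a
contraction. -/
theorem absorb_fst_left {Z : H ⊗[k] (H ⊗[k] H)} (hZ : IsCounital Z)
    (hC : ∀ h T, C (d (h ⊗ₜ 1) * T) = ε h • C T) (T : B) : C (d Z * T) = C T := by
  rw [map_comul_fst_mul d C hC, hZ.fst, ← Algebra.TensorProduct.one_def, map_one, one_mul]

theorem absorb_fst_right {Z : H ⊗[k] (H ⊗[k] H)} (hZ : IsCounital Z)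
    (hC : ∀ h T, C (T * d (h ⊗ₜ 1)) = ε h • C T) (T : B) : C (T * d Z) = C T := by
  rw [map_mul_comul_fst d C hC, hZ.fst, ← Algebra.TensorProduct.one_def, map_one, mul_one]

theorem IsCounital.snd' {Z : H ⊗[k] (H ⊗[k] H)} (hZ : IsCounital Z) :
    Algebra.TensorProduct.map (AlgHom.id k H)
      ((Algebra.TensorProduct.includeRight : H →ₐ[k] H ⊗[k] H).comp (counitTensor k H H)) Z =
        1 := by
  rw [← AlgHom.comp_id (AlgHom.id k H), Algebra.TensorProduct.map_comp, AlgHom.comp_apply,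
    hZ.snd, map_one]

theorem IsCounital.thd' {Z : H ⊗[k] (H ⊗[k] H)} (hZ : IsCounital Z) :
    Algebra.TensorProduct.map (AlgHom.id k H)
      ((Algebra.TensorProduct.includeLeft : H →ₐ[k] H ⊗[k] H).comp (tensorCounit k H H)) Z =
        1 := by
  rw [← AlgHom.comp_id (AlgHom.id k H), Algebra.TensorProduct.map_comp, AlgHom.comp_apply,
    hZ.thd, map_one]

theorem absorb_snd_left {Z : H ⊗[k] (H ⊗[k] H)} (hZ : IsCounital Z)
    (hC : ∀ h T, C (d (1 ⊗ₜ (h ⊗ₜ 1)) * T) = ε h • C T) (T : B) : C (d Z * T) = C T := by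
  rw [map_comul_snd_mul d C hC, hZ.snd', map_one, one_mul]

theorem absorb_snd_right {Z : H ⊗[k] (H ⊗[k] H)} (hZ : IsCounital Z)
    (hC : ∀ h T, C (T * d (1 ⊗ₜ (h ⊗ₜ 1))) = ε h • C T) (T : B) : C (T * d Z) = C T := by
  rw [map_mul_comul_snd d C hC, hZ.snd', map_one, mul_one]

theorem absorb_thd_left {Z : H ⊗[k] (H ⊗[k] H)} (hZ : IsCounital Z)
    (hC : ∀ h T, C (d (1 ⊗ₜ (1 ⊗ₜ h)) * T) = ε h • C T) (T : B) : C (d Z * T) = C T := by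
  rw [map_comul_thd_mul d C hC, hZ.thd', map_one, one_mul]

theorem absorb_thd_right {Z : H ⊗[k] (H ⊗[k] H)} (hZ : IsCounital Z)
    (hC : ∀ h T, C (T * d (1 ⊗ₜ (1 ⊗ₜ h))) = ε h • C T) (T : B) : C (T * d Z) = C T := by
  rw [map_mul_comul_thd d C hC, hZ.thd', map_one, mul_one]

end Absorb

/-! ### Solved forms of the pentagon, and quasi-coassociativity with spectator factors. -/

section Pentagon

theorem map_phi_mul_map_phiInv {B : Type*} [Ring B] [Algebra k B]
    (d : H ⊗[k] (H ⊗[k] H) →ₐ[k] B) : d Φ * d Φi = 1 := by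
  rw [← map_mul, phi_mul_phiInv, map_one]

theorem map_phiInv_mul_map_phi {B : Type*} [Ring B] [Algebra k B]
    (d : H ⊗[k] (H ⊗[k] H) →ₐ[k] B) : d Φi * d Φ = 1 := by
  rw [← map_mul, phiInv_mul_phi, map_one]

theorem padRight_phi_mul_comulFst_phiInv : padRight k H Φ * comulFst k H Φi =
    comulSnd k H Φi * padLeft k H Φi * comulThd k H Φ := by
  have h := congrArg (fun t => comulSnd k H Φi * (padLeft k H Φi * t * comulFst k H Φi))
    (pentagon_phi (k := k) (H := H))
  simp only [mul_assoc, map_phi_mul_map_phiInv, mul_one] at h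
  rw [← mul_assoc (padLeft k H Φi) (padLeft k H Φ), map_phiInv_mul_map_phi, one_mul,
    ← mul_assoc (comulSnd k H Φi), map_phiInv_mul_map_phi, one_mul] at h
  rw [h, mul_assoc]

theorem comulFst_phi_mul_padRight_phiInv : comulFst k H Φ * padRight k H Φi =
    comulThd k H Φi * padLeft k H Φ * comulSnd k H Φ := by
  have h := congrArg (fun t => comulThd k H Φi * (t * padRight k H Φi))
    (pentagon_phi (k := k) (H := H))
  simp only [mul_assoc, map_phi_mul_map_phiInv, mul_one] at h
  rw [← mul_assoc (comulThd k H Φi) (comulThd k H Φ), map_phiInv_mul_map_phi, one_mul] at h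
  rw [← h, mul_assoc]

theorem padLeft_phiInv_mul_comulThd_phi : padLeft k H Φi * comulThd k H Φ =
    comulSnd k H Φ * padRight k H Φ * comulFst k H Φi := by
  have h := congrArg (fun t => padLeft k H Φi * (t * comulFst k H Φi))
    (pentagon_phi (k := k) (H := H))
  simp only [mul_assoc, map_phi_mul_map_phiInv, mul_one] at h
  rw [← mul_assoc (padLeft k H Φi) (padLeft k H Φ), map_phiInv_mul_map_phi, one_mul] at h
  rw [← h, mul_assoc]

theorem padRight_mul_comulSnd_mul_padLeft_phiInv :
    padRight k H Φi * comulSnd k H Φi * padLeft k H Φi =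
      comulFst k H Φi * comulThd k H Φi := by
  have h := congrArg (fun t => comulFst k H Φi * comulThd k H Φi * t *
    (padRight k H Φi * comulSnd k H Φi * padLeft k H Φi)) (pentagon_phi (k := k) (H := H))
  have h1 : padLeft k H Φ * comulSnd k H Φ * padRight k H Φ *
      (padRight k H Φi * comulSnd k H Φi * padLeft k H Φi) = 1 := by
    rw [mul_assoc, mul_assoc (padRight k H Φi), ← mul_assoc (padRight k H Φ),
      map_phi_mul_map_phiInv, one_mul, mul_assoc, ← mul_assoc (comulSnd k H Φ),
      map_phi_mul_map_phiInv, one_mul, map_phi_mul_map_phiInv]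
  have h2 : comulFst k H Φi * comulThd k H Φi * (comulThd k H Φ * comulFst k H Φ) = 1 := by
    rw [mul_assoc, ← mul_assoc (comulThd k H Φi), map_phiInv_mul_map_phi, one_mul,
      map_phiInv_mul_map_phi]
  rw [h2, one_mul, mul_assoc, h1, mul_one] at h
  exact h.symm

theorem comulFst_comulLeft_tmul (a b : H) : comulFst k H (comulLeft k H (a ⊗ₜ b)) =
    padRight k H (comulLeft k H (Δ a)) * (1 ⊗ₜ (1 ⊗ₜ (1 ⊗ₜ b))) := by
  rw [comulLeft_tmul]
  generalize Δ a = D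
  induction D using TensorProduct.induction_on with
  | zero => simp
  | add x y hx hy => simp only [TensorProduct.add_tmul, map_add, hx, hy, add_mul]
  | tmul x y =>
    simp only [Algebra.TensorProduct.assoc_tmul, comulFst_tmul, comulLeft_tmul]
    generalize Δ x = D
    induction D using TensorProduct.induction_on with
    | zero => simp
    | add x y hx hy => simp only [TensorProduct.add_tmul, map_add, hx, hy, add_mul]
    | tmul x z => simp

theorem comulSnd_comulLeft_tmul (a b : H) : comulSnd k H (comulLeft k H (a ⊗ₜ b)) =
    padRight k H (comulRight k H (Δ a)) * (1 ⊗ₜ (1 ⊗ₜ (1 ⊗ₜ b))) := by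
  rw [comulLeft_tmul]
  generalize Δ a = D
  induction D using TensorProduct.induction_on with
  | zero => simp
  | add x y hx hy => simp only [TensorProduct.add_tmul, map_add, hx, hy, add_mul]
  | tmul x y =>
    simp only [Algebra.TensorProduct.assoc_tmul, comulSnd_tmul, comulLeft_tmul, comulRight_tmul]
    generalize Δ y = D
    induction D using TensorProduct.induction_on with
    | zero => simp
    | add x y hx hy =>
      simp only [TensorProduct.add_tmul, TensorProduct.tmul_add, map_add, hx, hy, add_mul]
    | tmul x z => simp

omit [QuasiBialgebra k H] in
theorem padRight_mul_comm (x : H ⊗[k] (H ⊗[k] H)) (b : H) :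
    padRight k H x * (1 ⊗ₜ (1 ⊗ₜ (1 ⊗ₜ b))) = (1 ⊗ₜ (1 ⊗ₜ (1 ⊗ₜ b))) * padRight k H x := by
  induction x using tensor_induction₃ with
  | zero => simp
  | add x y hx hy => simp only [map_add, add_mul, mul_add, hx, hy]
  | tmul a b c => simp

/-- Quasi-coassociativity acts on the first three factors; the fourth is a spectator and commutes
with `Φ ⊗ 1`. -/
theorem padRight_phi_mul_comulFst_comulLeft (y : H ⊗[k] H) :
    padRight k H Φ * comulFst k H (comulLeft k H y) =
      comulSnd k H (comulLeft k H y) * padRight k H Φ := by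
  induction y using TensorProduct.induction_on with
  | zero => simp
  | add x y hx hy => simp only [map_add, add_mul, mul_add, hx, hy]
  | tmul a b =>
    rw [comulFst_comulLeft_tmul, comulSnd_comulLeft_tmul, ← mul_assoc, ← map_mul,
      ← comulRight_comul_mul_phi, map_mul, mul_assoc, padRight_mul_comm, mul_assoc]

omit [QuasiBialgebra k H] in
theorem tmul_tmul_eq_assoc {A : Type*} [Ring A] [Algebra k A] (a b : H) (c : A) :
    a ⊗ₜ[k] (b ⊗ₜ[k] c) = Algebra.TensorProduct.assoc k k k H H A ((a ⊗ₜ b) ⊗ₜ c) := rfl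

theorem comulLeft_mul_tmul (h a b c : H) : comulLeft k H (h ⊗ₜ 1) * (a ⊗ₜ (b ⊗ₜ c)) =
    Algebra.TensorProduct.assoc k k k H H H ((Δ h * (a ⊗ₜ b)) ⊗ₜ c) := by
  rw [comulLeft_tmul, tmul_tmul_eq_assoc, ← map_mul,
    Algebra.TensorProduct.tmul_mul_tmul, one_mul]

theorem tmul_mul_comulLeft (h a b c : H) : (a ⊗ₜ (b ⊗ₜ c)) * comulLeft k H (h ⊗ₜ 1) =
    Algebra.TensorProduct.assoc k k k H H H (((a ⊗ₜ b) * Δ h) ⊗ₜ c) := by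
  rw [comulLeft_tmul, tmul_tmul_eq_assoc, ← map_mul,
    Algebra.TensorProduct.tmul_mul_tmul, mul_one]

theorem comulFst_mul_tmul (h a b : H) (c : H ⊗[k] H) :
    comulFst k H (h ⊗ₜ 1) * (a ⊗ₜ (b ⊗ₜ c)) =
      Algebra.TensorProduct.assoc k k k H H (H ⊗[k] H) ((Δ h * (a ⊗ₜ b)) ⊗ₜ c) := by
  rw [comulFst_tmul, tmul_tmul_eq_assoc, ← map_mul,
    Algebra.TensorProduct.tmul_mul_tmul, one_mul]

theorem tmul_mul_comulFst (h a b : H) (c : H ⊗[k] H) :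
    (a ⊗ₜ (b ⊗ₜ c)) * comulFst k H (h ⊗ₜ 1) =
      Algebra.TensorProduct.assoc k k k H H (H ⊗[k] H) (((a ⊗ₜ b) * Δ h) ⊗ₜ c) := by
  rw [comulFst_tmul, tmul_tmul_eq_assoc, ← map_mul,
    Algebra.TensorProduct.tmul_mul_tmul, mul_one]

theorem comulSnd_mul_tmul (h a b c d : H) :
    comulSnd k H (1 ⊗ₜ (h ⊗ₜ 1)) * (a ⊗ₜ (b ⊗ₜ (c ⊗ₜ d))) =
      a ⊗ₜ Algebra.TensorProduct.assoc k k k H H H ((Δ h * (b ⊗ₜ c)) ⊗ₜ d) := by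
  rw [comulSnd_tmul, Algebra.TensorProduct.tmul_mul_tmul, comulLeft_mul_tmul, one_mul]

theorem tmul_mul_comulSnd (h a b c d : H) :
    (a ⊗ₜ (b ⊗ₜ (c ⊗ₜ d))) * comulSnd k H (1 ⊗ₜ (h ⊗ₜ 1)) =
      a ⊗ₜ Algebra.TensorProduct.assoc k k k H H H (((b ⊗ₜ c) * Δ h) ⊗ₜ d) := by
  rw [comulSnd_tmul, Algebra.TensorProduct.tmul_mul_tmul, tmul_mul_comulLeft, mul_one]

end Pentagon

end

/-! ### Contractions by the antipode. -/

section Hopf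

variable {k H : Type*} [Field k] [Ring H] [Algebra k H] [QuasiHopfAlgebra k H]

local notation "Δ" => QuasiBialgebra.comul (k := k) (H := H)
local notation "ε" => QuasiBialgebra.counit (k := k) (H := H)
local notation "Φ" => phi k H
local notation "Φi" => phiInv k H
local notation "S" => QuasiHopfAlgebra.antipode (k := k) (H := H)
local notation "α" => QuasiHopfAlgebra.α k (H := H)
local notation "β" => QuasiHopfAlgebra.β k (H := H)
local notation "𝓔" => antipodeAlpha k H
local notation "𝓑" => betaAntipode k H

@[simp] theorem antipodeAlpha_tmul (a b : H) : 𝓔 (a ⊗ₜ b) = S a * (α * b) := rfl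
@[simp] theorem betaAntipode_tmul (a b : H) : 𝓑 (a ⊗ₜ b) = a * β * S b := rfl

theorem antipodeAlpha_comul (h : H) : 𝓔 (Δ h) = ε h • α := antipode_left h
theorem betaAntipode_comul (h : H) : 𝓑 (Δ h) = ε h • β := antipode_right h

theorem antipodeAlpha_mul_tmul (D : H ⊗[k] H) (a b : H) :
    𝓔 (D * (a ⊗ₜ b)) = S a * 𝓔 D * b := by
  induction D using TensorProduct.induction_on with
  | zero => simp
  | add x y hx hy => simp only [map_add, add_mul, mul_add, hx, hy]
  | tmul x y => simp [antipode_mul, mul_assoc]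

theorem betaAntipode_tmul_mul (D : H ⊗[k] H) (a b : H) :
    𝓑 ((a ⊗ₜ b) * D) = a * 𝓑 D * S b := by
  induction D using TensorProduct.induction_on with
  | zero => simp
  | add x y hx hy => simp only [map_add, add_mul, mul_add, hx, hy]
  | tmul x y => simp [antipode_mul, mul_assoc]

/-- Antimultiplicativity of `S` sends the entries of `t` to the outside, so the antipode axiom
applies inside. This supplies the absorption hypotheses for `α`; the next lemma does so for `β`,
from the other side. -/
theorem antipodeAlpha_comul_mul (h : H) (t : H ⊗[k] H) : 𝓔 (Δ h * t) = ε h • 𝓔 t := by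
  induction t using TensorProduct.induction_on with
  | zero => simp
  | add x y hx hy => simp only [map_add, mul_add, hx, hy, smul_add]
  | tmul x y => simp [antipodeAlpha_mul_tmul, antipodeAlpha_comul, mul_assoc]

theorem betaAntipode_mul_comul (h : H) (t : H ⊗[k] H) : 𝓑 (t * Δ h) = ε h • 𝓑 t := by
  induction t using TensorProduct.induction_on with
  | zero => simp
  | add x y hx hy => simp only [map_add, add_mul, hx, hy, smul_add]
  | tmul x y => simp [betaAntipode_tmul_mul, betaAntipode_comul, mul_assoc]

variable (k H) in
/-- `a ⊗ b ⊗ c ↦ S(a) α b β S(c)`. -/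
def alphaBeta : H ⊗[k] (H ⊗[k] H) →ₗ[k] H :=
  LinearMap.mul' k H ∘ₗ TensorProduct.map S (LinearMap.mulLeft k α ∘ₗ 𝓑)

variable (k H) in
/-- `a ⊗ b ⊗ c ↦ a β S(b) α c`. -/
def betaAlpha : H ⊗[k] (H ⊗[k] H) →ₗ[k] H :=
  LinearMap.mul' k H ∘ₗ TensorProduct.map (LinearMap.mulRight k β) 𝓔

theorem alphaBeta_tmul (a : H) (D : H ⊗[k] H) :
    alphaBeta k H (a ⊗ₜ D) = S a * (α * 𝓑 D) := rfl
theorem betaAlpha_tmul (a : H) (D : H ⊗[k] H) : betaAlpha k H (a ⊗ₜ D) = a * β * 𝓔 D := rfl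

theorem alphaBeta_assoc (D : H ⊗[k] H) (c : H) :
    alphaBeta k H (Algebra.TensorProduct.assoc k k k H H H (D ⊗ₜ c)) = 𝓔 D * β * S c := by
  induction D using TensorProduct.induction_on with
  | zero => simp
  | add x y hx hy => simp only [TensorProduct.add_tmul, map_add, add_mul, hx, hy]
  | tmul x y => simp [alphaBeta_tmul, mul_assoc]

theorem betaAlpha_assoc (D : H ⊗[k] H) (c : H) :
    betaAlpha k H (Algebra.TensorProduct.assoc k k k H H H (D ⊗ₜ c)) = 𝓑 D * (α * c) := by
  induction D using TensorProduct.induction_on with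
  | zero => simp
  | add x y hx hy => simp only [TensorProduct.add_tmul, map_add, add_mul, hx, hy]
  | tmul x y => simp [betaAlpha_tmul, mul_assoc]

theorem betaAlpha_phi : betaAlpha k H Φ = 1 := antipode_assoc
theorem alphaBeta_phiInv : alphaBeta k H Φi = 1 := antipode_assoc_inv

/-- `∑ X¹ x¹₁ ⊗ S(X² x¹₂) α X³ x² β S(x³) = 1 ⊗ 1`. -/
theorem alphaBeta_padRight_phi_mul_comulFst_phiInv :
    TensorProduct.map LinearMap.id (alphaBeta k H) (padRight k H Φ * comulFst k H Φi) =
      1 ⊗ₜ[k] 1 := by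
  -- The pentagon gives `(id ⊗ Δ ⊗ id)(Φ⁻¹) (1 ⊗ Φ⁻¹) (id ⊗ id ⊗ Δ)(Φ)`. The last factor is absorbed
  -- by `β S`, the first by `S α`, and the middle one gives `∑ S(x¹) α x² β S(x³) = 1`.
  rw [padRight_phi_mul_comulFst_phiInv, absorb_thd_right isCounital_phi,
    absorb_snd_left isCounital_phiInv, padLeft_apply, TensorProduct.map_tmul,
    alphaBeta_phiInv]
  · rfl
  · intro h T
    induction T using tensor_induction₄ with
    | zero => simp
    | add x y hx hy => simp only [map_add, mul_add, hx, hy, smul_add]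
    | tmul a b c d =>
      rw [comulSnd_mul_tmul, TensorProduct.map_tmul, TensorProduct.map_tmul, alphaBeta_assoc,
        antipodeAlpha_comul_mul, tmul_tmul_eq_assoc b, alphaBeta_assoc]
      simp
  · intro h T
    induction T using tensor_induction₄ with
    | zero => simp
    | add x y hx hy => simp only [map_add, add_mul, hx, hy, smul_add]
    | tmul a b c d =>
      simp [alphaBeta_tmul, betaAntipode_mul_comul]

end Hopf
end QuasiHopf
end

noncomputable section

set_option maxSynthPendingDepth 3

namespace QuasiHopf

open QuasiBialgebra QuasiHopfAlgebra

variable {k H : Type*} [Field k] [Ring H] [Algebra k H] [QuasiHopfAlgebra k H]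

local notation "Δ" => QuasiBialgebra.comul (k := k) (H := H)
local notation "ε" => QuasiBialgebra.counit (k := k) (H := H)
local notation "Φ" => phi k H
local notation "Φi" => phiInv k H
local notation "S" => QuasiHopfAlgebra.antipode (k := k) (H := H)
local notation "α" => QuasiHopfAlgebra.α k (H := H)
local notation "β" => QuasiHopfAlgebra.β k (H := H)
local notation "𝓔" => antipodeAlpha k H
local notation "𝓑" => betaAntipode k H

/-! ### Invariance of `γ`. -/

section Gamma

variable (k H) in
/-- `a ⊗ b ⊗ c ⊗ d ↦ S(b) α c ⊗ S(a) α d`. -/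
def gammaMap : H ⊗[k] (H ⊗[k] (H ⊗[k] H)) →ₗ[k] H ⊗[k] H :=
  TensorProduct.map 𝓔 𝓔 ∘ₗ (TensorProduct.leftComm k H (H ⊗[k] H) H).toLinearMap ∘ₗ
    TensorProduct.map LinearMap.id (TensorProduct.assoc k H H H).symm.toLinearMap

theorem gammaMap_padRight_phi_mul_comulFst_phiInv :
    gammaMap k H (padRight k H Φ * comulFst k H Φi) = gamma k H := rfl

theorem gammaMap_tmul (a b c d : H) :
    gammaMap k H (a ⊗ₜ (b ⊗ₜ (c ⊗ₜ d))) = 𝓔 (b ⊗ₜ c) ⊗ₜ 𝓔 (a ⊗ₜ d) := rfl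

theorem gammaMap_tmul_assoc (a d : H) (D : H ⊗[k] H) :
    gammaMap k H (a ⊗ₜ Algebra.TensorProduct.assoc k k k H H H (D ⊗ₜ d)) =
      𝓔 D ⊗ₜ 𝓔 (a ⊗ₜ d) := by
  induction D using TensorProduct.induction_on with
  | zero => simp
  | add x y hx hy =>
    simp only [TensorProduct.add_tmul, TensorProduct.tmul_add, map_add, hx, hy]
  | tmul x y => rfl

variable (k H) in
/-- `h ↦ (S ⊗ S)(Δᶜᵒᵖ(h))`. -/
def antipodeCop : H →ₗ[k] H ⊗[k] H := antipode₂ k H ∘ₗ comulCop k H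

theorem antipode₂_comm_mul (D D' : H ⊗[k] H) :
    antipode₂ k H (TensorProduct.comm k H H (D * D')) =
      antipode₂ k H (TensorProduct.comm k H H D') * antipode₂ k H (TensorProduct.comm k H H D) := by
  induction D using TensorProduct.induction_on with
  | zero => simp
  | add x y hx hy => simp only [map_add, add_mul, mul_add, hx, hy]
  | tmul x y =>
    induction D' using TensorProduct.induction_on with
    | zero => simp
    | add x y hx hy => simp only [map_add, add_mul, mul_add, hx, hy]
    | tmul a b => simp [antipode₂, antipode_mul]

theorem antipodeCop_apply (a : H) :
    antipodeCop k H a = antipode₂ k H (TensorProduct.comm k H H (Δ a)) := rfl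

theorem antipodeCop_mul (a b : H) :
    antipodeCop k H (a * b) = antipodeCop k H b * antipodeCop k H a := by
  simp only [antipodeCop_apply, map_mul, antipode₂_comm_mul]

theorem antipodeCop_one : antipodeCop k H 1 = 1 := by
  simp [antipodeCop_apply, Algebra.TensorProduct.one_def, antipode₂, antipode_one]

variable (k H) in
/-- `a ⊗ b ↦ (S ⊗ S)(Δᶜᵒᵖ(a)) γ Δ(b)`. -/
def antipodeGamma : H ⊗[k] H →ₗ[k] H ⊗[k] H :=
  LinearMap.mul' k (H ⊗[k] H) ∘ₗ TensorProduct.map (antipodeCop k H)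
    (LinearMap.mulLeft k (gamma k H) ∘ₗ AlgHom.toLinearMap Δ)

theorem antipodeGamma_tmul (a b : H) :
    antipodeGamma k H (a ⊗ₜ b) = antipodeCop k H a * (gamma k H * Δ b) := rfl

/-- In `S(b) α c ⊗ S(a) α d` the first two slots are reversed and swapped by `S`, which is why
`Δᶜᵒᵖ` appears on the left of `γ`. -/
theorem gammaMap_mul_assoc_tmul (T : H ⊗[k] (H ⊗[k] (H ⊗[k] H))) (D D' : H ⊗[k] H) :
    gammaMap k H (T * Algebra.TensorProduct.assoc k k k H H (H ⊗[k] H) (D ⊗ₜ D')) =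
      antipode₂ k H (TensorProduct.comm k H H D) * (gammaMap k H T * D') := by
  induction T using tensor_induction₄ with
  | zero => simp
  | add x y hx hy => simp only [map_add, add_mul, mul_add, hx, hy]
  | tmul a b c d =>
    induction D using TensorProduct.induction_on with
    | zero => simp
    | add x y hx hy => simp only [TensorProduct.add_tmul, map_add, mul_add, add_mul, hx, hy]
    | tmul x y =>
      induction D' using TensorProduct.induction_on with
      | zero => simp
      | add x y hx hy => simp only [TensorProduct.tmul_add, map_add, mul_add, hx, hy]
      | tmul z w => simp [gammaMap_tmul, antipode₂, antipode_mul, mul_assoc]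

theorem antipodeGamma_eq (y : H ⊗[k] H) : antipodeGamma k H y =
    gammaMap k H (padRight k H Φ * comulFst k H Φi * comulFst k H (comulRight k H y)) := by
  induction y using TensorProduct.induction_on with
  | zero => simp
  | add x y hx hy => simp only [map_add, mul_add, hx, hy]
  | tmul a b =>
    rw [comulRight_tmul, comulFst_tmul, gammaMap_mul_assoc_tmul,
      gammaMap_padRight_phi_mul_comulFst_phiInv]
    rfl

theorem gammaMap_comulSnd_mul (h : H) (T : H ⊗[k] (H ⊗[k] (H ⊗[k] H))) :
    gammaMap k H (comulSnd k H (1 ⊗ₜ (h ⊗ₜ 1)) * T) = ε h • gammaMap k H T := by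
  induction T using tensor_induction₄ with
  | zero => simp
  | add x y hx hy => simp only [map_add, mul_add, hx, hy, smul_add]
  | tmul a b c d =>
    rw [comulSnd_mul_tmul, gammaMap_tmul_assoc, antipodeAlpha_comul_mul, gammaMap_tmul,
      ← TensorProduct.smul_tmul']

theorem gammaMap_outer_mul (y : H ⊗[k] H) (a b c d : H) :
    gammaMap k H (comulSnd k H (Algebra.TensorProduct.map (AlgHom.id k H)
      (Algebra.TensorProduct.includeRight : H →ₐ[k] H ⊗[k] H) y) * (a ⊗ₜ (b ⊗ₜ (c ⊗ₜ d)))) =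
      𝓔 (b ⊗ₜ c) ⊗ₜ 𝓔 (y * (a ⊗ₜ d)) := by
  induction y using TensorProduct.induction_on with
  | zero => simp
  | add x y hx hy => simp only [TensorProduct.tmul_add, map_add, add_mul, hx, hy]
  | tmul p q => simp [gammaMap_tmul, Algebra.TensorProduct.one_def]

theorem gammaMap_outer_comul_mul (h : H) (T : H ⊗[k] (H ⊗[k] (H ⊗[k] H))) :
    gammaMap k H (comulSnd k H (Algebra.TensorProduct.map (AlgHom.id k H)
      (Algebra.TensorProduct.includeRight : H →ₐ[k] H ⊗[k] H) (Δ h)) * T) =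
      ε h • gammaMap k H T := by
  induction T using tensor_induction₄ with
  | zero => simp
  | add x y hx hy => simp only [map_add, mul_add, hx, hy, smul_add]
  | tmul a b c d =>
    rw [gammaMap_outer_mul, antipodeAlpha_comul_mul, gammaMap_tmul, TensorProduct.tmul_smul]

/-- Once the middle pair is absorbed, `(id ⊗ Δ ⊗ id)((Δ ⊗ id)(y))` retains only the outer slots,
where `S(a) α d` can absorb a second coproduct. -/
theorem map_counitTensor_comulLeft (y : H ⊗[k] H) :
    Algebra.TensorProduct.map (AlgHom.id k H)
      ((Algebra.TensorProduct.includeRight : H →ₐ[k] H ⊗[k] H).comp (counitTensor k H H))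
        (comulLeft k H y) =
      Algebra.TensorProduct.map (AlgHom.id k H)
        (Algebra.TensorProduct.includeRight : H →ₐ[k] H ⊗[k] H) y := by
  rw [← AlgHom.comp_id (AlgHom.id k H), Algebra.TensorProduct.map_comp, AlgHom.comp_apply,
    AlgHom.comp_id]
  congr 1
  induction y using TensorProduct.induction_on with
  | zero => simp
  | add x y hx hy => simp only [map_add, hx, hy]
  | tmul a b => rw [comulLeft_tmul, snd_counitTensor_assoc, tensorCounit_comul]

/-- `∑ (S ⊗ S)(Δᶜᵒᵖ(h₁)) γ Δ(h₂) = ε(h) γ`. -/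
theorem antipodeGamma_comul (h : H) : antipodeGamma k H (Δ h) = ε h • gamma k H := by
  -- Quasi-coassociativity is used twice, past `Φ⁻¹` and then past `Φ ⊗ 1`, so that the iterated
  -- coproduct of `h` stands on the left. The pair of slots 2, 3 absorbs one coproduct and the pair
  -- 1, 4 the other.
  rw [antipodeGamma_eq, mul_assoc, ← map_mul, phiInv_mul_comulRight_comul, map_mul (comulFst k H),
    ← mul_assoc, padRight_phi_mul_comulFst_comulLeft, mul_assoc,
    map_comul_snd_mul (comulSnd k H) (gammaMap k H) gammaMap_comulSnd_mul,
    map_counitTensor_comulLeft, gammaMap_outer_comul_mul,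
    gammaMap_padRight_phi_mul_comulFst_phiInv]

theorem antipodeGamma_mul_tmul (D : H ⊗[k] H) (a b : H) : antipodeGamma k H (D * (a ⊗ₜ b)) =
    antipodeCop k H a * antipodeGamma k H D * Δ b := by
  induction D using TensorProduct.induction_on with
  | zero => simp
  | add x y hx hy => simp only [map_add, add_mul, mul_add, hx, hy]
  | tmul x y => simp [antipodeGamma_tmul, antipodeCop_mul, mul_assoc]

theorem antipodeGamma_comul_mul (h : H) (t : H ⊗[k] H) :
    antipodeGamma k H (Δ h * t) = ε h • antipodeGamma k H t := by
  induction t using TensorProduct.induction_on with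
  | zero => simp
  | add x y hx hy => simp only [map_add, mul_add, hx, hy, smul_add]
  | tmul x y =>
    rw [antipodeGamma_mul_tmul, antipodeGamma_comul, antipodeGamma_tmul, mul_smul_comm,
      smul_mul_assoc, mul_assoc]

end Gamma

/-! ### The two identities of the Drinfel'd twist. -/

section Twist

variable (k H) in
/-- `a ⊗ b ⊗ c ↦ (S ⊗ S)(Δᶜᵒᵖ(a)) γ Δ(b β S(c))`. -/
def twistMap : H ⊗[k] (H ⊗[k] H) →ₗ[k] H ⊗[k] H :=
  LinearMap.mul' k (H ⊗[k] H) ∘ₗ TensorProduct.map (antipodeCop k H)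
    (LinearMap.mulLeft k (gamma k H) ∘ₗ AlgHom.toLinearMap Δ ∘ₗ 𝓑)

theorem twistMap_phiInv : twistMap k H Φi = drinfeldTwist k H := rfl

theorem twistMap_tmul (a : H) (D : H ⊗[k] H) :
    twistMap k H (a ⊗ₜ D) = antipodeCop k H a * (gamma k H * Δ (𝓑 D)) := rfl

theorem twistMap_assoc (D : H ⊗[k] H) (c : H) :
    twistMap k H (Algebra.TensorProduct.assoc k k k H H H (D ⊗ₜ c)) =
      antipodeGamma k H D * Δ (β * S c) := by
  induction D using TensorProduct.induction_on with
  | zero => simp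
  | add x y hx hy => simp only [TensorProduct.add_tmul, map_add, add_mul, hx, hy]
  | tmul x y => simp [twistMap_tmul, antipodeGamma_tmul, mul_assoc]

theorem twistMap_mul_comulRight (T : H ⊗[k] (H ⊗[k] H)) (y : H ⊗[k] H) :
    twistMap k H (T * comulRight k H y) = twistMap k H (T * (tensorCounit k H H y ⊗ₜ 1)) := by
  induction T using tensor_induction₃ with
  | zero => simp
  | add x y hx hy => simp only [map_add, add_mul, hx, hy]
  | tmul a b c =>
    induction y using TensorProduct.induction_on with
    | zero => simp
    | add x y hx hy => simp only [TensorProduct.add_tmul, map_add, mul_add, hx, hy]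
    | tmul p q => simp [twistMap_tmul, betaAntipode_mul_comul]

theorem twistMap_comulLeft_mul (T : H ⊗[k] (H ⊗[k] H)) (y : H ⊗[k] H) :
    twistMap k H (comulLeft k H y * T) =
      twistMap k H ((1 ⊗ₜ (1 ⊗ₜ counitTensor k H H y)) * T) := by
  induction T using tensor_induction₃ with
  | zero => simp
  | add x y hx hy => simp only [map_add, mul_add, hx, hy]
  | tmul a b c =>
    induction y using TensorProduct.induction_on with
    | zero => simp
    | add x y hx hy => simp only [TensorProduct.tmul_add, map_add, add_mul, hx, hy]
    | tmul p q =>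
      rw [comulLeft_tmul, tmul_tmul_eq_assoc, ← map_mul,
        Algebra.TensorProduct.tmul_mul_tmul, twistMap_assoc, antipodeGamma_comul_mul,
        antipodeGamma_tmul]
      simp [twistMap_tmul, antipode_mul, mul_assoc]

/-- `f Δ(S(h)) = (S ⊗ S)(Δᶜᵒᵖ(h)) f`. -/
theorem drinfeldTwist_mul_comul_antipode (h : H) :
    drinfeldTwist k H * Δ (S h) = antipodeCop k H h * drinfeldTwist k H := by
  have h1 : ∀ T, twistMap k H ((1 ⊗ₜ (1 ⊗ₜ h)) * T) = twistMap k H T * Δ (S h) := by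
    intro T
    induction T using tensor_induction₃ with
    | zero => simp
    | add x y hx hy => simp only [map_add, mul_add, add_mul, hx, hy]
    | tmul a b c => simp [twistMap_tmul, antipode_mul, mul_assoc]
  have h2 : ∀ T, twistMap k H (T * (h ⊗ₜ 1)) = antipodeCop k H h * twistMap k H T := by
    intro T
    induction T using tensor_induction₃ with
    | zero => simp
    | add x y hx hy => simp only [map_add, mul_add, add_mul, hx, hy]
    | tmul a b c => simp [twistMap_tmul, antipodeCop_mul, mul_assoc]
  rw [← twistMap_phiInv, ← h1, ← h2]
  -- Write `h` as `(ε ⊗ id)(Δ(h))`. By invariance of `γ` the left factor may be replaced by `(Δ ⊗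
  -- id)(Δ(h))`, which passes through `Φ⁻¹` as `(id ⊗ Δ)(Δ(h))`; there `β S` absorbs the second
  -- coproduct.
  nth_rewrite 1 [← counitTensor_comul (k := k) h]
  rw [← twistMap_comulLeft_mul, ← phiInv_mul_comulRight_comul, twistMap_mul_comulRight,
    tensorCounit_comul]

variable (k H) in
/-- `a ⊗ b ⊗ c ⊗ d ↦ (S ⊗ S)(Δᶜᵒᵖ(a)) γ Δ(b β S(c) α d)`. -/
def twistMap₄ : H ⊗[k] (H ⊗[k] (H ⊗[k] H)) →ₗ[k] H ⊗[k] H :=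
  LinearMap.mul' k (H ⊗[k] H) ∘ₗ TensorProduct.map (antipodeCop k H)
    (LinearMap.mulLeft k (gamma k H) ∘ₗ AlgHom.toLinearMap Δ ∘ₗ betaAlpha k H)

theorem twistMap₄_tmul (a : H) (D : H ⊗[k] (H ⊗[k] H)) :
    twistMap₄ k H (a ⊗ₜ D) = antipodeCop k H a * (gamma k H * Δ (betaAlpha k H D)) := rfl

theorem twistMap₄_assoc (D D' : H ⊗[k] H) :
    twistMap₄ k H (Algebra.TensorProduct.assoc k k k H H (H ⊗[k] H) (D ⊗ₜ D')) =
      antipodeGamma k H D * Δ (β * 𝓔 D') := by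
  induction D using TensorProduct.induction_on with
  | zero => simp
  | add x y hx hy => simp only [TensorProduct.add_tmul, map_add, add_mul, hx, hy]
  | tmul x y => simp [twistMap₄_tmul, antipodeGamma_tmul, betaAlpha_tmul, mul_assoc]

/-- `f Δ(α) = γ`. -/
theorem drinfeldTwist_mul_comul_alpha : drinfeldTwist k H * Δ α = gamma k H := by
  have h1 : ∀ T, twistMap₄ k H (padRight k H T) = twistMap k H T * Δ α := by
    intro T
    induction T using tensor_induction₃ with
    | zero => simp
    | add x y hx hy => simp only [map_add, add_mul, hx, hy]
    | tmul a b c => simp [twistMap_tmul, twistMap₄_tmul, betaAlpha_tmul, mul_assoc]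
  rw [← twistMap_phiInv, ← h1]
  -- Insert `(Δ ⊗ id ⊗ id)(Φ)`, invisible by invariance of `γ`. The pentagon then gives `(id ⊗ id ⊗
  -- Δ)(Φ⁻¹) (1 ⊗ Φ) (id ⊗ Δ ⊗ id)(Φ)`; the outer factors are absorbed and `∑ X¹ β S(X²) α X³ = 1`
  -- leaves `γ`.
  rw [← absorb_fst_left (d := comulFst k H) (C := twistMap₄ k H) isCounital_phi,
    comulFst_phi_mul_padRight_phiInv, mul_assoc, absorb_thd_left isCounital_phiInv,
    absorb_snd_right isCounital_phi, padLeft_apply, twistMap₄_tmul, betaAlpha_phi, map_one Δ, mul_one,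
    antipodeCop_one, one_mul]
  · intro h T
    induction T using tensor_induction₄ with
    | zero => simp
    | add x y hx hy => simp only [map_add, add_mul, hx, hy, smul_add]
    | tmul a b c d =>
      rw [tmul_mul_comulSnd, twistMap₄_tmul, betaAlpha_assoc, betaAntipode_mul_comul,
        tmul_tmul_eq_assoc b, twistMap₄_tmul, betaAlpha_assoc]
      simp
  · intro h T
    induction T using tensor_induction₄ with
    | zero => simp
    | add x y hx hy => simp only [map_add, mul_add, hx, hy, smul_add]
    | tmul a b c d =>
      simp [twistMap₄_tmul, betaAlpha_tmul, antipodeAlpha_comul_mul]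
  · intro h T
    induction T using tensor_induction₄ with
    | zero => simp
    | add x y hx hy => simp only [map_add, mul_add, hx, hy, smul_add]
    | tmul a b c d =>
      rw [comulFst_mul_tmul, twistMap₄_assoc, antipodeGamma_comul_mul,
        tmul_tmul_eq_assoc, twistMap₄_assoc, smul_mul_assoc]

end Twist

end QuasiHopf
end

noncomputable section

set_option maxSynthPendingDepth 3

namespace QuasiHopf

open QuasiBialgebra QuasiHopfAlgebra

variable {k H : Type*} [Field k] [Ring H] [Algebra k H] [QuasiHopfAlgebra k H]

local notation "Δ" => QuasiBialgebra.comul (k := k) (H := H)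
local notation "ε" => QuasiBialgebra.counit (k := k) (H := H)
local notation "Φ" => phi k H
local notation "Φi" => phiInv k H
local notation "S" => QuasiHopfAlgebra.antipode (k := k) (H := H)
local notation "α" => QuasiHopfAlgebra.α k (H := H)
local notation "β" => QuasiHopfAlgebra.β k (H := H)
local notation "𝓔" => antipodeAlpha k H
local notation "𝓑" => betaAntipode k H

/-! ### Covariant elements and their uniqueness. -/

section Covariant

variable {A : Type*} [Ring A] [Algebra k A] (l r : H →ₐ[k] A) (T : A)

/-- `a ⊗ b ↦ l(a) T r(S(b))`. -/
def sandwich : H ⊗[k] H →ₗ[k] A :=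
  LinearMap.mul' k A ∘ₗ TensorProduct.map l.toLinearMap
    (LinearMap.mulLeft k T ∘ₗ r.toLinearMap ∘ₗ S)

/-- `a ⊗ b ⊗ c ↦ l(a) T r(S(b) α c)`. -/
def sandwichAlpha : H ⊗[k] (H ⊗[k] H) →ₗ[k] A :=
  LinearMap.mul' k A ∘ₗ TensorProduct.map l.toLinearMap
    (LinearMap.mulLeft k T ∘ₗ r.toLinearMap ∘ₗ 𝓔)

theorem sandwich_tmul (a b : H) : sandwich l r T (a ⊗ₜ b) = l a * (T * r (S b)) := rfl

theorem sandwichAlpha_tmul (a : H) (D : H ⊗[k] H) :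
    sandwichAlpha l r T (a ⊗ₜ D) = l a * (T * r (𝓔 D)) := rfl

/-- The elements `T` with `∑ l(h₁) T r(S(h₂)) = s(h) T`. -/
def IsCovariant (s : H →ₗ[k] A) : Prop := ∀ h : H, sandwich l r T (Δ h) = s h * T

variable {l r T}

/-- A covariant `T` is determined by `∑ l(X¹) T r(S(X²) α X³)`. -/
theorem IsCovariant.eq_sum {s : H →ₗ[k] A} (hT : IsCovariant l r T s)
    (hs : ∀ a b, s a * l b = l b * s a) :
    T = (LinearMap.mul' k A ∘ₗ TensorProduct.map s
      (LinearMap.mulLeft k (sandwichAlpha l r T Φ) ∘ₗ r.toLinearMap ∘ₗ 𝓑)) Φi := by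
  let Q : H ⊗[k] H →ₗ[k] A := LinearMap.mul' k A ∘ₗ TensorProduct.map l.toLinearMap
    (LinearMap.mulLeft k T ∘ₗ r.toLinearMap)
  have hQ : ∀ a b, Q (a ⊗ₜ b) = l a * (T * r b) := fun a b => rfl
  -- Insert `1 ⊗ 1 = ∑ X¹ x¹₁ ⊗ S(X² x¹₂) α X³ x² β S(x³)` around `T`. The two halves of `Δ(x¹)`
  -- then enclose `T`, so covariance replaces them by `s(x¹)`.
  have h1 : T = Q (TensorProduct.map LinearMap.id (alphaBeta k H)
      (padRight k H Φ * comulFst k H Φi)) := by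
    rw [alphaBeta_padRight_phi_mul_comulFst_phiInv, hQ, map_one, map_one, one_mul, mul_one]
  have h2 : ∀ Z W, Q (TensorProduct.map LinearMap.id (alphaBeta k H)
      (padRight k H Z * comulFst k H W)) = (LinearMap.mul' k A ∘ₗ TensorProduct.map s
      (LinearMap.mulLeft k (sandwichAlpha l r T Z) ∘ₗ r.toLinearMap ∘ₗ 𝓑)) W := by
    intro Z W
    induction W using tensor_induction₃ with
    | zero => simp
    | add x y hx hy => simp only [map_add, mul_add, hx, hy]
    | tmul p q t =>
      change _ = s p * (sandwichAlpha l r T Z * r (𝓑 (q ⊗ₜ t)))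
      induction Z using tensor_induction₃ with
      | zero => simp
      | add x y hx hy => simp only [map_add, mul_add, add_mul, hx, hy]
      | tmul a b c =>
        have h3 : ∀ D : H ⊗[k] H, Q (TensorProduct.map LinearMap.id (alphaBeta k H)
            (padRight k H (a ⊗ₜ (b ⊗ₜ c)) *
              Algebra.TensorProduct.assoc k k k H H (H ⊗[k] H) (D ⊗ₜ (q ⊗ₜ t)))) =
            l a * (sandwich l r T D * (r (𝓔 (b ⊗ₜ c)) * r (𝓑 (q ⊗ₜ t)))) := by
          intro D
          induction D using TensorProduct.induction_on with
          | zero => simp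
          | add x y hx hy =>
            simp only [TensorProduct.add_tmul, map_add, mul_add, add_mul, hx, hy]
          | tmul x y =>
            simp [hQ, alphaBeta_tmul, sandwich_tmul, antipode_mul, mul_assoc]
        rw [comulFst_tmul, h3, hT, sandwichAlpha_tmul, mul_assoc, mul_assoc (l a),
          ← mul_assoc (l a), ← hs, mul_assoc, mul_assoc T]
  rw [← h2]
  exact h1

/-- The uniqueness principle behind the cocycle identity: only one contraction with `Φ` has to be
compared. -/
theorem IsCovariant.eq {s : H →ₗ[k] A} {T' : A} (hT : IsCovariant l r T s)
    (hT' : IsCovariant l r T' s) (hs : ∀ a b, s a * l b = l b * s a)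
    (h : sandwichAlpha l r T Φ = sandwichAlpha l r T' Φ) : T = T' := by
  rw [hT.eq_sum hs, hT'.eq_sum hs, h]

end Covariant

/-! ### The elements `q_L` and `Ṽ`; covariance of `Ṽ`. -/

section Elements

variable (k H) in
/-- `a ⊗ b ⊗ c ↦ S(a) α b ⊗ c`. -/
def qMap : H ⊗[k] (H ⊗[k] H) →ₗ[k] H ⊗[k] H :=
  TensorProduct.map 𝓔 LinearMap.id ∘ₗ (TensorProduct.assoc k H H H).symm.toLinearMap

theorem qMap_tmul (a b c : H) : qMap k H (a ⊗ₜ (b ⊗ₜ c)) = 𝓔 (a ⊗ₜ b) ⊗ₜ c := rfl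

theorem qMap_assoc (D : H ⊗[k] H) (c : H) :
    qMap k H (Algebra.TensorProduct.assoc k k k H H H (D ⊗ₜ c)) = 𝓔 D ⊗ₜ c := by
  induction D using TensorProduct.induction_on with
  | zero => simp
  | add x y hx hy => simp only [TensorProduct.add_tmul, map_add, hx, hy]
  | tmul x y => rfl

variable (k H) in
/-- `q_L = ∑ S(x¹) α x² ⊗ x³`. -/
def qL : H ⊗[k] H := qMap k H Φi

variable (k H) in
/-- `a ⊗ b ⊗ c ↦ S(c) ⊗ a β S(b)`. -/
def vMap : H ⊗[k] (H ⊗[k] H) →ₗ[k] H ⊗[k] H :=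
  (TensorProduct.comm k H H).toLinearMap ∘ₗ TensorProduct.map 𝓑 S ∘ₗ
    (TensorProduct.assoc k H H H).symm.toLinearMap

theorem vMap_tmul (a b c : H) : vMap k H (a ⊗ₜ (b ⊗ₜ c)) = S c ⊗ₜ 𝓑 (a ⊗ₜ b) := rfl

theorem vMap_assoc (D : H ⊗[k] H) (c : H) :
    vMap k H (Algebra.TensorProduct.assoc k k k H H H (D ⊗ₜ c)) = S c ⊗ₜ 𝓑 D := by
  induction D using TensorProduct.induction_on with
  | zero => simp
  | add x y hx hy =>
    simp only [TensorProduct.add_tmul, TensorProduct.tmul_add, map_add, hx, hy]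
  | tmul x y => rfl

variable (k H) in
/-- `∑ S(X³) f¹ ⊗ X¹ β S(X²) f²`; this is `Ṽ`, written without `S⁻¹`. -/
def vElem : H ⊗[k] H := vMap k H Φ * drinfeldTwist k H

theorem tmul_mul_vMap (a : H) (D : H ⊗[k] H) (T : H ⊗[k] (H ⊗[k] H)) :
    ((1 : H) ⊗ₜ[k] a) * vMap k H T * antipode₂ k H (TensorProduct.comm k H H D) =
      vMap k H ((a ⊗ₜ D) * T) := by
  induction T using tensor_induction₃ with
  | zero => simp
  | add x y hx hy => simp only [map_add, mul_add, add_mul, hx, hy]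
  | tmul p q r =>
    induction D using TensorProduct.induction_on with
    | zero => simp
    | add x y hx hy => simp only [TensorProduct.tmul_add, map_add, mul_add, add_mul, hx, hy]
    | tmul x y => simp [vMap_tmul, antipode₂, antipode_mul, mul_assoc]

/-- `β S` absorbs the coproduct in the first two slots; the third slot leaves through `S` into the
first output. -/
theorem vMap_mul_comulLeft (y : H ⊗[k] H) (T : H ⊗[k] (H ⊗[k] H)) :
    vMap k H (T * comulLeft k H y) = (S (counitTensor k H H y) ⊗ₜ[k] (1 : H)) * vMap k H T := by
  induction y using TensorProduct.induction_on with
  | zero => simp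
  | add x y hx hy => simp only [TensorProduct.add_tmul, map_add, mul_add, add_mul, hx, hy]
  | tmul x y =>
    induction T using tensor_induction₃ with
    | zero => simp
    | add x y hx hy => simp only [map_add, mul_add, add_mul, hx, hy]
    | tmul p q r =>
      rw [comulLeft_tmul, tmul_tmul_eq_assoc, ← map_mul, Algebra.TensorProduct.tmul_mul_tmul,
        vMap_assoc, betaAntipode_mul_comul, vMap_assoc]
      simp [antipode_mul, TensorProduct.smul_tmul', mul_assoc]

/-- `∑ (1 ⊗ h₁) Ṽ Δ(S(h₂)) = (S(h) ⊗ 1) Ṽ`. -/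
theorem isCovariant_vElem :
    IsCovariant (Algebra.TensorProduct.includeRight : H →ₐ[k] H ⊗[k] H) Δ (vElem k H)
      ((TensorProduct.mk k H H).flip 1 ∘ₗ S) := by
  have key : ∀ y : H ⊗[k] H,
      sandwich (Algebra.TensorProduct.includeRight : H →ₐ[k] H ⊗[k] H) Δ (vElem k H) y =
        vMap k H (comulRight k H y * Φ) * drinfeldTwist k H := by
    intro y
    induction y using TensorProduct.induction_on with
    | zero => simp
    | add x y hx hy => simp only [map_add, add_mul, hx, hy]
    | tmul a b =>
      rw [sandwich_tmul, vElem, mul_assoc (vMap k H Φ), drinfeldTwist_mul_comul_antipode,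
        comulRight_tmul, ← tmul_mul_vMap, Algebra.TensorProduct.includeRight_apply,
        antipodeCop_apply]
      simp only [mul_assoc]
  intro h
  -- Commuting with `f` has put `(id ⊗ Δ)(Δ(h))` to the left of `Φ`. On the right of `Φ` it becomes
  -- `(Δ ⊗ id)(Δ(h))`, of which only `S(h) ⊗ 1` survives.
  rw [key, comulRight_comul_mul_phi, vMap_mul_comulLeft, counitTensor_comul, vElem, mul_assoc]
  rfl

end Elements

/-! ### A fivefold pentagon. -/

section FiveFold

variable (k H) in
/-- `a ⊗ b ⊗ c ⊗ d ⊗ e ↦ S(c) α d ⊗ a β S(b) ⊗ e`. -/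
def contract : H ⊗[k] (H ⊗[k] (H ⊗[k] (H ⊗[k] H))) →ₗ[k] H ⊗[k] (H ⊗[k] H) :=
  TensorProduct.map 𝓔 (TensorProduct.map 𝓑 LinearMap.id) ∘ₗ
    (TensorProduct.leftComm k (H ⊗[k] H) (H ⊗[k] H) H).toLinearMap ∘ₗ
    TensorProduct.map LinearMap.id (TensorProduct.assoc k H H H).symm.toLinearMap ∘ₗ
    (TensorProduct.assoc k H H (H ⊗[k] (H ⊗[k] H))).symm.toLinearMap

theorem contract_tmul (a b c d e : H) :
    contract k H (a ⊗ₜ (b ⊗ₜ (c ⊗ₜ (d ⊗ₜ e)))) = 𝓔 (c ⊗ₜ d) ⊗ₜ (𝓑 (a ⊗ₜ b) ⊗ₜ e) := rfl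

theorem contract_tmul_tmul_assoc (a b e : H) (D : H ⊗[k] H) :
    contract k H (a ⊗ₜ (b ⊗ₜ Algebra.TensorProduct.assoc k k k H H H (D ⊗ₜ e))) =
      𝓔 D ⊗ₜ (𝓑 (a ⊗ₜ b) ⊗ₜ e) := by
  induction D using TensorProduct.induction_on with
  | zero => simp
  | add x y hx hy =>
    simp only [TensorProduct.add_tmul, TensorProduct.tmul_add, map_add, hx, hy]
  | tmul x y => rfl

theorem contract_assoc (D : H ⊗[k] H) (c d e : H) :
    contract k H (Algebra.TensorProduct.assoc k k k H H (H ⊗[k] (H ⊗[k] H))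
      (D ⊗ₜ (c ⊗ₜ (d ⊗ₜ e)))) = 𝓔 (c ⊗ₜ d) ⊗ₜ (𝓑 D ⊗ₜ e) := by
  induction D using TensorProduct.induction_on with
  | zero => simp
  | add x y hx hy =>
    simp only [TensorProduct.add_tmul, TensorProduct.tmul_add, map_add, hx, hy]
  | tmul x y => rfl

variable (k H) in
/-- `x ↦ x ⊗ 1` on the fourfold tensor power. -/
def padRight₄ : H ⊗[k] (H ⊗[k] (H ⊗[k] H)) →ₐ[k] H ⊗[k] (H ⊗[k] (H ⊗[k] (H ⊗[k] H))) :=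
  Algebra.TensorProduct.map (AlgHom.id k H) (padRight k H)

variable (k H) in
/-- `Δ ⊗ id ⊗ id ⊗ id` on the fourfold tensor power. -/
def comulFst₄ : H ⊗[k] (H ⊗[k] (H ⊗[k] H)) →ₐ[k] H ⊗[k] (H ⊗[k] (H ⊗[k] (H ⊗[k] H))) :=
  (Algebra.TensorProduct.assoc k k k H H (H ⊗[k] (H ⊗[k] H))).toAlgHom.comp
    (Algebra.TensorProduct.map Δ (AlgHom.id k (H ⊗[k] (H ⊗[k] H))))

variable (k H) in
/-- `id ⊗ Δ ⊗ id ⊗ id` on the fourfold tensor power. -/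
def comulSnd₄ : H ⊗[k] (H ⊗[k] (H ⊗[k] H)) →ₐ[k] H ⊗[k] (H ⊗[k] (H ⊗[k] (H ⊗[k] H))) :=
  Algebra.TensorProduct.map (AlgHom.id k H) (comulFst k H)

variable (k H) in
/-- `id ⊗ id ⊗ Δ ⊗ id` on the fourfold tensor power. -/
def comulThd₄ : H ⊗[k] (H ⊗[k] (H ⊗[k] H)) →ₐ[k] H ⊗[k] (H ⊗[k] (H ⊗[k] (H ⊗[k] H))) :=
  Algebra.TensorProduct.map (AlgHom.id k H) (comulSnd k H)

omit [QuasiHopfAlgebra k H] in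
@[simp] theorem padRight₄_tmul (a : H) (x : H ⊗[k] (H ⊗[k] H)) :
    padRight₄ k H (a ⊗ₜ x) = a ⊗ₜ padRight k H x := rfl
@[simp] theorem comulFst₄_tmul (a : H) (x : H ⊗[k] (H ⊗[k] H)) : comulFst₄ k H (a ⊗ₜ x) =
    Algebra.TensorProduct.assoc k k k H H (H ⊗[k] (H ⊗[k] H)) (Δ a ⊗ₜ x) := rfl
@[simp] theorem comulSnd₄_tmul (a : H) (x : H ⊗[k] (H ⊗[k] H)) :
    comulSnd₄ k H (a ⊗ₜ x) = a ⊗ₜ comulFst k H x := rfl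
@[simp] theorem comulThd₄_tmul (a : H) (x : H ⊗[k] (H ⊗[k] H)) :
    comulThd₄ k H (a ⊗ₜ x) = a ⊗ₜ comulSnd k H x := rfl

omit [QuasiHopfAlgebra k H] in
theorem padRight_assoc (D : H ⊗[k] H) (c : H) :
    padRight k H (Algebra.TensorProduct.assoc k k k H H H (D ⊗ₜ c)) =
      Algebra.TensorProduct.assoc k k k H H (H ⊗[k] H) (D ⊗ₜ (c ⊗ₜ 1)) := by
  induction D using TensorProduct.induction_on with
  | zero => simp
  | add x y hx hy => simp only [TensorProduct.add_tmul, map_add, hx, hy]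
  | tmul x y => rfl

theorem comulSnd₄_padRight (Z : H ⊗[k] (H ⊗[k] H)) :
    comulSnd₄ k H (padRight k H Z) = padRight₄ k H (comulSnd k H Z) := by
  induction Z using tensor_induction₃ with
  | zero => simp
  | add x y hx hy => simp only [map_add, hx, hy]
  | tmul a b c => simp [padRight_assoc]

/-- Quasi-coassociativity in slots 2, 3, 4, with the outer slots as spectators. -/
theorem tmul_padRight_phi_mul_comulSnd₄ (Z : H ⊗[k] (H ⊗[k] H)) :
    ((1 : H) ⊗ₜ[k] padRight k H Φ) * comulSnd₄ k H (comulSnd k H Z) =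
      comulThd₄ k H (comulSnd k H Z) * ((1 : H) ⊗ₜ[k] padRight k H Φ) := by
  induction Z using TensorProduct.induction_on with
  | zero => simp
  | add x y hx hy => simp only [map_add, mul_add, add_mul, hx, hy]
  | tmul a y => simp [padRight_phi_mul_comulFst_comulLeft]

theorem comulSnd₄_comulFst_tmul (a : H) (y : H ⊗[k] H) : comulSnd₄ k H (comulFst k H (a ⊗ₜ y)) =
    padRight₄ k H (padRight k H (comulRight k H (Δ a))) * (1 ⊗ₜ (1 ⊗ₜ (1 ⊗ₜ y))) := by
  rw [comulFst_tmul]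
  generalize Δ a = D
  induction D using TensorProduct.induction_on with
  | zero => simp
  | add x y hx hy => simp only [TensorProduct.add_tmul, map_add, hx, hy, add_mul]
  | tmul x z =>
    simp only [Algebra.TensorProduct.assoc_tmul, comulSnd₄_tmul, comulFst_tmul, comulRight_tmul]
    generalize Δ z = D
    induction D using TensorProduct.induction_on with
    | zero => simp
    | add x y hx hy =>
      simp only [TensorProduct.add_tmul, TensorProduct.tmul_add, map_add, hx, hy, add_mul]
    | tmul p q => simp [← Algebra.TensorProduct.one_def]

theorem comulFst₄_comulFst_tmul (a : H) (y : H ⊗[k] H) : comulFst₄ k H (comulFst k H (a ⊗ₜ y)) =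
    padRight₄ k H (padRight k H (comulLeft k H (Δ a))) * (1 ⊗ₜ (1 ⊗ₜ (1 ⊗ₜ y))) := by
  rw [comulFst_tmul]
  generalize Δ a = D
  induction D using TensorProduct.induction_on with
  | zero => simp
  | add x y hx hy => simp only [TensorProduct.add_tmul, map_add, hx, hy, add_mul]
  | tmul x z =>
    simp only [Algebra.TensorProduct.assoc_tmul, comulFst₄_tmul, comulLeft_tmul]
    generalize Δ x = D
    induction D using TensorProduct.induction_on with
    | zero => simp
    | add x y hx hy =>
      simp only [TensorProduct.add_tmul, map_add, hx, hy, add_mul]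
    | tmul p q => simp [← Algebra.TensorProduct.one_def]

omit [QuasiHopfAlgebra k H] in
theorem padRight₄_padRight_mul_comm (x : H ⊗[k] (H ⊗[k] H)) (y : H ⊗[k] H) :
    padRight₄ k H (padRight k H x) * (1 ⊗ₜ (1 ⊗ₜ (1 ⊗ₜ y))) =
      (1 ⊗ₜ (1 ⊗ₜ (1 ⊗ₜ y))) * padRight₄ k H (padRight k H x) := by
  induction x using tensor_induction₃ with
  | zero => simp
  | add x y hx hy => simp only [map_add, add_mul, mul_add, hx, hy]
  | tmul a b c => simp [← Algebra.TensorProduct.one_def]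

/-- Quasi-coassociativity in slots 1, 2, 3, with the last two slots as spectators. -/
theorem comulSnd₄_comulFst_mul_padRight₄ (Z : H ⊗[k] (H ⊗[k] H)) :
    comulSnd₄ k H (comulFst k H Z) * padRight₄ k H (padRight k H Φ) =
      padRight₄ k H (padRight k H Φ) * comulFst₄ k H (comulFst k H Z) := by
  induction Z using TensorProduct.induction_on with
  | zero => simp
  | add x y hx hy => simp only [map_add, mul_add, add_mul, hx, hy]
  | tmul a y =>
    rw [comulSnd₄_comulFst_tmul, comulFst₄_comulFst_tmul, mul_assoc,
      ← padRight₄_padRight_mul_comm, ← mul_assoc, ← map_mul, ← map_mul, comulRight_comul_mul_phi,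
      ← mul_assoc, ← map_mul, ← map_mul]

/-- The fivefold form of the pentagon that computes `∑ (1 ⊗ X¹) Ṽ Δ(S(X²) α X³)`. -/
theorem fivefold_pentagon :
    ((1 : H) ⊗ₜ[k] (padRight k H Φ * comulFst k H Φi)) * comulSnd₄ k H (comulThd k H Φ) *
        padRight₄ k H (padRight k H Φ) =
      comulThd₄ k H (comulSnd k H Φ) * (padRight₄ k H (comulThd k H Φ) *
        (padRight₄ k H (comulFst k H Φ) * comulFst₄ k H (comulFst k H Φi))) := by
  have h1 : ((1 : H) ⊗ₜ[k] (padRight k H Φ * comulFst k H Φi)) =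
      ((1 : H) ⊗ₜ[k] padRight k H Φ) * comulSnd₄ k H (padLeft k H Φi) := by
    rw [padLeft_apply, comulSnd₄_tmul, Algebra.TensorProduct.tmul_mul_tmul, one_mul]
  -- Two pentagons: one is applied inside `id ⊗ Δ ⊗ id ⊗ id`. After the copies of `Φ` at both ends
  -- have moved inward past iterated coproducts, the other is applied in reverse to the first four
  -- slots.
  rw [h1, mul_assoc _ (comulSnd₄ k H (padLeft k H Φi)), ← map_mul,
    padLeft_phiInv_mul_comulThd_phi, map_mul, map_mul, ← mul_assoc, ← mul_assoc,
    tmul_padRight_phi_mul_comulSnd₄, comulSnd₄_padRight, mul_assoc,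
    comulSnd₄_comulFst_mul_padRight₄, ← mul_assoc (padRight₄ k H (comulThd k H Φ)),
    ← map_mul (padRight₄ k H) (comulThd k H Φ), ← pentagon_phi, map_mul (padRight₄ k H),
    map_mul (padRight₄ k H), padLeft_apply, padRight₄_tmul]
  simp only [mul_assoc]

end FiveFold

end QuasiHopf
end

noncomputable section

set_option maxSynthPendingDepth 3

namespace QuasiHopf

open QuasiBialgebra QuasiHopfAlgebra

variable {k H : Type*} [Field k] [Ring H] [Algebra k H] [QuasiHopfAlgebra k H]

local notation "Δ" => QuasiBialgebra.comul (k := k) (H := H)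
local notation "ε" => QuasiBialgebra.counit (k := k) (H := H)
local notation "Φ" => phi k H
local notation "Φi" => phiInv k H
local notation "S" => QuasiHopfAlgebra.antipode (k := k) (H := H)
local notation "α" => QuasiHopfAlgebra.α k (H := H)
local notation "β" => QuasiHopfAlgebra.β k (H := H)
local notation "𝓔" => antipodeAlpha k H
local notation "𝓑" => betaAntipode k H

/-! ### The invariant of `Ṽ`. -/

section FiveFold

/-- The two twist identities combined. They remove `f` from the invariant of `Ṽ`, leaving only `γ`,
which is explicit in `Φ`. -/
theorem drinfeldTwist_mul_comul_antipodeAlpha (D : H ⊗[k] H) :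
    drinfeldTwist k H * Δ (𝓔 D) = antipodeGamma k H D := by
  induction D using TensorProduct.induction_on with
  | zero => simp
  | add x y hx hy => simp only [map_add, mul_add, hx, hy]
  | tmul b c =>
    rw [antipodeAlpha_tmul, antipodeGamma_tmul, map_mul, map_mul, ← mul_assoc,
      drinfeldTwist_mul_comul_antipode, mul_assoc, ← mul_assoc (drinfeldTwist k H),
      drinfeldTwist_mul_comul_alpha]

variable (k H) in
/-- `a ⊗ b ⊗ c ⊗ d ⊗ e ↦ S(c) α d ⊗ a β S(b) α e`. -/
def contractAll : H ⊗[k] (H ⊗[k] (H ⊗[k] (H ⊗[k] H))) →ₗ[k] H ⊗[k] H :=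
  TensorProduct.map LinearMap.id (LinearMap.mul' k H ∘ₗ
    TensorProduct.map LinearMap.id (LinearMap.mulLeft k α)) ∘ₗ contract k H

theorem contractAll_tmul (a b c d e : H) :
    contractAll k H (a ⊗ₜ (b ⊗ₜ (c ⊗ₜ (d ⊗ₜ e)))) =
      𝓔 (c ⊗ₜ d) ⊗ₜ (𝓑 (a ⊗ₜ b) * (α * e)) := rfl

theorem contractAll_tmul_tmul_assoc (a b e : H) (D : H ⊗[k] H) :
    contractAll k H (a ⊗ₜ (b ⊗ₜ Algebra.TensorProduct.assoc k k k H H H (D ⊗ₜ e))) =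
      𝓔 D ⊗ₜ (𝓑 (a ⊗ₜ b) * (α * e)) := by
  rw [contractAll, LinearMap.comp_apply, contract_tmul_tmul_assoc]
  rfl

theorem tmul_mul_vMap_mul_gammaMap (a : H) (Z : H ⊗[k] (H ⊗[k] H))
    (T : H ⊗[k] (H ⊗[k] (H ⊗[k] H))) :
    ((1 : H) ⊗ₜ[k] a) * (vMap k H Z * gammaMap k H T) =
      contractAll k H ((a ⊗ₜ T) * padRight₄ k H (padRight k H Z)) := by
  induction Z using tensor_induction₃ with
  | zero => simp
  | add x y hx hy => simp only [map_add, mul_add, add_mul, hx, hy]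
  | tmul p q r =>
    induction T using tensor_induction₄ with
    | zero => simp
    | add x y hx hy =>
      simp only [map_add, TensorProduct.tmul_add, mul_add, add_mul, hx, hy]
    | tmul x y z w =>
      simp [vMap_tmul, gammaMap_tmul, contractAll_tmul, antipode_mul, mul_assoc]

theorem sandwichAlpha_vElem_eq_contractAll (Z : H ⊗[k] (H ⊗[k] H)) :
    sandwichAlpha (Algebra.TensorProduct.includeRight : H →ₐ[k] H ⊗[k] H) Δ (vElem k H) Z =
      contractAll k H (((1 : H) ⊗ₜ[k] (padRight k H Φ * comulFst k H Φi)) *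
        comulSnd₄ k H (comulThd k H Z) * padRight₄ k H (padRight k H Φ)) := by
  induction Z using TensorProduct.induction_on with
  | zero => simp
  | add x y hx hy => simp only [map_add, mul_add, add_mul, hx, hy]
  | tmul a D =>
    rw [sandwichAlpha_tmul, vElem, mul_assoc (vMap k H Φ), drinfeldTwist_mul_comul_antipodeAlpha,
      antipodeGamma_eq, Algebra.TensorProduct.includeRight_apply, tmul_mul_vMap_mul_gammaMap,
      comulThd_tmul, comulSnd₄_tmul, Algebra.TensorProduct.tmul_mul_tmul, one_mul]

/-- Slots 3, 4 absorb the inner coproduct, so the middle entry of `Z` survives only in slot 2 and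
joins the last entry as `S(b) α c`. The leftover will meet a `β` and close up to `∑ X¹ β S(X²) α
X³`. -/
theorem contractAll_comulThd₄_comulSnd_mul (Z : H ⊗[k] (H ⊗[k] H))
    (T : H ⊗[k] (H ⊗[k] (H ⊗[k] (H ⊗[k] H)))) :
    contractAll k H (comulThd₄ k H (comulSnd k H Z) * T) =
      TensorProduct.map LinearMap.id (LinearMap.mul' k H)
        (((1 : H) ⊗ₜ[k] TensorProduct.map LinearMap.id 𝓔 Z) * contract k H T) := by
  induction Z using tensor_induction₃ with
  | zero => simp
  | add x y hx hy => simp only [map_add, TensorProduct.tmul_add, add_mul, hx, hy]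
  | tmul a b c =>
    induction T using TensorProduct.induction_on with
    | zero => simp
    | add x y hx hy => simp only [map_add, mul_add, hx, hy]
    | tmul t₁ T =>
      induction T using tensor_induction₄ with
      | zero => simp
      | add x y hx hy => simp only [map_add, TensorProduct.tmul_add, mul_add, hx, hy]
      | tmul t₂ t₃ t₄ t₅ =>
        have key : ∀ D : H ⊗[k] H, contractAll k H ((a ⊗ₜ comulSnd k H
            (Algebra.TensorProduct.assoc k k k H H H (D ⊗ₜ c))) *
              (t₁ ⊗ₜ (t₂ ⊗ₜ (t₃ ⊗ₜ (t₄ ⊗ₜ t₅))))) =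
            𝓔 (t₃ ⊗ₜ t₄) ⊗ₜ (𝓑 ((a * t₁) ⊗ₜ (tensorCounit k H H D * t₂)) * (α * (c * t₅))) := by
          intro D
          induction D using TensorProduct.induction_on with
          | zero => simp
          | add x y hx hy =>
            simp only [TensorProduct.add_tmul, TensorProduct.tmul_add, map_add, add_mul, hx, hy]
          | tmul p q =>
            rw [Algebra.TensorProduct.assoc_tmul, comulSnd_tmul, comulLeft_tmul,
              Algebra.TensorProduct.tmul_mul_tmul, Algebra.TensorProduct.tmul_mul_tmul,
              tmul_tmul_eq_assoc t₃, ← map_mul, Algebra.TensorProduct.tmul_mul_tmul,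
              contractAll_tmul_tmul_assoc, antipodeAlpha_comul_mul]
            simp [TensorProduct.smul_tmul]
        rw [comulSnd_tmul, comulThd₄_tmul, comulLeft_tmul, key, tensorCounit_comul, contract_tmul]
        simp [antipode_mul, mul_assoc]

theorem contract_mul_comulFst₄ (W : H ⊗[k] (H ⊗[k] (H ⊗[k] H)))
    (T : H ⊗[k] (H ⊗[k] (H ⊗[k] (H ⊗[k] H)))) :
    contract k H (T * comulFst₄ k H W) =
      contract k H (T * (1 ⊗ₜ (1 ⊗ₜ counitTensor k H (H ⊗[k] (H ⊗[k] H)) W))) := by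
  induction W using tensor_induction₄ with
  | zero => simp
  | add x y hx hy => simp only [map_add, TensorProduct.tmul_add, mul_add, hx, hy]
  | tmul a b c d =>
    induction T using TensorProduct.induction_on with
    | zero => simp
    | add x y hx hy => simp only [map_add, add_mul, hx, hy]
    | tmul t₁ T =>
      induction T using tensor_induction₄ with
      | zero => simp
      | add x y hx hy => simp only [map_add, TensorProduct.tmul_add, add_mul, hx, hy]
      | tmul t₂ t₃ t₄ t₅ =>
        rw [comulFst₄_tmul, tmul_tmul_eq_assoc t₁, ← map_mul, Algebra.TensorProduct.tmul_mul_tmul,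
          Algebra.TensorProduct.tmul_mul_tmul, Algebra.TensorProduct.tmul_mul_tmul,
          contract_assoc, betaAntipode_mul_comul, ← tmul_tmul_eq_assoc t₁,
          counitTensor_tmul, ← TensorProduct.tmul_smul, ← TensorProduct.tmul_smul]
        simp only [Algebra.TensorProduct.tmul_mul_tmul, mul_one, contract_tmul, mul_smul_comm,
          TensorProduct.tmul_smul, ← TensorProduct.smul_tmul', map_smul]

theorem counitTensor_comulFst (Z : H ⊗[k] (H ⊗[k] H)) :
    counitTensor k H (H ⊗[k] (H ⊗[k] H)) (comulFst k H Z) = Z := by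
  induction Z using TensorProduct.induction_on with
  | zero => simp
  | add x y hx hy => simp only [map_add, hx, hy]
  | tmul a y => rw [comulFst_tmul, counitTensor_comulLeft_assoc, counitTensor_comul]

/-- With nothing else in slots 1, 2 the contraction of the coproduct is `β` times a counit; what
remains of `Z` is its first counital contraction. -/
theorem contract_padRight₄_comulFst_mul (Z W : H ⊗[k] (H ⊗[k] H)) :
    contract k H (padRight₄ k H (comulFst k H Z) * (1 ⊗ₜ (1 ⊗ₜ W))) =
      TensorProduct.map LinearMap.id (TensorProduct.mk k H H β)
        (qMap k H (Algebra.TensorProduct.map (AlgHom.id k H)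
          (Algebra.TensorProduct.includeLeft : H →ₐ[k] H ⊗[k] H)
            (counitTensor k H (H ⊗[k] H) Z) * W)) := by
  induction W using tensor_induction₃ with
  | zero => simp
  | add x y hx hy => simp only [map_add, TensorProduct.tmul_add, mul_add, hx, hy]
  | tmul p q r =>
    induction Z using tensor_induction₃ with
    | zero => simp
    | add x y hx hy => simp only [map_add, add_mul, hx, hy]
    | tmul a b c =>
      have key : ∀ D : H ⊗[k] H, contract k H (padRight₄ k H
          (Algebra.TensorProduct.assoc k k k H H (H ⊗[k] H) (D ⊗ₜ (b ⊗ₜ c))) *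
            (1 ⊗ₜ (1 ⊗ₜ (p ⊗ₜ (q ⊗ₜ r))))) = 𝓔 ((b * p) ⊗ₜ (c * q)) ⊗ₜ (𝓑 D ⊗ₜ r) := by
        intro D
        induction D using TensorProduct.induction_on with
        | zero => simp
        | add x y hx hy =>
          simp only [TensorProduct.add_tmul, TensorProduct.tmul_add, map_add, add_mul, hx, hy]
        | tmul x y => simp [contract_tmul]
      rw [comulFst_tmul, key, betaAntipode_comul]
      simp [qMap_tmul, TensorProduct.smul_tmul]

/-- `∑ (1 ⊗ X¹) Ṽ Δ(S(X²) α X³) = q_L`. -/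
theorem sandwichAlpha_vElem :
    sandwichAlpha (Algebra.TensorProduct.includeRight : H →ₐ[k] H ⊗[k] H) Δ (vElem k H) Φ =
      qL k H := by
  have h1 : ∀ T, contract k H (padRight₄ k H (comulThd k H Φ) * T) = contract k H T := by
    refine absorb_thd_left (d := (padRight₄ k H).comp (comulThd k H)) isCounital_phi ?_
    intro h T
    induction T using TensorProduct.induction_on with
    | zero => simp
    | add x y hx hy => simp only [map_add, mul_add, hx, hy, smul_add]
    | tmul t₁ T =>
      induction T using tensor_induction₄ with
      | zero => simp
      | add x y hx hy => simp only [map_add, TensorProduct.tmul_add, mul_add, hx, hy, smul_add]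
      | tmul t₂ t₃ t₄ t₅ =>
        have key : ∀ D : H ⊗[k] H, contract k H ((1 ⊗ₜ padRight k H (1 ⊗ₜ D)) *
            (t₁ ⊗ₜ (t₂ ⊗ₜ (t₃ ⊗ₜ (t₄ ⊗ₜ t₅))))) =
            𝓔 (D * (t₃ ⊗ₜ t₄)) ⊗ₜ (𝓑 (t₁ ⊗ₜ t₂) ⊗ₜ t₅) := by
          intro D
          induction D using TensorProduct.induction_on with
          | zero => simp
          | add x y hx hy =>
            simp only [TensorProduct.add_tmul, TensorProduct.tmul_add, map_add, add_mul, hx, hy]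
          | tmul x y => simp [contract_tmul]
        rw [AlgHom.comp_apply, comulThd_tmul, comulRight_tmul, padRight₄_tmul, key,
          antipodeAlpha_comul_mul, contract_tmul, TensorProduct.smul_tmul']
  have h2 : ∀ y : H ⊗[k] H, TensorProduct.map LinearMap.id (LinearMap.mul' k H)
      (((1 : H) ⊗ₜ[k] TensorProduct.map LinearMap.id 𝓔 Φ) *
        TensorProduct.map LinearMap.id (TensorProduct.mk k H H β) y) = y := by
    intro y
    induction y using TensorProduct.induction_on with
    | zero => simp
    | add x y hx hy => simp only [map_add, mul_add, hx, hy]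
    | tmul u w =>
      have h3 : ∀ Z, LinearMap.mul' k H (TensorProduct.map LinearMap.id 𝓔 Z * (β ⊗ₜ w)) =
          betaAlpha k H Z * w := by
        intro Z
        induction Z using TensorProduct.induction_on with
        | zero => simp
        | add x y hx hy => simp only [map_add, add_mul, hx, hy]
        | tmul a D => simp [betaAlpha_tmul, mul_assoc]
      simp [h3, betaAlpha_phi]
  -- The four factors in turn: the first closes up to `1` by `h2`; the second is absorbed in slots
  -- 3, 4 by `h1`; the last loses its outer coproduct in slots 1, 2 and leaves `Φ⁻¹` in slots 3, 4,
  -- 5; the third contributes `β`. The remainder is `q_L`.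
  rw [sandwichAlpha_vElem_eq_contractAll, fivefold_pentagon, contractAll_comulThd₄_comulSnd_mul,
    h1, contract_mul_comulFst₄, counitTensor_comulFst, contract_padRight₄_comulFst_mul,
    counitTensor_phi, map_one, one_mul, h2, qL]

end FiveFold

end QuasiHopf
end

noncomputable section

set_option maxSynthPendingDepth 3

namespace QuasiHopf

open QuasiBialgebra QuasiHopfAlgebra

variable {k H : Type*} [Field k] [Ring H] [Algebra k H] [QuasiHopfAlgebra k H]

local notation "Δ" => QuasiBialgebra.comul (k := k) (H := H)
local notation "ε" => QuasiBialgebra.counit (k := k) (H := H)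
local notation "Φ" => phi k H
local notation "Φi" => phiInv k H
local notation "S" => QuasiHopfAlgebra.antipode (k := k) (H := H)
local notation "α" => QuasiHopfAlgebra.α k (H := H)
local notation "β" => QuasiHopfAlgebra.β k (H := H)
local notation "𝓔" => antipodeAlpha k H
local notation "𝓑" => betaAntipode k H

/-! ### Functoriality of covariance. -/

section Map

variable {A B : Type*} [Ring A] [Algebra k A] [Ring B] [Algebra k B] (l r : H →ₐ[k] A)
  (g : A →ₐ[k] B) (T : A)

theorem sandwich_comp (y : H ⊗[k] H) :
    sandwich (g.comp l) (g.comp r) (g T) y = g (sandwich l r T y) := by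
  induction y using TensorProduct.induction_on with
  | zero => simp
  | add x y hx hy => simp only [map_add, hx, hy]
  | tmul a b => simp [sandwich_tmul]

theorem sandwichAlpha_comp (Z : H ⊗[k] (H ⊗[k] H)) :
    sandwichAlpha (g.comp l) (g.comp r) (g T) Z = g (sandwichAlpha l r T Z) := by
  induction Z using TensorProduct.induction_on with
  | zero => simp
  | add x y hx hy => simp only [map_add, hx, hy]
  | tmul a b => simp [sandwichAlpha_tmul]

variable {l r T}

/-- The two halves of `Δ(a)` enclose `T` and turn into `s(a)` by covariance. This is how one copy of
`Ṽ` is evaluated inside a larger product. -/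
theorem IsCovariant.sandwichAlpha_mul_comulLeft {s : H →ₗ[k] A} (hT : IsCovariant l r T s)
    (hs : ∀ a b, s a * l b = l b * s a) (Z : H ⊗[k] (H ⊗[k] H)) (a b : H) :
    sandwichAlpha l r T (Z * comulLeft k H (a ⊗ₜ b)) = s a * sandwichAlpha l r T Z * r b := by
  induction Z using tensor_induction₃ with
  | zero => simp
  | add x y hx hy => simp only [map_add, mul_add, add_mul, hx, hy]
  | tmul p q t =>
    have h3 : ∀ D : H ⊗[k] H, sandwichAlpha l r T ((p ⊗ₜ (q ⊗ₜ t)) *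
        Algebra.TensorProduct.assoc k k k H H H (D ⊗ₜ b)) =
        l p * sandwich l r T D * r (𝓔 (q ⊗ₜ t)) * r b := by
      intro D
      induction D using TensorProduct.induction_on with
      | zero => simp
      | add x y hx hy =>
        simp only [TensorProduct.add_tmul, map_add, mul_add, add_mul, hx, hy]
      | tmul x y => simp [sandwichAlpha_tmul, sandwich_tmul, antipode_mul, mul_assoc]
    rw [comulLeft_tmul, h3, hT, ← mul_assoc (l p), ← hs, sandwichAlpha_tmul]
    simp only [mul_assoc]

end Map

/-! ### The operation `T ↦ ∑ (1 ⊗ a ⊗ b) T (id ⊗ Δ)(Δ(S(c)))`. -/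

section Outer

variable (k H) in
/-- `x ↦ x ⊗ 1` on `H ⊗ H`. -/
def padRight₂ : H ⊗[k] H →ₐ[k] H ⊗[k] (H ⊗[k] H) :=
  Algebra.TensorProduct.map (AlgHom.id k H) Algebra.TensorProduct.includeLeft

omit [QuasiHopfAlgebra k H] in
@[simp] theorem padRight₂_tmul (a b : H) : padRight₂ k H (a ⊗ₜ b) = a ⊗ₜ (b ⊗ₜ 1) := rfl

theorem comulLeft_tmul_one (a : H) : comulLeft k H (a ⊗ₜ 1) = padRight₂ k H (Δ a) := by
  rw [comulLeft_tmul]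
  generalize Δ a = D
  induction D using TensorProduct.induction_on with
  | zero => simp
  | add x y hx hy => simp only [TensorProduct.add_tmul, map_add, hx, hy]
  | tmul x y => rfl

theorem comulLeft_one_tmul (a : H) : comulLeft k H (1 ⊗ₜ a) = 1 ⊗ₜ (1 ⊗ₜ a) := by
  rw [comulLeft_tmul, map_one]; rfl

omit [QuasiHopfAlgebra k H] in
theorem padRight₂_mul_comm (D : H ⊗[k] H) (a : H) :
    padRight₂ k H D * (1 ⊗ₜ (1 ⊗ₜ a)) = (1 ⊗ₜ (1 ⊗ₜ a)) * padRight₂ k H D := by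
  induction D using TensorProduct.induction_on with
  | zero => simp
  | add x y hx hy => simp only [map_add, mul_add, add_mul, hx, hy]
  | tmul x y => simp

variable (k H) in
/-- `(id ⊗ Δ) ∘ Δ`. -/
def comulTwice : H →ₐ[k] H ⊗[k] (H ⊗[k] H) := (comulRight k H).comp Δ

theorem comulTwice_apply (a : H) : comulTwice k H a = comulRight k H (Δ a) := rfl

/-- `a ⊗ b ⊗ c ↦ (1 ⊗ a ⊗ b) T ((id ⊗ Δ)Δ(S(c)))`. -/
def outerSandwich (T : H ⊗[k] (H ⊗[k] H)) : H ⊗[k] (H ⊗[k] H) →ₗ[k] H ⊗[k] (H ⊗[k] H) :=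
  LinearMap.mul' k _ ∘ₗ TensorProduct.map
    (Algebra.TensorProduct.includeRight : H ⊗[k] H →ₐ[k] H ⊗[k] (H ⊗[k] H)).toLinearMap
    (LinearMap.mulLeft k T ∘ₗ (comulTwice k H).toLinearMap ∘ₗ S) ∘ₗ
    (TensorProduct.assoc k H H H).symm.toLinearMap

theorem outerSandwich_tmul (T : H ⊗[k] (H ⊗[k] H)) (a b c : H) :
    outerSandwich T (a ⊗ₜ (b ⊗ₜ c)) =
      ((1 : H) ⊗ₜ[k] (a ⊗ₜ[k] b)) * (T * comulTwice k H (S c)) := rfl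

theorem outerSandwich_assoc (T : H ⊗[k] (H ⊗[k] H)) (D : H ⊗[k] H) (c : H) :
    outerSandwich T (Algebra.TensorProduct.assoc k k k H H H (D ⊗ₜ c)) =
      ((1 : H) ⊗ₜ[k] D) * (T * comulTwice k H (S c)) := by
  induction D using TensorProduct.induction_on with
  | zero => simp
  | add x y hx hy => simp only [TensorProduct.add_tmul, TensorProduct.tmul_add, map_add, add_mul, hx, hy]
  | tmul x y => rfl

theorem outerSandwich_add (T T' : H ⊗[k] (H ⊗[k] H)) :
    outerSandwich (T + T') = outerSandwich T + outerSandwich T' := by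
  ext a b c
  simp [outerSandwich_tmul, mul_add, add_mul]

theorem outerSandwich_zero : outerSandwich (0 : H ⊗[k] (H ⊗[k] H)) = 0 := by
  ext a b c
  simp [outerSandwich_tmul]

/-- This makes `outerSandwich` an action of the algebra `H ⊗ H ⊗ H`, so the operation for `Φ` is
undone by the one for `Φ⁻¹`. -/
theorem outerSandwich_mul (T Z W : H ⊗[k] (H ⊗[k] H)) :
    outerSandwich T (Z * W) = outerSandwich (outerSandwich T W) Z := by
  induction W using tensor_induction₃ with
  | zero => simp [outerSandwich_zero]
  | add x y hx hy => simp only [map_add, mul_add, hx, hy, outerSandwich_add, LinearMap.add_apply]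
  | tmul a b c =>
    induction Z using tensor_induction₃ with
    | zero => simp
    | add x y hx hy => simp only [map_add, add_mul, hx, hy]
    | tmul p q t =>
      rw [Algebra.TensorProduct.tmul_mul_tmul, Algebra.TensorProduct.tmul_mul_tmul,
        outerSandwich_tmul, outerSandwich_tmul, outerSandwich_tmul, antipode_mul, map_mul,
        ← one_mul (1 : H), ← Algebra.TensorProduct.tmul_mul_tmul,
        ← Algebra.TensorProduct.tmul_mul_tmul, one_mul]
      simp only [mul_assoc]

theorem outerSandwich_one (T : H ⊗[k] (H ⊗[k] H)) : outerSandwich T 1 = T := by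
  rw [Algebra.TensorProduct.one_def, Algebra.TensorProduct.one_def, outerSandwich_tmul,
    antipode_one, map_one, mul_one, ← Algebra.TensorProduct.one_def,
    ← Algebra.TensorProduct.one_def, one_mul]

end Outer

/-! ### Covariance of both sides of the cocycle identity. -/

section TwistedCocycle

local notation "V" => vElem k H
local notation "ι₂" => (Algebra.TensorProduct.includeRight : H →ₐ[k] H ⊗[k] H)

variable (k H) in
/-- `(Ṽ ⊗ 1) (Δ ⊗ id)(Ṽ) Φ⁻¹`. -/
def vProd : H ⊗[k] (H ⊗[k] H) := padRight₂ k H V * comulLeft k H V * Φi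

variable (k H) in
/-- `h ↦ S(h) ⊗ 1 ⊗ 1`. -/
def antipodeFst : H →ₗ[k] H ⊗[k] (H ⊗[k] H) := (TensorProduct.mk k H (H ⊗[k] H)).flip 1 ∘ₗ S

theorem antipodeFst_apply (h : H) : antipodeFst k H h = S h ⊗ₜ 1 := rfl

theorem antipodeFst_eq (h : H) : antipodeFst k H h = padRight₂ k H (S h ⊗ₜ 1) := rfl

theorem antipodeFst_mul_comm (h : H) (D : H ⊗[k] H) :
    antipodeFst k H h * ((1 : H) ⊗ₜ[k] D) = ((1 : H) ⊗ₜ[k] D) * antipodeFst k H h := by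
  simp [antipodeFst_apply]

theorem vElem_comm (a b : H) :
    ((TensorProduct.mk k H H).flip 1 ∘ₗ S) a * ι₂ b = ι₂ b * ((TensorProduct.mk k H H).flip 1 ∘ₗ S) a := by
  simp

theorem phiInv_mul_comulTwice (h : H) : Φi * comulTwice k H h = comulLeft k H (Δ h) * Φi :=
  phiInv_mul_comulRight_comul h

/-- The iterated coproduct of `S(c)` passes `Φ⁻¹` and becomes `(Δ ⊗ id)(Δ(S(c)))`. Covariance of the
copy `(Δ ⊗ id)(Ṽ)` then yields `Δ(S(b)) ⊗ 1`, exactly what the copy `Ṽ ⊗ 1` needs for its own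
covariance. -/
theorem outerSandwich_vProd_comulRight (y : H ⊗[k] H) :
    outerSandwich (vProd k H) (comulRight k H y) =
      padRight₂ k H (sandwich ι₂ Δ V y) * comulLeft k H V * Φi := by
  have h1 : ∀ (a : H) (D : H ⊗[k] H), outerSandwich (vProd k H) (a ⊗ₜ D) =
      padRight₂ k H (1 ⊗ₜ a) * padRight₂ k H V * comulLeft k H (sandwich ι₂ Δ V D) * Φi := by
    intro a D
    induction D using TensorProduct.induction_on with
    | zero => simp
    | add x y hx hy =>
      simp only [TensorProduct.tmul_add, map_add, mul_add, add_mul, hx, hy]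
    | tmul b c =>
      have : ((1 : H) ⊗ₜ[k] (a ⊗ₜ[k] b)) =
          padRight₂ k H (1 ⊗ₜ a) * ((1 : H) ⊗ₜ[k] ((1 : H) ⊗ₜ[k] b)) := by simp
      rw [outerSandwich_tmul, vProd, mul_assoc _ Φi, phiInv_mul_comulTwice, sandwich_tmul,
        Algebra.TensorProduct.includeRight_apply, map_mul, map_mul, comulLeft_one_tmul, this]
      simp only [mul_assoc]
      rw [← mul_assoc (padRight₂ k H V) (1 ⊗ₜ (1 ⊗ₜ b)), padRight₂_mul_comm]
      simp only [mul_assoc]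
  induction y using TensorProduct.induction_on with
  | zero => simp
  | add x y hx hy => simp only [map_add, add_mul, hx, hy]
  | tmul a b =>
    rw [comulRight_tmul, h1, isCovariant_vElem, sandwich_tmul]
    change _ * comulLeft k H ((S b ⊗ₜ 1) * V) * Φi = _
    rw [map_mul (comulLeft k H), comulLeft_tmul_one, Algebra.TensorProduct.includeRight_apply,
      map_mul (padRight₂ k H), map_mul (padRight₂ k H)]
    simp only [mul_assoc]

theorem outerSandwich_vProd_mul_comulRight_comul (W : H ⊗[k] (H ⊗[k] H)) (h : H) :
    outerSandwich (vProd k H) (W * comulRight k H (Δ h)) =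
      antipodeFst k H h * outerSandwich (vProd k H) W := by
  have h1 : outerSandwich (vProd k H) (comulRight k H (Δ h)) = antipodeFst k H h * vProd k H := by
    rw [outerSandwich_vProd_comulRight, isCovariant_vElem, map_mul (padRight₂ k H), antipodeFst_eq,
      vProd]
    simp only [mul_assoc]
    rfl
  rw [outerSandwich_mul, h1]
  induction W using tensor_induction₃ with
  | zero => simp
  | add x y hx hy => simp only [map_add, mul_add, hx, hy]
  | tmul p q r =>
    simp only [outerSandwich_tmul, mul_assoc]
    rw [← mul_assoc (antipodeFst k H h) (1 ⊗ₜ (p ⊗ₜ q)), antipodeFst_mul_comm, mul_assoc]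

theorem sandwich_outerSandwich (T W : H ⊗[k] (H ⊗[k] H)) (y : H ⊗[k] H) :
    sandwich ((comulRight k H).comp ι₂) (comulTwice k H) (outerSandwich T W) y =
      outerSandwich T (comulLeft k H y * W) := by
  rw [outerSandwich_mul]
  induction y using TensorProduct.induction_on with
  | zero => simp
  | add x y hx hy => simp only [map_add, hx, hy]
  | tmul a b =>
    rw [comulLeft_tmul, outerSandwich_assoc, sandwich_tmul]
    rfl

theorem isCovariant_outerSandwich_vProd :
    IsCovariant ((comulRight k H).comp ι₂) (comulTwice k H) (outerSandwich (vProd k H) Φi)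
      (antipodeFst k H) := by
  intro h
  rw [sandwich_outerSandwich, ← phiInv_mul_comulRight_comul,
    outerSandwich_vProd_mul_comulRight_comul]

theorem isCovariant_comulRight_vElem :
    IsCovariant ((comulRight k H).comp ι₂) (comulTwice k H) (comulRight k H V)
      (antipodeFst k H) := by
  intro h
  rw [comulTwice, sandwich_comp, isCovariant_vElem, map_mul (comulRight k H)]
  congr 1
  change comulRight k H (S h ⊗ₜ 1) = _
  rw [comulRight_tmul, map_one]
  rfl

end TwistedCocycle

end QuasiHopf
end

noncomputable section

set_option maxSynthPendingDepth 3

namespace QuasiHopf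

open QuasiBialgebra QuasiHopfAlgebra

variable {k H : Type*} [Field k] [Ring H] [Algebra k H] [QuasiHopfAlgebra k H]

local notation "Δ" => QuasiBialgebra.comul (k := k) (H := H)
local notation "ε" => QuasiBialgebra.counit (k := k) (H := H)
local notation "Φ" => phi k H
local notation "Φi" => phiInv k H
local notation "S" => QuasiHopfAlgebra.antipode (k := k) (H := H)
local notation "α" => QuasiHopfAlgebra.α k (H := H)
local notation "β" => QuasiHopfAlgebra.β k (H := H)
local notation "𝓔" => antipodeAlpha k H
local notation "𝓑" => betaAntipode k H

/-! ### The invariant of the product, and the cocycle identity. -/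

section TwistedCocycle

local notation "V" => vElem k H
local notation "ι₂" => (Algebra.TensorProduct.includeRight : H →ₐ[k] H ⊗[k] H)

omit [QuasiHopfAlgebra k H] in
theorem assoc_tmul_eq_padRight₂_mul (D : H ⊗[k] H) (c : H) :
    Algebra.TensorProduct.assoc k k k H H H (D ⊗ₜ c) = padRight₂ k H D * (1 ⊗ₜ (1 ⊗ₜ c)) := by
  induction D using TensorProduct.induction_on with
  | zero => simp
  | add x y hx hy => simp only [TensorProduct.add_tmul, map_add, add_mul, hx, hy]
  | tmul x y => simp

/-- `a ⊗ b ⊗ c ⊗ d ↦ (1 ⊗ a ⊗ b) T ((id ⊗ Δ)Δ(S(c) α d))`. -/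
def outerSandwichAlpha (T : H ⊗[k] (H ⊗[k] H)) :
    H ⊗[k] (H ⊗[k] (H ⊗[k] H)) →ₗ[k] H ⊗[k] (H ⊗[k] H) :=
  LinearMap.mul' k _ ∘ₗ TensorProduct.map
    (Algebra.TensorProduct.includeRight : H ⊗[k] H →ₐ[k] H ⊗[k] (H ⊗[k] H)).toLinearMap
    (LinearMap.mulLeft k T ∘ₗ (comulTwice k H).toLinearMap ∘ₗ 𝓔) ∘ₗ
    (TensorProduct.assoc k H H (H ⊗[k] H)).symm.toLinearMap

theorem outerSandwichAlpha_tmul (T : H ⊗[k] (H ⊗[k] H)) (a b : H) (D : H ⊗[k] H) :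
    outerSandwichAlpha T (a ⊗ₜ (b ⊗ₜ D)) =
      ((1 : H) ⊗ₜ[k] (a ⊗ₜ[k] b)) * (T * comulTwice k H (𝓔 D)) := rfl

theorem outerSandwichAlpha_assoc (T : H ⊗[k] (H ⊗[k] H)) (D D' : H ⊗[k] H) :
    outerSandwichAlpha T (Algebra.TensorProduct.assoc k k k H H (H ⊗[k] H) (D ⊗ₜ D')) =
      ((1 : H) ⊗ₜ[k] D) * (T * comulTwice k H (𝓔 D')) := by
  induction D using TensorProduct.induction_on with
  | zero => simp
  | add x y hx hy =>
    simp only [TensorProduct.add_tmul, TensorProduct.tmul_add, map_add, add_mul, hx, hy]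
  | tmul x y => rfl

theorem outerSandwichAlpha_comulThd_phiInv_mul (T : H ⊗[k] (H ⊗[k] H))
    (W : H ⊗[k] (H ⊗[k] (H ⊗[k] H))) :
    outerSandwichAlpha T (comulThd k H Φi * W) = outerSandwichAlpha T W := by
  refine absorb_thd_left isCounital_phiInv ?_ W
  intro h W
  induction W using tensor_induction₄ with
  | zero => simp
  | add x y hx hy => simp only [map_add, mul_add, hx, hy, smul_add]
  | tmul a b c d =>
    simp [outerSandwichAlpha_tmul, antipodeAlpha_comul_mul]

theorem sandwichAlpha_outerSandwich (T W Z : H ⊗[k] (H ⊗[k] H)) :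
    sandwichAlpha ((comulRight k H).comp ι₂) (comulTwice k H) (outerSandwich T W) Z =
      outerSandwichAlpha T (comulFst k H Z * padRight k H W) := by
  induction W using tensor_induction₃ with
  | zero =>
    induction Z using TensorProduct.induction_on with
    | zero => simp
    | add x y hx hy => simp_all
    | tmul a b => simp [sandwichAlpha_tmul]
  | add x y hx hy =>
    have : ∀ A B, sandwichAlpha ((comulRight k H).comp ι₂) (comulTwice k H) (A + B) Z =
        sandwichAlpha ((comulRight k H).comp ι₂) (comulTwice k H) A Z +
        sandwichAlpha ((comulRight k H).comp ι₂) (comulTwice k H) B Z := by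
      intro A B
      rw [← LinearMap.add_apply]
      congr 1
      ext a b c
      simp [sandwichAlpha_tmul, mul_add, add_mul]
    simp only [map_add, mul_add, this, hx, hy]
  | tmul p q r =>
    induction Z using tensor_induction₃ with
    | zero => simp
    | add x y hx hy => simp only [map_add, add_mul, hx, hy]
    | tmul a b c =>
      rw [comulFst_tmul, padRight_tmul, tmul_tmul_eq_assoc p q (r ⊗ₜ[k] (1 : H)), ← map_mul,
        Algebra.TensorProduct.tmul_mul_tmul, outerSandwichAlpha_assoc, sandwichAlpha_tmul,
        outerSandwich_tmul, Algebra.TensorProduct.tmul_mul_tmul, mul_one,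
        ← one_mul (1 : H), ← Algebra.TensorProduct.tmul_mul_tmul, one_mul]
      simp only [antipodeAlpha_tmul, antipode_mul, map_mul, mul_assoc]
      rfl

theorem outerSandwichAlpha_vProd_tmul (a : H) (Y : H ⊗[k] (H ⊗[k] H)) :
    outerSandwichAlpha (vProd k H) (a ⊗ₜ Y) = padRight₂ k H (1 ⊗ₜ a) * padRight₂ k H V *
      comulLeft k H (sandwichAlpha ι₂ Δ V Y) * Φi := by
  induction Y using TensorProduct.induction_on with
  | zero => simp
  | add x y hx hy =>
    simp only [TensorProduct.tmul_add, map_add, mul_add, add_mul, hx, hy]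
  | tmul b D =>
    have : ((1 : H) ⊗ₜ[k] (a ⊗ₜ[k] b)) =
        padRight₂ k H (1 ⊗ₜ a) * ((1 : H) ⊗ₜ[k] ((1 : H) ⊗ₜ[k] b)) := by simp
    rw [outerSandwichAlpha_tmul, vProd, mul_assoc _ Φi, phiInv_mul_comulTwice, sandwichAlpha_tmul,
      Algebra.TensorProduct.includeRight_apply, map_mul, map_mul, comulLeft_one_tmul, this]
    simp only [mul_assoc]
    rw [← mul_assoc (padRight₂ k H V) (1 ⊗ₜ (1 ⊗ₜ b)), padRight₂_mul_comm]
    simp only [mul_assoc]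

variable (k H) in
/-- `a ⊗ b ⊗ c ⊗ d ↦ (1 ⊗ a) Ṽ Δ(S(b) α c) ⊗ d`. -/
def vSandwich : H ⊗[k] (H ⊗[k] (H ⊗[k] H)) →ₗ[k] H ⊗[k] (H ⊗[k] H) :=
  (TensorProduct.assoc k H H H).toLinearMap ∘ₗ
    TensorProduct.map (sandwichAlpha ι₂ Δ V) LinearMap.id ∘ₗ
    (TensorProduct.assoc k H (H ⊗[k] H) H).symm.toLinearMap ∘ₗ
    TensorProduct.map LinearMap.id (TensorProduct.assoc k H H H).symm.toLinearMap

theorem vSandwich_tmul (a b c d : H) : vSandwich k H (a ⊗ₜ (b ⊗ₜ (c ⊗ₜ d))) =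
    Algebra.TensorProduct.assoc k k k H H H (sandwichAlpha ι₂ Δ V (a ⊗ₜ (b ⊗ₜ c)) ⊗ₜ d) := rfl

theorem vSandwich_tmul_assoc (a d : H) (D : H ⊗[k] H) :
    vSandwich k H (a ⊗ₜ Algebra.TensorProduct.assoc k k k H H H (D ⊗ₜ d)) =
      Algebra.TensorProduct.assoc k k k H H H (sandwichAlpha ι₂ Δ V (a ⊗ₜ D) ⊗ₜ d) := by
  induction D using TensorProduct.induction_on with
  | zero => simp
  | add x y hx hy =>
    simp only [TensorProduct.add_tmul, TensorProduct.tmul_add, map_add, hx, hy]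
  | tmul x y => rfl

theorem vSandwich_comulSnd_phi_mul (T : H ⊗[k] (H ⊗[k] (H ⊗[k] H))) :
    vSandwich k H (comulSnd k H Φ * T) = vSandwich k H T := by
  refine absorb_snd_left isCounital_phi ?_ T
  intro h T
  induction T using tensor_induction₄ with
  | zero => simp
  | add x y hx hy => simp only [map_add, mul_add, hx, hy, smul_add]
  | tmul a b c d =>
    rw [comulSnd_mul_tmul, vSandwich_tmul_assoc, sandwichAlpha_tmul, antipodeAlpha_comul_mul,
      vSandwich_tmul, sandwichAlpha_tmul, map_smul, mul_smul_comm, mul_smul_comm,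
      ← TensorProduct.smul_tmul', map_smul]

/-- When `X = Φ⁻¹`, the term `qMap k H X` is `q_L`, the invariant produced by the inner copy of `Ṽ`;
this rewrites it as a contraction around the outer copy. -/
theorem vSandwich_padLeft_mul_comulThd (X : H ⊗[k] (H ⊗[k] H)) (a b c : H) :
    vSandwich k H (padLeft k H X * comulThd k H (a ⊗ₜ (b ⊗ₜ c))) =
      padRight₂ k H (1 ⊗ₜ a) * padRight₂ k H V *
        comulLeft k H ((S b ⊗ₜ 1) * qMap k H X * Δ c) := by
  rw [padLeft_apply, comulThd_tmul, Algebra.TensorProduct.tmul_mul_tmul, one_mul, comulRight_tmul]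
  generalize Δ c = D
  induction X using tensor_induction₃ with
  | zero => simp
  | add x y hx hy =>
    simp only [map_add, mul_add, add_mul, TensorProduct.tmul_add, hx, hy]
  | tmul p q r =>
    induction D using TensorProduct.induction_on with
    | zero => simp
    | add x y hx hy => simp only [map_add, mul_add, TensorProduct.tmul_add, hx, hy]
    | tmul d e =>
      rw [Algebra.TensorProduct.tmul_mul_tmul, Algebra.TensorProduct.tmul_mul_tmul,
        vSandwich_tmul, assoc_tmul_eq_padRight₂_mul, qMap_tmul,
        Algebra.TensorProduct.tmul_mul_tmul, Algebra.TensorProduct.tmul_mul_tmul, one_mul,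
        comulLeft_tmul, assoc_tmul_eq_padRight₂_mul, sandwichAlpha_tmul,
        Algebra.TensorProduct.includeRight_apply, map_mul (padRight₂ k H),
        map_mul (padRight₂ k H)]
      simp only [antipodeAlpha_tmul, antipode_mul, mul_assoc]

theorem vSandwich_padRight_mul_comulFst (X : H ⊗[k] (H ⊗[k] H)) (p q r : H) :
    vSandwich k H (padRight k H X * comulFst k H (p ⊗ₜ (q ⊗ₜ r))) =
      padRight₂ k H ((S p ⊗ₜ 1) * sandwichAlpha ι₂ Δ V X) * comulLeft k H (q ⊗ₜ r) := by
  have h1 : ∀ D : H ⊗[k] H, vSandwich k H (padRight k H X *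
      Algebra.TensorProduct.assoc k k k H H (H ⊗[k] H) (D ⊗ₜ (q ⊗ₜ r))) =
      Algebra.TensorProduct.assoc k k k H H H (sandwichAlpha ι₂ Δ V
        (X * Algebra.TensorProduct.assoc k k k H H H (D ⊗ₜ q)) ⊗ₜ r) := by
    intro D
    induction X using tensor_induction₃ with
    | zero => simp
    | add x y hx hy => simp only [map_add, add_mul, TensorProduct.add_tmul, hx, hy]
    | tmul a b c =>
      induction D using TensorProduct.induction_on with
      | zero => simp
      | add x y hx hy => simp only [map_add, mul_add, TensorProduct.add_tmul, hx, hy]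
      | tmul d e => simp [vSandwich_tmul]
  rw [comulFst_tmul, h1, ← comulLeft_tmul, isCovariant_vElem.sandwichAlpha_mul_comulLeft vElem_comm,
    comulLeft_tmul, assoc_tmul_eq_padRight₂_mul, assoc_tmul_eq_padRight₂_mul,
    map_mul (padRight₂ k H)]
  simp only [mul_assoc]
  rfl

variable (k H) in
/-- `a ⊗ b ⊗ c ⊗ d ↦ S(a) α b ⊗ c ⊗ d`. -/
def qMap₄ : H ⊗[k] (H ⊗[k] (H ⊗[k] H)) →ₗ[k] H ⊗[k] (H ⊗[k] H) :=
  TensorProduct.map 𝓔 LinearMap.id ∘ₗ (TensorProduct.assoc k H H (H ⊗[k] H)).symm.toLinearMap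

theorem qMap₄_tmul (a b : H) (D : H ⊗[k] H) :
    qMap₄ k H (a ⊗ₜ (b ⊗ₜ D)) = 𝓔 (a ⊗ₜ b) ⊗ₜ D := rfl

theorem qMap₄_assoc (D D' : H ⊗[k] H) :
    qMap₄ k H (Algebra.TensorProduct.assoc k k k H H (H ⊗[k] H) (D ⊗ₜ D')) = 𝓔 D ⊗ₜ D' := by
  induction D using TensorProduct.induction_on with
  | zero => simp
  | add x y hx hy => simp only [TensorProduct.add_tmul, map_add, hx, hy]
  | tmul x y => rfl

theorem qMap₄_comulThd (X : H ⊗[k] (H ⊗[k] H)) :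
    qMap₄ k H (comulThd k H X) = comulRight k H (qMap k H X) := by
  induction X using tensor_induction₃ with
  | zero => simp
  | add x y hx hy => simp only [map_add, hx, hy]
  | tmul a b c => simp [qMap₄_tmul, qMap_tmul]

theorem qMap₄_comulFst_phiInv_mul (T : H ⊗[k] (H ⊗[k] (H ⊗[k] H))) :
    qMap₄ k H (comulFst k H Φi * T) = qMap₄ k H T := by
  refine absorb_fst_left isCounital_phiInv ?_ T
  intro h T
  induction T using tensor_induction₄ with
  | zero => simp
  | add x y hx hy => simp only [map_add, mul_add, hx, hy, smul_add]
  | tmul a b c d =>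
    rw [comulFst_mul_tmul, qMap₄_assoc, antipodeAlpha_comul_mul, qMap₄_tmul,
      TensorProduct.smul_tmul']

theorem qMap₄_padRight_mul_comulSnd_mul (X U : H ⊗[k] (H ⊗[k] H)) (p q r : H) :
    qMap₄ k H (padRight k H X * comulSnd k H (p ⊗ₜ (q ⊗ₜ r)) * padLeft k H U) =
      padRight₂ k H ((S p ⊗ₜ 1) * qMap k H X) * comulLeft k H (q ⊗ₜ r) * U := by
  rw [comulSnd_tmul, padLeft_apply, mul_assoc, Algebra.TensorProduct.tmul_mul_tmul, mul_one,
    mul_assoc]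
  generalize comulLeft k H (q ⊗ₜ r) * U = Y
  induction X using tensor_induction₃ with
  | zero => simp
  | add x y hx hy => simp only [map_add, mul_add, add_mul, hx, hy]
  | tmul a b c =>
    induction Y using tensor_induction₃ with
    | zero => simp
    | add x y hx hy => simp only [map_add, mul_add, TensorProduct.tmul_add, hx, hy]
    | tmul x y z => simp [qMap₄_tmul, qMap_tmul, antipode_mul, mul_assoc]

/-- The pentagon is used three times, each time shedding an absorbed outer factor. Between these,
`h1` replaces the copy `(Δ ⊗ id)(Ṽ)` by its invariant `q_L`, and `h2` does the same for `Ṽ ⊗ 1`.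
What is left is `qMap₄` of `(id ⊗ id ⊗ Δ)(Φ⁻¹)`. -/
theorem sandwichAlpha_outerSandwich_vProd :
    sandwichAlpha ((comulRight k H).comp ι₂) (comulTwice k H) (outerSandwich (vProd k H) Φi) Φ =
      comulRight k H (qL k H) := by
  have h1 : ∀ Z, outerSandwichAlpha (vProd k H) (padLeft k H Φ * comulSnd k H Z) =
      vSandwich k H (padLeft k H Φi * comulThd k H Z) * Φi := by
    intro Z
    induction Z using tensor_induction₃ with
    | zero => simp
    | add x y hx hy => simp only [map_add, mul_add, add_mul, hx, hy]
    | tmul a b c =>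
      rw [vSandwich_padLeft_mul_comulThd, padLeft_apply, comulSnd_tmul,
        Algebra.TensorProduct.tmul_mul_tmul, one_mul, outerSandwichAlpha_vProd_tmul,
        isCovariant_vElem.sandwichAlpha_mul_comulLeft vElem_comm, sandwichAlpha_vElem]
      rfl
  have h2 : ∀ Z, vSandwich k H (padRight k H Φ * comulFst k H Z) * Φi =
      qMap₄ k H (padRight k H Φi * comulSnd k H Z * padLeft k H Φi) := by
    intro Z
    induction Z using tensor_induction₃ with
    | zero => simp
    | add x y hx hy => simp only [map_add, mul_add, add_mul, hx, hy]
    | tmul a b c =>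
      rw [vSandwich_padRight_mul_comulFst, qMap₄_padRight_mul_comulSnd_mul, sandwichAlpha_vElem, qL]
  rw [sandwichAlpha_outerSandwich, comulFst_phi_mul_padRight_phiInv, mul_assoc,
    outerSandwichAlpha_comulThd_phiInv_mul, h1, padLeft_phiInv_mul_comulThd_phi, mul_assoc,
    vSandwich_comulSnd_phi_mul, h2, padRight_mul_comulSnd_mul_padLeft_phiInv,
    qMap₄_comulFst_phiInv_mul, qMap₄_comulThd, qL]

/-- `(Ṽ ⊗ 1) (Δ ⊗ id)(Ṽ) Φ⁻¹ = ∑ (1 ⊗ X¹ ⊗ X²) (id ⊗ Δ)(Ṽ Δ(S(X³)))`. -/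
theorem vProd_eq_outerSandwich : vProd k H = outerSandwich (comulRight k H V) Φ := by
  -- With `Φ` moved to the left, the identity compares two elements covariant for the same `l`, `r`,
  -- `s`, so equality of their invariants suffices.
  have h : outerSandwich (vProd k H) Φi = comulRight k H V := by
    refine isCovariant_outerSandwich_vProd.eq isCovariant_comulRight_vElem ?_ ?_
    · intro a b
      exact antipodeFst_mul_comm a (Δ b)
    · rw [sandwichAlpha_outerSandwich_vProd, comulTwice, sandwichAlpha_comp, sandwichAlpha_vElem]
  rw [← h, ← outerSandwich_mul, phi_mul_phiInv, outerSandwich_one]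

end TwistedCocycle

end QuasiHopf
end

noncomputable section

set_option maxSynthPendingDepth 3

namespace QuasiHopf

open QuasiBialgebra QuasiHopfAlgebra

variable {k H : Type*} [Field k] [Ring H] [Algebra k H] [QuasiHopfAlgebra k H]

local notation "Δ" => QuasiBialgebra.comul (k := k) (H := H)
local notation "ε" => QuasiBialgebra.counit (k := k) (H := H)
local notation "Φ" => phi k H
local notation "Φi" => phiInv k H
local notation "S" => QuasiHopfAlgebra.antipode (k := k) (H := H)
local notation "α" => QuasiHopfAlgebra.α k (H := H)
local notation "β" => QuasiHopfAlgebra.β k (H := H)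
local notation "𝓔" => antipodeAlpha k H
local notation "𝓑" => betaAntipode k H

/-! ### Dual bases and slices. -/

section EvalDual

variable {ι : Type*} [Fintype ι] (e : Module.Basis ι k H)

variable (k) in
/-- `a ⊗ ξ ↦ ξ(y) a`. -/
def evalDual (y : H) : H ⊗[k] Module.Dual k H →ₗ[k] H :=
  (TensorProduct.rid k H).toLinearMap ∘ₗ TensorProduct.map LinearMap.id (Module.Dual.eval k H y)

omit [QuasiHopfAlgebra k H] in
@[simp] theorem evalDual_tmul (y a : H) (ξ : Module.Dual k H) :
    evalDual k y (a ⊗ₜ ξ) = ξ y • a := rfl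

omit [QuasiHopfAlgebra k H] in
theorem sum_apply_basis_smul_coord (ξ : Module.Dual k H) : ∑ i, ξ (e i) • e.coord i = ξ := by
  refine e.ext fun j => ?_
  simp

omit [QuasiHopfAlgebra k H] in
theorem sum_evalDual_tmul_coord (w : H ⊗[k] Module.Dual k H) :
    ∑ i, evalDual k (e i) w ⊗ₜ[k] e.coord i = w := by
  induction w using TensorProduct.induction_on with
  | zero => simp
  | add x y hx hy => simp only [map_add, TensorProduct.add_tmul, Finset.sum_add_distrib, hx, hy]
  | tmul a ξ =>
    simp only [evalDual_tmul, TensorProduct.smul_tmul, ← TensorProduct.tmul_sum,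
      sum_apply_basis_smul_coord]

omit [QuasiHopfAlgebra k H] in
theorem sum_coord_smul (y : H) : ∑ i, e.coord i y • e i = y := e.sum_repr y

omit [QuasiHopfAlgebra k H] in
include e in
theorem evalDual_injective {w w' : H ⊗[k] Module.Dual k H}
    (h : ∀ y, evalDual k y w = evalDual k y w') : w = w' := by
  rw [← sum_evalDual_tmul_coord e w, ← sum_evalDual_tmul_coord e w']
  simp only [h]

omit [QuasiHopfAlgebra k H] in
theorem sum_basis_tmul_slice (u : H ⊗[k] H) :
    ∑ i, e i ⊗ₜ[k] TensorProduct.lid k H (TensorProduct.map (e.coord i) LinearMap.id u) = u := by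
  induction u using TensorProduct.induction_on with
  | zero => simp
  | add x y hx hy => simp only [map_add, TensorProduct.tmul_add, Finset.sum_add_distrib, hx, hy]
  | tmul a b =>
    simp only [TensorProduct.map_tmul, TensorProduct.lid_tmul, LinearMap.id_apply,
      TensorProduct.tmul_smul, TensorProduct.smul_tmul', ← TensorProduct.sum_tmul,
      sum_coord_smul]

end EvalDual

/-! ### The structure map of the fundamental theorem. -/

section Fundamental

variable (k H) in
/-- `a ⊗ b ↦ ∑ X¹ a₁ ⊗ S(X² a₂) α X³ b`. -/
def contractMap : H ⊗[k] H →ₗ[k] H ⊗[k] H :=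
  TensorProduct.map LinearMap.id 𝓔 ∘ₗ LinearMap.mulLeft k Φ ∘ₗ (comulLeft k H).toLinearMap

theorem contractMap_apply (D : H ⊗[k] H) :
    contractMap k H D = TensorProduct.map LinearMap.id 𝓔 (Φ * comulLeft k H D) := rfl

theorem map_antipodeAlpha_comulRight_mul (y : H ⊗[k] H) (T : H ⊗[k] (H ⊗[k] H)) :
    TensorProduct.map LinearMap.id 𝓔 (comulRight k H y * T) =
      (tensorCounit k H H y ⊗ₜ 1) * TensorProduct.map LinearMap.id 𝓔 T := by
  induction T using TensorProduct.induction_on with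
  | zero => simp
  | add x y hx hy => simp only [map_add, mul_add, hx, hy]
  | tmul a D =>
    induction y using TensorProduct.induction_on with
    | zero => simp
    | add x y hx hy => simp only [TensorProduct.add_tmul, map_add, add_mul, hx, hy]
    | tmul p q =>
      simp [antipodeAlpha_comul_mul, TensorProduct.smul_tmul']

/-- Past `Φ` the iterated coproduct of `h` becomes `(id ⊗ Δ)(Δ(h))`, and `S α` absorbs its last two
slots. Thus the diagonal action is converted into the action on the first factor. -/
theorem contractMap_comul_mul (h : H) (D : H ⊗[k] H) :
    contractMap k H (Δ h * D) = (h ⊗ₜ 1) * contractMap k H D := by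
  rw [contractMap_apply, map_mul (comulLeft k H), ← mul_assoc, ← comulRight_comul_mul_phi,
    mul_assoc, map_antipodeAlpha_comulRight_mul, tensorCounit_comul]
  rfl

theorem contractMap_mul_tmul (D : H ⊗[k] H) (b : H) :
    contractMap k H (D * (1 ⊗ₜ b)) = contractMap k H D * (1 ⊗ₜ b) := by
  rw [contractMap_apply, contractMap_apply, map_mul (comulLeft k H), ← mul_assoc]
  generalize Φ * comulLeft k H D = T
  rw [comulLeft_one_tmul]
  induction T using tensor_induction₃ with
  | zero => simp
  | add x y hx hy => simp only [map_add, add_mul, hx, hy]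
  | tmul p q r => simp [mul_assoc]

variable (k H) in
/-- `p_R = ∑ x¹ ⊗ x² β S(x³)`. -/
def pR : H ⊗[k] H := TensorProduct.map LinearMap.id 𝓑 Φi

theorem contractMap_pR : contractMap k H (pR k H) = 1 := by
  have key : ∀ Z, contractMap k H (TensorProduct.map LinearMap.id 𝓑 Z) =
      TensorProduct.map LinearMap.id (alphaBeta k H) (padRight k H Φ * comulFst k H Z) := by
    intro Z
    induction Z using tensor_induction₃ with
    | zero => simp
    | add x y hx hy => simp only [map_add, mul_add, hx, hy]
    | tmul a b c =>
      rw [TensorProduct.map_tmul, contractMap_apply, LinearMap.id_apply, comulLeft_tmul,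
        comulFst_tmul]
      generalize Δ a = D
      generalize Φ = X
      induction D using TensorProduct.induction_on with
      | zero => simp
      | add x y hx hy => simp only [map_add, mul_add, TensorProduct.add_tmul, hx, hy]
      | tmul x y =>
        induction X using tensor_induction₃ with
        | zero => simp
        | add x y hx hy => simp only [map_add, add_mul, hx, hy]
        | tmul p q r => simp [alphaBeta_tmul, mul_assoc]
  rw [pR, key, alphaBeta_padRight_phi_mul_comulFst_phiInv, Algebra.TensorProduct.one_def]

end Fundamental

/-! ### The diagonal action on `H ⊗ M`. -/

section Module

variable {M : Type*} [AddCommGroup M] [Module k M] (ρ : H →ₐ[k] Module.End k M)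

/-- The action of `H ⊗ H` on `H ⊗ M`. -/
def tensorAction : H ⊗[k] H →ₐ[k] Module.End k (H ⊗[k] M) :=
  (Module.endTensorEndAlgHom :
    Module.End k H ⊗[k] Module.End k M →ₐ[k] Module.End k (H ⊗[k] M)).comp
    (Algebra.TensorProduct.map (Algebra.lmul k H) ρ)

omit [QuasiHopfAlgebra k H] in
@[simp] theorem tensorAction_tmul_tmul (a b c : H) (m : M) :
    tensorAction ρ (a ⊗ₜ b) (c ⊗ₜ m) = (a * c) ⊗ₜ ρ b m := rfl

/-- `F ↦ (a ⊗ m ↦ F(a ⊗ 1) (1 ⊗ m))`. -/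
def inducedMap (F : H ⊗[k] H →ₗ[k] H ⊗[k] H) : H ⊗[k] M →ₗ[k] H ⊗[k] M :=
  TensorProduct.lift (LinearMap.lcomp k _ (TensorProduct.mk k H M 1) ∘ₗ
    (tensorAction ρ).toLinearMap ∘ₗ F ∘ₗ (TensorProduct.mk k H H).flip 1)

omit [QuasiHopfAlgebra k H] in
theorem inducedMap_tmul (F : H ⊗[k] H →ₗ[k] H ⊗[k] H) (a : H) (m : M) :
    inducedMap ρ F (a ⊗ₜ m) = tensorAction ρ (F (a ⊗ₜ 1)) (1 ⊗ₜ m) := rfl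

omit [QuasiHopfAlgebra k H] in
theorem inducedMap_tensorAction (F : H ⊗[k] H →ₗ[k] H ⊗[k] H)
    (hF : ∀ D b, F (D * (1 ⊗ₜ b)) = F D * (1 ⊗ₜ b)) (D : H ⊗[k] H) (m : M) :
    inducedMap ρ F (tensorAction ρ D (1 ⊗ₜ m)) = tensorAction ρ (F D) (1 ⊗ₜ m) := by
  induction D using TensorProduct.induction_on with
  | zero => simp
  | add x y hx hy => simp only [map_add, LinearMap.add_apply, hx, hy]
  | tmul a b =>
    have : a ⊗ₜ[k] b = (a ⊗ₜ 1) * (1 ⊗ₜ b) := by simp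
    rw [tensorAction_tmul_tmul, inducedMap_tmul, this, hF, map_mul, Module.End.mul_apply,
      tensorAction_tmul_tmul, one_mul, mul_one]

omit [QuasiHopfAlgebra k H] in
theorem tensorAction_mul_apply (D D' : H ⊗[k] H) (z : H ⊗[k] M) :
    tensorAction ρ D (tensorAction ρ D' z) = tensorAction ρ (D * D') z := by
  rw [map_mul, Module.End.mul_apply]

omit [QuasiHopfAlgebra k H] in
theorem tmul_eq_tensorAction (a : H) (m : M) : a ⊗ₜ m = tensorAction ρ (a ⊗ₜ 1) (1 ⊗ₜ m) := by
  simp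

theorem inducedMap_contractMap_comul (h : H) (z : H ⊗[k] M) :
    inducedMap ρ (contractMap k H) (tensorAction ρ (Δ h) z) =
      tensorAction ρ (h ⊗ₜ 1) (inducedMap ρ (contractMap k H) z) := by
  induction z using TensorProduct.induction_on with
  | zero => simp
  | add x y hx hy => simp only [map_add, hx, hy]
  | tmul a m =>
    rw [tmul_eq_tensorAction ρ a m, tensorAction_mul_apply,
      inducedMap_tensorAction ρ _ contractMap_mul_tmul,
      inducedMap_tensorAction ρ _ contractMap_mul_tmul, contractMap_comul_mul,
      tensorAction_mul_apply]

/-- A preimage of `a ⊗ m` is `Δ(a) p_R` acting on `1 ⊗ m`, because the map sends `p_R` to `1`. In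
finite dimension surjectivity gives injectivity. -/
theorem inducedMap_contractMap_surjective :
    Function.Surjective (inducedMap ρ (contractMap k H)) := by
  intro z
  induction z using TensorProduct.induction_on with
  | zero => exact ⟨0, map_zero _⟩
  | add x y hx hy =>
    obtain ⟨a, rfl⟩ := hx
    obtain ⟨b, rfl⟩ := hy
    exact ⟨a + b, map_add _ _ _⟩
  | tmul a m =>
    refine ⟨tensorAction ρ (Δ a * pR k H) (1 ⊗ₜ m), ?_⟩
    rw [inducedMap_tensorAction ρ _ contractMap_mul_tmul, contractMap_comul_mul, contractMap_pR,
      mul_one, tensorAction_tmul_tmul]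
    simp

end Module

/-! ### Left integrals and bijectivity of the antipode. -/

section Integral

variable {ι : Type*} [Fintype ι] (e : Module.Basis ι k H)

variable (k H) in
/-- The left action `(h ξ)(y) = ξ(S(h) y)` of `H` on `H*`. -/
def dualAction : H →ₐ[k] Module.End k (Module.Dual k H) :=
  AlgHom.ofLinearMap
    { toFun := fun h => (LinearMap.mulLeft k (S h)).dualMap
      map_add' := fun a b => by ext; simp [add_mul]
      map_smul' := fun c a => by ext; simp }
    (by ext; simp [antipode_one]) (fun a b => by ext; simp [antipode_mul])

@[simp] theorem dualAction_apply (h y : H) (ξ : Module.Dual k H) :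
    dualAction k H h ξ y = ξ (S h * y) := rfl

theorem nontrivial_of_counit (k H : Type*) [Field k] [Ring H] [Algebra k H]
    [QuasiBialgebra k H] : Nontrivial H := by
  refine ⟨⟨1, 0, fun h => ?_⟩⟩
  have := congrArg (QuasiBialgebra.counit (k := k) (H := H)) h
  simp at this

/-- Otherwise `∑ X¹ β S(X²) α X³ = 1` would force `1 = 0`. -/
theorem beta_ne_zero : (β : H) ≠ 0 := by
  intro h
  have : Nontrivial H := nontrivial_of_counit k H
  have h1 : ∀ Z, betaAlpha k H Z = 0 := by
    intro Z
    induction Z using TensorProduct.induction_on with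
    | zero => simp
    | add x y hx hy => simp only [map_add, hx, hy, add_zero]
    | tmul a D => simp [betaAlpha_tmul, h]
  exact one_ne_zero (betaAlpha_phi.symm.trans (h1 Φ))

include e in
theorem exists_leftIntegral : ∃ t : H, t ≠ 0 ∧ ∀ h : H, h * t = ε h • t := by
  have : Module.Finite k H := Module.Finite.of_basis e
  -- Under `H ⊗ H* ≅ End(H)` this is `y ↦ β y`. It is invariant for the diagonal action by `∑ h₁ β
  -- S(h₂) = ε(h) β`, so its image `w` is invariant for left multiplication on the first factor, and
  -- any nonzero slice of `w` is an integral.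
  let z : H ⊗[k] Module.Dual k H := ∑ i, (β * e i) ⊗ₜ e.coord i
  have hz : ∀ y, evalDual k y z = β * y := by
    intro y
    simp only [z, map_sum, evalDual_tmul, ← mul_smul_comm, ← Finset.mul_sum, sum_coord_smul]
  have hinv : ∀ h, tensorAction (dualAction k H) (Δ h) z = ε h • z := by
    intro h
    refine evalDual_injective e fun y => ?_
    have key : ∀ D, evalDual k y (tensorAction (dualAction k H) D z) = 𝓑 D * y := by
      intro D
      induction D using TensorProduct.induction_on with
      | zero => simp
      | add x y hx hy => simp only [map_add, LinearMap.add_apply, add_mul, hx, hy]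
      | tmul a b =>
        simp only [z, map_sum, tensorAction_tmul_tmul, evalDual_tmul, dualAction_apply,
          ← mul_smul_comm, ← Finset.mul_sum, sum_coord_smul, betaAntipode_tmul, mul_assoc]
    rw [key, betaAntipode_comul, map_smul, hz, smul_mul_assoc]
  have hinj : Function.Injective (inducedMap (dualAction k H) (contractMap k H)) :=
    LinearMap.injective_iff_surjective.mpr (inducedMap_contractMap_surjective _)
  set w := inducedMap (dualAction k H) (contractMap k H) z with hw
  have hw0 : w ≠ 0 := by
    intro h0
    have : z = 0 := hinj (by rw [← hw, h0, map_zero])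
    apply beta_ne_zero (k := k) (H := H)
    rw [← mul_one β, ← hz, this, map_zero]
  have hwinv : ∀ h, tensorAction (dualAction k H) (h ⊗ₜ 1) w = ε h • w := by
    intro h
    rw [hw, ← inducedMap_contractMap_comul, hinv, map_smul]
  obtain ⟨y, hy⟩ : ∃ y, evalDual k y w ≠ 0 := by
    by_contra! hcon
    exact hw0 (evalDual_injective e fun y => by rw [hcon, map_zero])
  refine ⟨evalDual k y w, hy, fun h => ?_⟩
  rw [← map_smul, ← hwinv]
  generalize w = w
  induction w using TensorProduct.induction_on with
  | zero => simp
  | add x y hx hy => simp only [map_add, mul_add, hx, hy]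
  | tmul a ξ => simp

variable {u : H ⊗[k] H}

/-- In general `(1 ⊗ h) q_L = ∑ (S(h₁) ⊗ 1) q_L Δ(h₂)`, by quasi-coassociativity and `S α`
absorption; the invariant `u` then swallows `Δ(h₂)`. -/
theorem one_tmul_mul_qL_mul (hu : ∀ h, Δ h * u = ε h • u) (h : H) :
    ((1 : H) ⊗ₜ[k] h) * qL k H * u = (S h ⊗ₜ[k] (1 : H)) * qL k H * u := by
  have h1 : ∀ y T, qMap k H (comulLeft k H y * T) =
      (1 ⊗ₜ counitTensor k H H y) * qMap k H T := by
    intro y T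
    induction T using tensor_induction₃ with
    | zero => simp
    | add x y hx hy => simp only [map_add, mul_add, hx, hy]
    | tmul a b c =>
      induction y using TensorProduct.induction_on with
      | zero => simp
      | add x y hx hy => simp only [TensorProduct.tmul_add, map_add, add_mul, hx, hy]
      | tmul p q =>
        rw [comulLeft_tmul, tmul_tmul_eq_assoc, ← map_mul, Algebra.TensorProduct.tmul_mul_tmul,
          qMap_assoc, antipodeAlpha_comul_mul, qMap_assoc]
        simp [TensorProduct.smul_tmul]
  have h2 : ∀ y T, qMap k H (T * comulRight k H y) * u =
      (S (tensorCounit k H H y) ⊗ₜ 1) * qMap k H T * u := by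
    intro y T
    induction y using TensorProduct.induction_on with
    | zero => simp
    | add x y hx hy => simp only [TensorProduct.add_tmul, map_add, mul_add, add_mul, hx, hy]
    | tmul p q =>
      have h3 : ∀ D, qMap k H (T * (p ⊗ₜ D)) = (S p ⊗ₜ 1) * qMap k H T * D := by
        intro D
        induction T using tensor_induction₃ with
        | zero => simp
        | add x y hx hy => simp only [map_add, mul_add, add_mul, hx, hy]
        | tmul a b c =>
          induction D using TensorProduct.induction_on with
          | zero => simp
          | add x y hx hy => simp only [TensorProduct.tmul_add, map_add, mul_add, hx, hy]
          | tmul d e => simp [qMap_tmul, antipode_mul, mul_assoc]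
      rw [comulRight_tmul, h3, mul_assoc, hu, tensorCounit_tmul, map_smul,
        ← TensorProduct.smul_tmul', smul_mul_assoc, smul_mul_assoc, mul_smul_comm]
  have h4 := h1 (Δ h) Φi
  rw [counitTensor_comul] at h4
  rw [qL, ← h4, ← phiInv_mul_comulRight_comul, h2, tensorCounit_comul]

/-- Contract `(1 ⊗ Φ⁻¹)(id ⊗ id ⊗ Δ)(Φ)` by `a β S(b) α c ⊗ d`. The pentagon and absorption give
`1`; computed directly in front of `u`, which swallows the coproduct, the result is `(β ⊗ 1) q_L u`.
-/
theorem beta_tmul_one_mul_qL_mul (hu : ∀ h, Δ h * u = ε h • u) :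
    (β ⊗ₜ[k] (1 : H)) * qL k H * u = u := by
  let P : H ⊗[k] (H ⊗[k] (H ⊗[k] H)) →ₗ[k] H ⊗[k] H :=
    TensorProduct.map (betaAlpha k H) LinearMap.id ∘ₗ
      (TensorProduct.assoc k H (H ⊗[k] H) H).symm.toLinearMap ∘ₗ
      TensorProduct.map LinearMap.id (TensorProduct.assoc k H H H).symm.toLinearMap
  have hP : ∀ a b c d, P (a ⊗ₜ (b ⊗ₜ (c ⊗ₜ d))) = betaAlpha k H (a ⊗ₜ (b ⊗ₜ c)) ⊗ₜ d :=
    fun a b c d => rfl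
  have hP' : ∀ a D d, P (a ⊗ₜ Algebra.TensorProduct.assoc k k k H H H (D ⊗ₜ d)) =
      betaAlpha k H (a ⊗ₜ D) ⊗ₜ d := by
    intro a D d
    induction D using TensorProduct.induction_on with
    | zero => simp
    | add x y hx hy =>
      simp only [TensorProduct.add_tmul, TensorProduct.tmul_add, map_add, hx, hy]
    | tmul x y => rfl
  have hP'' : ∀ D c d, P (Algebra.TensorProduct.assoc k k k H H (H ⊗[k] H) (D ⊗ₜ (c ⊗ₜ d))) =
      (𝓑 D * (α * c)) ⊗ₜ d := by
    intro D c d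
    induction D using TensorProduct.induction_on with
    | zero => simp
    | add x y hx hy =>
      simp only [TensorProduct.add_tmul, map_add, add_mul, hx, hy]
    | tmul x y => simp [hP, betaAlpha_tmul, mul_assoc]
  have h1 : P (padLeft k H Φi * comulThd k H Φ) = 1 := by
    rw [padLeft_phiInv_mul_comulThd_phi, absorb_fst_right isCounital_phiInv,
      absorb_snd_left isCounital_phi]
    · have : ∀ Z, P (padRight k H Z) = betaAlpha k H Z ⊗ₜ 1 := by
        intro Z
        induction Z using tensor_induction₃ with
        | zero => simp
        | add x y hx hy => simp only [map_add, TensorProduct.add_tmul, hx, hy]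
        | tmul a b c => rw [padRight_tmul, hP]
      rw [this, betaAlpha_phi, Algebra.TensorProduct.one_def]
    · intro h T
      induction T using tensor_induction₄ with
      | zero => simp
      | add x y hx hy => simp only [map_add, mul_add, hx, hy, smul_add]
      | tmul a b c d =>
        rw [comulSnd_mul_tmul, hP', betaAlpha_tmul, antipodeAlpha_comul_mul, hP, betaAlpha_tmul,
          mul_smul_comm, TensorProduct.smul_tmul']
    · intro h T
      induction T using tensor_induction₄ with
      | zero => simp
      | add x y hx hy => simp only [map_add, add_mul, hx, hy, smul_add]
      | tmul a b c d =>
        rw [tmul_mul_comulFst, hP'', betaAntipode_mul_comul, tmul_tmul_eq_assoc a, hP'',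
          smul_mul_assoc, TensorProduct.smul_tmul']
  have h2 : ∀ W Z, P (padLeft k H W * comulThd k H Z) * u =
      (𝓑 (Algebra.TensorProduct.map (AlgHom.id k H) (tensorCounit k H H) Z) ⊗ₜ 1) *
        qMap k H W * u := by
    intro W Z
    induction Z using tensor_induction₃ with
    | zero => simp
    | add x y hx hy => simp only [map_add, TensorProduct.add_tmul, mul_add, add_mul, hx, hy]
    | tmul a b c =>
      have h3 : ∀ D, P ((1 ⊗ₜ W) * (a ⊗ₜ (b ⊗ₜ D))) =
          (𝓑 (a ⊗ₜ b) ⊗ₜ 1) * qMap k H W * D := by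
        intro D
        induction W using tensor_induction₃ with
        | zero => simp
        | add x y hx hy => simp only [map_add, TensorProduct.tmul_add, mul_add, add_mul, hx, hy]
        | tmul x y z =>
          induction D using TensorProduct.induction_on with
          | zero => simp
          | add x y hx hy => simp only [TensorProduct.tmul_add, map_add, mul_add, hx, hy]
          | tmul d e => simp [hP, betaAlpha_tmul, qMap_tmul, antipode_mul, mul_assoc]
      rw [padLeft_apply, comulThd_tmul, comulRight_tmul, h3, mul_assoc, hu]
      simp [← TensorProduct.smul_tmul']
  have h4 := h2 Φi Φ
  rw [h1, one_mul, thd_tensorCounit_phi, Algebra.TensorProduct.one_def, betaAntipode_tmul,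
    antipode_one, one_mul, mul_one] at h4
  exact h4.symm

include e in
-- An element killed by `S` annihilates every right slice of an invariant `u`, by the two preceding
-- identities. The kernel of `S` is a right ideal, so this passes through the structure map, whose
-- value at `u` is `t ⊗ 1`.
theorem antipode_injective : Function.Injective (S : H → H) := by
  obtain ⟨t, ht0, ht⟩ := exists_leftIntegral e
  obtain ⟨u, hu, hK⟩ : ∃ u : H ⊗[k] H, (∀ h, Δ h * u = ε h • u) ∧ contractMap k H u = t ⊗ₜ 1 := by
    -- The preimage of `t ⊗ 1` used for surjectivity; it is invariant because `t` is a left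
    -- integral.
    refine ⟨Δ t * pR k H, fun h => ?_, ?_⟩
    · rw [← mul_assoc, ← map_mul, ht, map_smul, smul_mul_assoc]
    · rw [contractMap_comul_mul, contractMap_pR, mul_one]
  have hann : ∀ g, S g = 0 → ((1 : H) ⊗ₜ[k] g) * u = 0 := by
    intro g hg
    have h1 := one_tmul_mul_qL_mul hu g
    rw [hg, TensorProduct.zero_tmul, zero_mul, zero_mul] at h1
    have h2 : ((1 : H) ⊗ₜ[k] g) * (β ⊗ₜ 1) = (β ⊗ₜ 1) * (1 ⊗ₜ g) := by simp
    calc ((1 : H) ⊗ₜ[k] g) * u = (1 ⊗ₜ g) * ((β ⊗ₜ 1) * qL k H * u) := by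
          rw [beta_tmul_one_mul_qL_mul hu]
      _ = (β ⊗ₜ 1) * ((1 ⊗ₜ g) * qL k H * u) := by
          rw [← mul_assoc, ← mul_assoc, h2, mul_assoc (β ⊗ₜ 1), mul_assoc (β ⊗ₜ 1)]
      _ = 0 := by rw [h1, mul_zero]
  have hslice : ∀ g, S g = 0 → ∀ i,
      g * TensorProduct.lid k H (TensorProduct.map (e.coord i) LinearMap.id u) = 0 := by
    intro g hg i
    have h1 : ∀ v : H ⊗[k] H,
        g * TensorProduct.lid k H (TensorProduct.map (e.coord i) LinearMap.id v) =
        TensorProduct.lid k H (TensorProduct.map (e.coord i) LinearMap.id ((1 ⊗ₜ g) * v)) := by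
      intro v
      induction v using TensorProduct.induction_on with
      | zero => simp
      | add x y hx hy => simp only [map_add, mul_add, hx, hy]
      | tmul a b => simp
    rw [h1, hann g hg, map_zero, map_zero]
  rw [injective_iff_map_eq_zero]
  intro h hh
  have h1 : ((1 : H) ⊗ₜ[k] h) * contractMap k H u = 0 := by
    rw [← sum_basis_tmul_slice e u, map_sum, Finset.mul_sum]
    refine Finset.sum_eq_zero fun i _ => ?_
    set v := TensorProduct.lid k H (TensorProduct.map (e.coord i) LinearMap.id u) with hv
    have h2 : e i ⊗ₜ[k] v = (e i ⊗ₜ 1) * (1 ⊗ₜ v) := by simp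
    rw [h2, contractMap_mul_tmul]
    generalize contractMap k H (e i ⊗ₜ 1) = D
    induction D using TensorProduct.induction_on with
    | zero => simp
    | add x y hx hy => rw [add_mul, mul_add, hx, hy, add_zero]
    | tmul a b =>
      -- The slices of `u` sit to the right of `b`, so it is `h b`, not `h`, that must annihilate
      -- them.
      have h3 : S (h * b) = 0 := by rw [antipode_mul, hh, mul_zero]
      simp [← mul_assoc, hslice _ h3 i, hv]
  rw [hK, Algebra.TensorProduct.tmul_mul_tmul, one_mul, mul_one] at h1
  obtain ⟨φ, hφ⟩ : ∃ φ : Module.Dual k H, φ t ≠ 0 := by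
    by_contra! hcon
    exact ht0 ((Module.forall_dual_apply_eq_zero_iff k t).mp hcon)
  have h2 := congrArg (fun z => TensorProduct.lid k H (TensorProduct.map φ LinearMap.id z)) h1
  simpa [hφ] using h2

include e in
theorem antipode_bijective : Function.Bijective (S : H →ₗ[k] H) := by
  have : Module.Finite k H := Module.Finite.of_basis e
  exact ⟨antipode_injective e, LinearMap.injective_iff_surjective.mp (antipode_injective e)⟩

/-- `Ṽ` as defined with `S⁻¹` agrees with the expression without `S⁻¹`. -/
theorem vTilde_eq (hS : Function.Bijective (S : H →ₗ[k] H)) : vTilde k H = vElem k H := by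
  -- `Ring.inverse` is a genuine inverse only at a unit. Then `S(X² S⁻¹(X¹ β)) = X¹ β S(X²)`, which
  -- eliminates `S⁻¹`.
  have hunit : IsUnit (antipode : Module.End k H) := (Module.End.isUnit_iff _).mpr hS
  have hinv : ∀ x, S (antipodeInv k H x) = x := fun x =>
    LinearMap.congr_fun (Ring.mul_inverse_cancel _ hunit) x
  rw [vTilde, vElem]
  congr 1
  rw [pL]
  generalize Φ = Z
  induction Z using tensor_induction₃ with
  | zero => simp
  | add x y hx hy => simp only [map_add, hx, hy]
  | tmul a b c => simp [vMap_tmul, antipode₂, antipode_mul, hinv]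

end Integral

end QuasiHopf
end

noncomputable section

set_option maxSynthPendingDepth 3

namespace HeisenbergDouble

open QuasiBialgebra QuasiHopfAlgebra QuasiHopf

/-! ### Units and associativity in the Heisenberg double. -/

section Product

variable {k H : Type*} [Field k] [Ring H] [Algebra k H] [QuasiBialgebra k H]

local notation "Δ" => QuasiBialgebra.comul (k := k) (H := H)
local notation "ε" => QuasiBialgebra.counit (k := k) (H := H)
local notation "Φi" => phiInv k H
local notation "𝟙" => (counitDual : Module.Dual k H)

theorem smash_induction {p : HeisenbergDouble k H → Prop} (x : HeisenbergDouble k H)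
    (zero : p 0) (smash : ∀ a ξ, p (smash a ξ)) (add : ∀ x y, p x → p y → p (x + y)) : p x :=
  TensorProduct.induction_on (motive := p) x zero smash add

omit [QuasiBialgebra k H] in
theorem hit_apply (ξ : Module.Dual k H) (a b : H) : hit ξ a b = ξ (a * b) := rfl

omit [QuasiBialgebra k H] in
theorem hit_one (ξ : Module.Dual k H) : hit ξ (1 : H) = ξ := by
  ext; simp [hit_apply]

theorem convolution_tmul (ξ ν : Module.Dual k H) (h : H) :
    convolution (ξ ⊗ₜ ν) h = TensorProduct.dualDistrib k H H (ξ ⊗ₜ ν) (Δ h) := rfl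

theorem counitDual_apply (h : H) : 𝟙 h = ε h := rfl

theorem convolution_hit_counitDual_left (ν : Module.Dual k H) (p q : H) :
    convolution (hit 𝟙 p ⊗ₜ hit ν q) = ε p • hit ν q := by
  ext h
  have key : ∀ D, TensorProduct.dualDistrib k H H (hit 𝟙 p ⊗ₜ hit ν q) D =
      ε p * ν (q * counitTensor k H H D) := by
    intro D
    induction D using TensorProduct.induction_on with
    | zero => simp
    | add x y hx hy => simp only [map_add, mul_add, hx, hy]
    | tmul a b => simp [hit_apply, counitDual_apply, mul_assoc]
  rw [convolution_tmul, key, counitTensor_comul]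
  rfl

theorem convolution_hit_counitDual_right (ξ : Module.Dual k H) (p q : H) :
    convolution (hit ξ p ⊗ₜ hit 𝟙 q) = ε q • hit ξ p := by
  ext h
  have key : ∀ D, TensorProduct.dualDistrib k H H (hit ξ p ⊗ₜ hit 𝟙 q) D =
      ε q * ξ (p * tensorCounit k H H D) := by
    intro D
    induction D using TensorProduct.induction_on with
    | zero => simp
    | add x y hx hy => simp only [map_add, mul_add, hx, hy]
    | tmul a b => simp [hit_apply, counitDual_apply]; ring
  rw [convolution_tmul, key, tensorCounit_comul]
  rfl

/-- Convolution with `ε ↼ p` is multiplication by `ε(p)`, so `Φ⁻¹` contributes only its middle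
counital contraction. The next lemma uses the contraction in the third slot. -/
theorem smashMul_counitDual_left (a b : H) (ν : Module.Dual k H) :
    smashMul a 𝟙 b ν = (a * b) ⊗ₜ ν := by
  have key : ∀ ω, TensorProduct.map (LinearMap.mulLeft k a)
      (convolution ∘ₗ TensorProduct.map (hit 𝟙) (hit ν)) ω =
      TensorProduct.map (LinearMap.mulLeft k a) (hit ν)
        (Algebra.TensorProduct.map (AlgHom.id k H) (counitTensor k H H) ω) := by
    intro ω
    induction ω using tensor_induction₃ with
    | zero => simp
    | add x y hx hy => simp only [map_add, hx, hy]
    | tmul p q r => simp [convolution_hit_counitDual_left]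
  rw [smashMul, key, map_mul, counitTensor_snd_phiInv, mul_one, snd_counitTensor_assoc,
    tensorCounit_comul, TensorProduct.map_tmul, hit_one, LinearMap.mulLeft_apply]

theorem smashMul_counitDual_right (a b : H) (ξ : Module.Dual k H) :
    smashMul a ξ b 𝟙 = TensorProduct.map (LinearMap.mulLeft k a) (hit ξ) (Δ b) := by
  have key : ∀ ω, TensorProduct.map (LinearMap.mulLeft k a)
      (convolution ∘ₗ TensorProduct.map (hit ξ) (hit 𝟙)) ω =
      TensorProduct.map (LinearMap.mulLeft k a) (hit ξ)
        (Algebra.TensorProduct.map (AlgHom.id k H) (tensorCounit k H H) ω) := by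
    intro ω
    induction ω using tensor_induction₃ with
    | zero => simp
    | add x y hx hy => simp only [map_add, hx, hy]
    | tmul p q r => simp [convolution_hit_counitDual_right]
  have h2 : ∀ D : H ⊗[k] H, Algebra.TensorProduct.map (AlgHom.id k H) (tensorCounit k H H)
      (Algebra.TensorProduct.assoc k k k H H H (D ⊗ₜ 1)) = D := by
    intro D
    induction D using TensorProduct.induction_on with
    | zero => simp
    | add x y hx hy => simp only [map_add, TensorProduct.add_tmul, hx, hy]
    | tmul p q => simp
  rw [smashMul, key, map_mul, thd_tensorCounit_phiInv, mul_one, h2]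

theorem smash_counitDual_mul_smash (a b : H) (ν : Module.Dual k H) :
    smash a 𝟙 * smash b ν = smash (a * b) ν :=
  smashMul_counitDual_left a b ν

/-- The left action of `H` on the Heisenberg double. -/
theorem smash_counitDual_mul (a : H) (x : HeisenbergDouble k H) :
    smash a 𝟙 * x = (TensorProduct.map (LinearMap.mulLeft k a) LinearMap.id :
      H ⊗[k] Module.Dual k H →ₗ[k] H ⊗[k] Module.Dual k H) x := by
  induction x using smash_induction with
  | zero => rw [mul_zero]; exact (map_zero _).symm
  | add x y hx hy => rw [mul_add, hx, hy]; exact (map_add _ _ _).symm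
  | smash b ν => rw [smash_counitDual_mul_smash]; rfl

theorem unit_mul (x : HeisenbergDouble k H) : unit * x = x := by
  induction x using smash_induction with
  | zero => rw [mul_zero]
  | add x y hx hy => rw [mul_add, hx, hy]
  | smash b ν => rw [unit, smash_counitDual_mul_smash, one_mul]

theorem mul_unit (x : HeisenbergDouble k H) : x * unit = x := by
  induction x using smash_induction with
  | zero => rw [zero_mul]
  | add x y hx hy => rw [add_mul, hx, hy]
  | smash b ξ =>
    rw [unit, smash_mul_smash, smashMul_counitDual_right, map_one,
      Algebra.TensorProduct.one_def, TensorProduct.map_tmul, hit_one, LinearMap.mulLeft_apply,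
      mul_one]
    rfl

theorem smash_counitDual_mul_assoc (a : H) (x y : HeisenbergDouble k H) :
    smash a 𝟙 * x * y = smash a 𝟙 * (x * y) := by
  induction x using smash_induction with
  | zero => simp only [mul_zero, zero_mul]
  | add x x' hx hy => simp only [mul_add, add_mul, hx, hy]
  | smash b ξ =>
    induction y using smash_induction with
    | zero => simp only [mul_zero]
    | add x y hx hy => simp only [mul_add, hx, hy]
    | smash c ν =>
      rw [smash_counitDual_mul_smash, smash_counitDual_mul, smash_mul_smash, smash_mul_smash,
        smashMul, smashMul, ← LinearMap.comp_apply, ← TensorProduct.map_comp, LinearMap.id_comp]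
      congr 2
      ext z
      simp

/-- Every leg contains a factor `1 # ε`, so each leg has at most two nontrivial entries. -/
theorem leg₂₃_mul_leg₁₃_mul_leg₁₂ (x y z : HeisenbergDouble k H ⊗[k] HeisenbergDouble k H) :
    leg₂₃ x * leg₁₃ y * leg₁₂ z = leg₂₃ x * (leg₁₃ y * leg₁₂ z) := by
  induction x using TensorProduct.induction_on with
  | zero => simp only [map_zero, zero_mul]
  | add _ _ h h' => simp only [map_add, add_mul, h, h']
  | tmul x₁ x₂ =>
  induction y using TensorProduct.induction_on with
  | zero => simp only [map_zero, mul_zero, zero_mul]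
  | add _ _ h h' => simp only [map_add, add_mul, mul_add, h, h']
  | tmul y₁ y₂ =>
  induction z using TensorProduct.induction_on with
  | zero => simp only [map_zero, mul_zero]
  | add _ _ h h' => simp only [map_add, mul_add, h, h']
  | tmul z₁ z₂ =>
    simp [leg₂₃, leg₁₃, leg₁₂, unit_mul, mul_unit]

theorem leg₁₂_mul_leg₁₃_mul_leg₂₃ (x y z : HeisenbergDouble k H ⊗[k] HeisenbergDouble k H) :
    leg₁₂ x * leg₁₃ y * leg₂₃ z = leg₁₂ x * (leg₁₃ y * leg₂₃ z) := by
  induction x using TensorProduct.induction_on with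
  | zero => simp only [map_zero, zero_mul]
  | add _ _ h h' => simp only [map_add, add_mul, h, h']
  | tmul x₁ x₂ =>
  induction y using TensorProduct.induction_on with
  | zero => simp only [map_zero, mul_zero, zero_mul]
  | add _ _ h h' => simp only [map_add, add_mul, mul_add, h, h']
  | tmul y₁ y₂ =>
  induction z using TensorProduct.induction_on with
  | zero => simp only [map_zero, mul_zero]
  | add _ _ h h' => simp only [map_add, mul_add, h, h']
  | tmul z₁ z₂ =>
    simp [leg₂₃, leg₁₃, leg₁₂, unit_mul, mul_unit]

variable (k H) in
/-- `a ⊗ b ⊗ c ↦ a # ε ⊗ b # ε ⊗ c # ε`. -/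
def smashLeft₃ : H ⊗[k] (H ⊗[k] H) →ₗ[k]
    HeisenbergDouble k H ⊗[k] (HeisenbergDouble k H ⊗[k] HeisenbergDouble k H) :=
  TensorProduct.map (smashLeft 𝟙) (TensorProduct.map (smashLeft 𝟙) (smashLeft 𝟙))

theorem smashLeft₃_tmul (a b c : H) :
    smashLeft₃ k H (a ⊗ₜ (b ⊗ₜ c)) = smash a 𝟙 ⊗ₜ (smash b 𝟙 ⊗ₜ smash c 𝟙) := rfl

theorem smashLeft₃_mul_leg₁₂_mul_leg₂₃ (Z : H ⊗[k] (H ⊗[k] H))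
    (x y : HeisenbergDouble k H ⊗[k] HeisenbergDouble k H) :
    smashLeft₃ k H Z * leg₁₂ x * leg₂₃ y = smashLeft₃ k H Z * (leg₁₂ x * leg₂₃ y) := by
  induction Z using tensor_induction₃ with
  | zero => simp only [map_zero, zero_mul]
  | add _ _ h h' => simp only [map_add, add_mul, h, h']
  | tmul a b c =>
  induction x using TensorProduct.induction_on with
  | zero => simp only [map_zero, mul_zero, zero_mul]
  | add _ _ h h' => simp only [map_add, add_mul, mul_add, h, h']
  | tmul x₁ x₂ =>
  induction y using TensorProduct.induction_on with
  | zero => simp only [map_zero, mul_zero]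
  | add _ _ h h' => simp only [map_add, mul_add, h, h']
  | tmul y₁ y₂ =>
    simp [smashLeft₃_tmul, leg₂₃, leg₁₂, unit_mul, mul_unit, smash_counitDual_mul_assoc]

/-- Only the second leg has three nontrivial entries. It associates because its leftmost entry lies
in `H # ε`, whence the special form of the first argument. -/
theorem leg₂₃_mul_leg₁₂_mul_smashLeft₃ (x : H ⊗[k] HeisenbergDouble k H)
    (y : HeisenbergDouble k H ⊗[k] HeisenbergDouble k H) (Z : H ⊗[k] (H ⊗[k] H)) :
    leg₂₃ (TensorProduct.map (smashLeft 𝟙) LinearMap.id x) * leg₁₂ y * smashLeft₃ k H Z =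
      leg₂₃ (TensorProduct.map (smashLeft 𝟙) LinearMap.id x) *
        (leg₁₂ y * smashLeft₃ k H Z) := by
  induction x using TensorProduct.induction_on with
  | zero => simp only [map_zero, zero_mul]
  | add _ _ h h' => simp only [map_add, add_mul, h, h']
  | tmul x₁ x₂ =>
  induction y using TensorProduct.induction_on with
  | zero => simp only [map_zero, mul_zero, zero_mul]
  | add _ _ h h' => simp only [map_add, add_mul, mul_add, h, h']
  | tmul y₁ y₂ =>
  induction Z using tensor_induction₃ with
  | zero => simp only [map_zero, mul_zero]
  | add _ _ h h' => simp only [map_add, mul_add, h, h']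
  | tmul a b c =>
    have h : (smashLeft 𝟙 x₁ : HeisenbergDouble k H) = smash x₁ 𝟙 := rfl
    simp [smashLeft₃_tmul, leg₂₃, leg₁₂, unit_mul, mul_unit, smash_counitDual_mul_assoc, h]

end Product

/-! ### Evaluation of the functionals. -/

section Evaluation

variable {k H ι : Type*} [Field k] [Ring H] [Algebra k H] [QuasiBialgebra k H] [Fintype ι]
  (e : Module.Basis ι k H)

local notation "Δ" => QuasiBialgebra.comul (k := k) (H := H)
local notation "ε" => QuasiBialgebra.counit (k := k) (H := H)
local notation "Φi" => phiInv k H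
local notation "𝟙" => (counitDual : Module.Dual k H)

variable (k) in
/-- `a # ξ ↦ ξ(y) a`. -/
def evalAt (y : H) : HeisenbergDouble k H →ₗ[k] H :=
  (evalDual k y : H ⊗[k] Module.Dual k H →ₗ[k] H)

theorem evalAt_smash (y a : H) (ξ : Module.Dual k H) : evalAt k y (smash a ξ) = ξ y • a := rfl

theorem sum_smashLeft_evalAt (x : HeisenbergDouble k H) :
    ∑ i, smashLeft (e.coord i) (evalAt k (e i) x) = x :=
  sum_evalDual_tmul_coord e x

/-- `p ⊗ q ⊗ r ↦ ξ(q) ν(r) c p`. -/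
def pairing (c : H) (ξ ν : Module.Dual k H) : H ⊗[k] (H ⊗[k] H) →ₗ[k] H :=
  (TensorProduct.rid k H).toLinearMap ∘ₗ
    TensorProduct.map (LinearMap.mulLeft k c) (TensorProduct.dualDistrib k H H (ξ ⊗ₜ ν))

omit [QuasiBialgebra k H] in
theorem pairing_tmul (c p q r : H) (ξ ν : Module.Dual k H) :
    pairing c ξ ν (p ⊗ₜ (q ⊗ₜ r)) = (ξ q * ν r) • (c * p) := by
  simp [pairing]

theorem evalAt_smash_mul_smash (y a b : H) (ξ ν : Module.Dual k H) :
    evalAt k y (smash a ξ * smash b ν) =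
      pairing a ξ ν (comulLeft k H (b ⊗ₜ 1) * Φi * (1 ⊗ₜ Δ y)) := by
  have key : ∀ ω, evalDual k y (TensorProduct.map (LinearMap.mulLeft k a)
      (convolution ∘ₗ TensorProduct.map (hit ξ) (hit ν)) ω) =
      pairing a ξ ν (ω * (1 ⊗ₜ Δ y)) := by
    intro ω
    induction ω using tensor_induction₃ with
    | zero => simp
    | add x y hx hy => simp only [map_add, add_mul, hx, hy]
    | tmul p q r =>
      simp only [TensorProduct.map_tmul, evalDual_tmul, LinearMap.comp_apply, convolution_tmul,
        LinearMap.mulLeft_apply]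
      generalize Δ y = D
      induction D using TensorProduct.induction_on with
      | zero => simp
      | add x y hx hy => simp only [map_add, TensorProduct.tmul_add, mul_add, add_smul, hx, hy]
      | tmul d d' => simp [pairing_tmul, hit_apply]
  exact key _

/-- `d ⊗ d' ↦ ξ(d' y) c d`. -/
def evalComul (c y : H) (ξ : Module.Dual k H) : H ⊗[k] H →ₗ[k] H :=
  (TensorProduct.rid k H).toLinearMap ∘ₗ
    TensorProduct.map (LinearMap.mulLeft k c) (ξ ∘ₗ LinearMap.mulRight k y)

omit [QuasiBialgebra k H] in
theorem evalComul_tmul (c y d d' : H) (ξ : Module.Dual k H) :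
    evalComul c y ξ (d ⊗ₜ d') = ξ (d' * y) • (c * d) := by
  simp [evalComul]

omit [QuasiBialgebra k H] in
theorem evalComul_mul (c c' y : H) (ξ : Module.Dual k H) (D : H ⊗[k] H) :
    evalComul (c * c') y ξ D = c * evalComul c' y ξ D := by
  induction D using TensorProduct.induction_on with
  | zero => simp
  | add x y hx hy => simp only [map_add, mul_add, hx, hy]
  | tmul d d' => simp [evalComul_tmul, mul_assoc]

theorem evalAt_smash_mul_smash_counitDual (y a b : H) (ξ : Module.Dual k H) :
    evalAt k y (smash a ξ * smash b 𝟙) = evalComul a y ξ (Δ b) := by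
  rw [smash_mul_smash, smashMul_counitDual_right]
  generalize Δ b = D
  change evalDual k y _ = _
  induction D using TensorProduct.induction_on with
  | zero => simp
  | add x y hx hy => simp only [map_add, hx, hy]
  | tmul d d' => simp [evalComul_tmul, hit_apply]

variable (k) in
/-- Evaluation in the last two tensor factors. -/
def evalAt₂₃ (a b : H) :
    HeisenbergDouble k H ⊗[k] (HeisenbergDouble k H ⊗[k] HeisenbergDouble k H) →ₗ[k]
      HeisenbergDouble k H ⊗[k] (H ⊗[k] H) :=
  TensorProduct.map LinearMap.id (TensorProduct.map (evalAt k a) (evalAt k b))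

theorem evalAt₂₃_tmul (a b : H) (x y z : HeisenbergDouble k H) :
    evalAt₂₃ k a b (x ⊗ₜ (y ⊗ₜ z)) = x ⊗ₜ (evalAt k a y ⊗ₜ evalAt k b z) := rfl

include e in
-- The first leg is left unevaluated: in both equations its entries all have the form `c # ε`.
theorem eq_of_evalAt₂₃
    {z w : HeisenbergDouble k H ⊗[k] (HeisenbergDouble k H ⊗[k] HeisenbergDouble k H)}
    (h : ∀ a b, evalAt₂₃ k a b z = evalAt₂₃ k a b w) : z = w := by
  have key : ∀ z : HeisenbergDouble k H ⊗[k] (HeisenbergDouble k H ⊗[k] HeisenbergDouble k H),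
      z = ∑ i, ∑ j, TensorProduct.map LinearMap.id
        (TensorProduct.map (smashLeft (e.coord i)) (smashLeft (e.coord j)))
        (evalAt₂₃ k (e i) (e j) z) := by
    intro z
    induction z using tensor_induction₃ with
    | zero => simp
    | add x y hx hy =>
      simp only [map_add, Finset.sum_add_distrib]
      rw [← hx, ← hy]
    | tmul x y z =>
      simp only [evalAt₂₃_tmul, TensorProduct.map_tmul, LinearMap.id_apply,
        ← TensorProduct.tmul_sum, ← TensorProduct.sum_tmul, sum_smashLeft_evalAt]
  rw [key z, key w]
  simp only [h]

omit [QuasiBialgebra k H] in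
theorem sum_coord_smul_apply {M : Type*} [AddCommGroup M] [Module k M] (f : H →ₗ[k] M) (y : H) :
    ∑ i, e.coord i y • f (e i) = f y := by
  simp only [← map_smul, ← map_sum, sum_coord_smul]

omit [QuasiBialgebra k H] in
theorem sum_sum_coord_smul_apply {M : Type*} [AddCommGroup M] [Module k M]
    (f : H →ₗ[k] H →ₗ[k] M) (y z : H) :
    ∑ i, ∑ j, (e.coord i y * e.coord j z) • f (e i) (e j) = f y z := by
  simp only [mul_smul, ← Finset.smul_sum, sum_coord_smul_apply]
  exact sum_coord_smul_apply e (f.flip z) y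

end Evaluation

end HeisenbergDouble
end

noncomputable section

set_option maxSynthPendingDepth 3

namespace HeisenbergDouble

open QuasiBialgebra QuasiHopfAlgebra QuasiHopf

/-! ### The quasi-Hopf equation. -/

section QuasiHopfEquation

variable {k H ι : Type*} [Field k] [Ring H] [Algebra k H] [QuasiBialgebra k H] [Fintype ι]
  (e : Module.Basis ι k H)

local notation "Δ" => QuasiBialgebra.comul (k := k) (H := H)
local notation "ε" => QuasiBialgebra.counit (k := k) (H := H)
local notation "Φi" => phiInv k H
local notation "𝟙" => (counitDual : Module.Dual k H)

variable (k) in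
/-- `p ⊗ q ⊗ r ↦ r a # ε ⊗ q ⊗ p`. -/
def reverseMap (a : H) : H ⊗[k] (H ⊗[k] H) →ₗ[k] HeisenbergDouble k H ⊗[k] (H ⊗[k] H) :=
  TensorProduct.map (smashLeft 𝟙 ∘ₗ LinearMap.mulRight k a) LinearMap.id ∘ₗ
    (TensorProduct.assoc k H H H).toLinearMap ∘ₗ
    (TensorProduct.comm k H (H ⊗[k] H)).toLinearMap ∘ₗ
    TensorProduct.map LinearMap.id (TensorProduct.comm k H H).toLinearMap

theorem reverseMap_tmul (a p q r : H) :
    reverseMap k a (p ⊗ₜ (q ⊗ₜ r)) = smash (r * a) 𝟙 ⊗ₜ (q ⊗ₜ p) := rfl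

/-- `Φ⁻¹` enters from the product `(1 # eⁱ)(1 # eʲ)` in the third leg. The dual bases carry its last
two components to the second and first legs, which produces the reversal `321`. -/
theorem evalAt₂₃_leg₂₃_mul_leg₁₃_mul_leg₁₂_wBar (a b : H) :
    evalAt₂₃ k a b (leg₂₃ (wBar e) * leg₁₃ (wBar e) * leg₁₂ (wBar e)) =
      reverseMap k a (Φi * (1 ⊗ₜ Δ b)) := by
  have h1 : ∀ i j l, evalAt₂₃ k a b
      (leg₂₃ (smash (e i) 𝟙 ⊗ₜ smash 1 (e.coord i)) *
        leg₁₃ (smash (e j) 𝟙 ⊗ₜ smash 1 (e.coord j)) *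
        leg₁₂ (smash (e l) 𝟙 ⊗ₜ smash 1 (e.coord l))) =
      e.coord l a • (smash (e j * e l) 𝟙 ⊗ₜ
        (e i ⊗ₜ pairing 1 (e.coord i) (e.coord j) (Φi * (1 ⊗ₜ Δ b)))) := by
    intro i j l
    have h2 : comulLeft k H ((1 : H) ⊗ₜ[k] (1 : H)) = 1 := map_one _
    simp [leg₂₃, leg₁₃, leg₁₂, unit_mul, mul_unit, smash_counitDual_mul_smash, evalAt₂₃_tmul,
      evalAt_smash, evalAt_smash_mul_smash, h2]
    rw [← TensorProduct.smul_tmul', TensorProduct.tmul_smul]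
  have h3 : ∀ (Q : H ⊗[k] H) j, ∑ l, e.coord l a • (smash (e j * e l) 𝟙 ⊗ₜ[k] Q) =
      smash (e j * a) 𝟙 ⊗ₜ[k] Q := fun Q j => sum_coord_smul_apply e
    ((TensorProduct.mk k (HeisenbergDouble k H) _).flip Q ∘ₗ smashLeft 𝟙 ∘ₗ
      LinearMap.mulLeft k (e j)) a
  have h4 : ∀ ω, ∑ i, ∑ j, smash (e j * a) 𝟙 ⊗ₜ[k]
      (e i ⊗ₜ[k] pairing 1 (e.coord i) (e.coord j) ω) = reverseMap k a ω := by
    intro ω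
    induction ω using tensor_induction₃ with
    | zero => simp
    | add x y hx hy =>
      simp only [map_add, TensorProduct.tmul_add, Finset.sum_add_distrib, hx, hy]
    | tmul p q r =>
      simp only [pairing_tmul, one_mul, TensorProduct.tmul_smul]
      exact sum_sum_coord_smul_apply e (LinearMap.flip ((TensorProduct.mk k _ _).compl₁₂
        (smashLeft 𝟙 ∘ₗ LinearMap.mulRight k a) ((TensorProduct.mk k H H).flip p))) q r
  rw [← h4]
  simp only [← h3, ← h1, ← map_sum, ← Finset.mul_sum, ← Finset.sum_mul]
  rfl

theorem phiBarInv₃₂₁_eq : (phiBarInv₃₂₁ : HeisenbergDouble k H ⊗[k] _) =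
    smashLeft₃ k H (TensorProduct.assoc k H H H (TensorProduct.comm k H (H ⊗[k] H)
      (TensorProduct.map LinearMap.id (TensorProduct.comm k H H).toLinearMap Φi))) := rfl

theorem evalAt₂₃_phiBarInv₃₂₁_mul_leg₁₂_mul_leg₂₃_wBar (a b : H) :
    evalAt₂₃ k a b (phiBarInv₃₂₁ * leg₁₂ (wBar e) * leg₂₃ (wBar e)) =
      reverseMap k a (Φi * (1 ⊗ₜ Δ b)) := by
  rw [phiBarInv₃₂₁_eq]
  generalize Φi = Z
  induction Z using tensor_induction₃ with
  | zero => simp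
  | add x y hx hy => simp only [map_add, add_mul, hx, hy]
  | tmul p q r =>
    have h1 : ∀ i j, evalAt₂₃ k a b (smashLeft₃ k H (r ⊗ₜ (q ⊗ₜ p)) *
        leg₁₂ (smash (e i) 𝟙 ⊗ₜ smash 1 (e.coord i)) *
        leg₂₃ (smash (e j) 𝟙 ⊗ₜ smash 1 (e.coord j))) =
        e.coord j b • (smash (r * e i) 𝟙 ⊗ₜ (evalComul q a (e.coord i) (Δ (e j)) ⊗ₜ p)) := by
      intro i j
      simp [leg₂₃, leg₁₂, mul_unit, smash_counitDual_mul_smash, evalAt₂₃_tmul, evalAt_smash,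
        smashLeft₃_tmul, evalAt_smash_mul_smash_counitDual]
    have h2 : ∀ i, ∑ j, e.coord j b • (smash (r * e i) 𝟙 ⊗ₜ[k]
        (evalComul q a (e.coord i) (Δ (e j)) ⊗ₜ[k] p)) = smash (r * e i) 𝟙 ⊗ₜ
        (evalComul q a (e.coord i) (Δ b) ⊗ₜ p) := fun i => sum_coord_smul_apply e
      (TensorProduct.mk k (HeisenbergDouble k H) _ (smash (r * e i) 𝟙) ∘ₗ
        (TensorProduct.mk k H H).flip p ∘ₗ evalComul q a (e.coord i) ∘ₗ AlgHom.toLinearMap Δ) b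
    have h3 : ∀ D, ∑ i, smash (r * e i) 𝟙 ⊗ₜ[k] (evalComul q a (e.coord i) D ⊗ₜ[k] p) =
        reverseMap k a ((p ⊗ₜ (q ⊗ₜ r)) * (1 ⊗ₜ D)) := by
      intro D
      induction D using TensorProduct.induction_on with
      | zero => simp
      | add x y hx hy => simp only [map_add, TensorProduct.tmul_add, TensorProduct.add_tmul,
          mul_add, Finset.sum_add_distrib, hx, hy]
      | tmul d d' =>
        have h4 := sum_coord_smul_apply e ((TensorProduct.mk k (HeisenbergDouble k H) _).flip
          ((q * d) ⊗ₜ[k] p) ∘ₗ smashLeft 𝟙 ∘ₗ LinearMap.mulLeft k r) (d' * a)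
        simp only [evalComul_tmul, TensorProduct.tmul_smul, ← TensorProduct.smul_tmul']
        rw [Algebra.TensorProduct.tmul_mul_tmul, Algebra.TensorProduct.tmul_mul_tmul, mul_one,
          reverseMap_tmul, mul_assoc]
        exact h4
    rw [← h3]
    simp only [← h2, ← h1, ← map_sum, ← Finset.mul_sum, ← Finset.sum_mul]
    rfl

end QuasiHopfEquation

/-! ### The quasi-pentagon equation. -/

section QuasiPentagon

variable {k H ι : Type*} [Field k] [Ring H] [Algebra k H] [QuasiHopfAlgebra k H] [Fintype ι]
  (e : Module.Basis ι k H)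

local notation "Δ" => QuasiBialgebra.comul (k := k) (H := H)
local notation "Φ" => phi k H
local notation "Φi" => phiInv k H
local notation "S" => QuasiHopfAlgebra.antipode (k := k) (H := H)
local notation "𝟙" => (counitDual : Module.Dual k H)
local notation "V" => vElem k H
local notation "ι₂" => (Algebra.TensorProduct.includeRight : H →ₐ[k] H ⊗[k] H)

/-- `c ⊗ d ↦ ∑ᵢ S(d eᵢ) # ε ⊗ c # eⁱ`. -/
def canonicalMap : H ⊗[k] H →ₗ[k] HeisenbergDouble k H ⊗[k] HeisenbergDouble k H :=
  ∑ i, TensorProduct.map (smashLeft 𝟙 ∘ₗ S ∘ₗ LinearMap.mulRight k (e i))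
    (smashLeft (e.coord i)) ∘ₗ (TensorProduct.comm k H H).toLinearMap

theorem canonicalMap_tmul (c d : H) : canonicalMap e (c ⊗ₜ d) =
    ∑ i, smash (S (d * e i)) 𝟙 ⊗ₜ smash c (e.coord i) := by
  simp only [canonicalMap, LinearMap.sum_apply]
  rfl

theorem wHat_eq_canonicalMap : wHat e = canonicalMap e (vTilde k H) := by
  simp only [canonicalMap, LinearMap.sum_apply]
  rfl

theorem canonicalMap_eq_map_smashLeft (P : H ⊗[k] H) : canonicalMap e P =
    TensorProduct.map (smashLeft 𝟙) LinearMap.id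
      (∑ i, TensorProduct.map (S ∘ₗ LinearMap.mulRight k (e i)) (smashLeft (e.coord i))
        (TensorProduct.comm k H H P)) := by
  simp only [canonicalMap, LinearMap.sum_apply, map_sum, ← LinearMap.comp_apply,
    ← TensorProduct.map_comp, LinearMap.id_comp]
  rfl

variable (k) in
/-- `x ⊗ y ⊗ t ⊗ t' ↦ S(y t' a) # ε ⊗ t ⊗ x`. -/
def slotMap (a : H) :
    H ⊗[k] (H ⊗[k] (H ⊗[k] H)) →ₗ[k] HeisenbergDouble k H ⊗[k] (H ⊗[k] H) :=
  TensorProduct.map (smashLeft 𝟙 ∘ₗ S ∘ₗ LinearMap.mulRight k a ∘ₗ LinearMap.mul' k H)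
      (TensorProduct.comm k H H).toLinearMap ∘ₗ
    (TensorProduct.comm k (H ⊗[k] H) (H ⊗[k] H)).toLinearMap ∘ₗ
    (TensorProduct.assoc k H H (H ⊗[k] H)).symm.toLinearMap ∘ₗ
    TensorProduct.map LinearMap.id (TensorProduct.leftComm k H H H).toLinearMap

theorem slotMap_tmul (a x y t t' : H) :
    slotMap k a (x ⊗ₜ (y ⊗ₜ (t ⊗ₜ t'))) = smash (S (y * t' * a)) 𝟙 ⊗ₜ (t ⊗ₜ x) := rfl

variable (k) in
/-- `h ↦ (u ⊗ v ⊗ w ↦ u ⊗ h v ⊗ w)`. -/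
def mulMid : H →ₗ[k] HeisenbergDouble k H ⊗[k] (H ⊗[k] H) →ₗ[k]
    HeisenbergDouble k H ⊗[k] (H ⊗[k] H) :=
  LinearMap.lTensorHom (HeisenbergDouble k H) ∘ₗ LinearMap.rTensorHom H ∘ₗ LinearMap.mul k H

theorem mulMid_tmul (h v w : H) (u : HeisenbergDouble k H) :
    mulMid k h (u ⊗ₜ (v ⊗ₜ w)) = u ⊗ₜ ((h * v) ⊗ₜ w) := rfl

theorem mulMid_mul (h h' : H) (z : HeisenbergDouble k H ⊗[k] (H ⊗[k] H)) :
    mulMid k (h * h') z = mulMid k h (mulMid k h' z) := by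
  induction z using tensor_induction₃ with
  | zero => simp
  | add x y hx hy => simp only [map_add, hx, hy]
  | tmul u v w => simp [mulMid_tmul, mul_assoc]

theorem slotMap_mul_right (a x y d : H) (T : H ⊗[k] H) :
    slotMap k a (x ⊗ₜ ((y * d) ⊗ₜ T)) = slotMap k a (x ⊗ₜ (y ⊗ₜ ((1 ⊗ₜ d) * T))) := by
  induction T using TensorProduct.induction_on with
  | zero => simp
  | add x y hx hy => simp only [map_add, TensorProduct.tmul_add, mul_add, hx, hy]
  | tmul t t' => simp [slotMap_tmul, mul_assoc]

theorem slotMap_tmul_one_mul (a x y c : H) (T : H ⊗[k] H) :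
    slotMap k a (x ⊗ₜ (y ⊗ₜ ((c ⊗ₜ 1) * T))) = mulMid k c (slotMap k a (x ⊗ₜ (y ⊗ₜ T))) := by
  induction T using TensorProduct.induction_on with
  | zero => simp
  | add x y hx hy => simp only [map_add, TensorProduct.tmul_add, mul_add, hx, hy]
  | tmul t t' => simp [slotMap_tmul, mulMid_tmul]

/-- `x ⊗ y ⊗ z ↦ S(y T² a) # ε ⊗ T¹ ⊗ x`, where `T = P Δ(S(z))`. -/
def twistedSlotMap (P : H ⊗[k] H) (a : H) :
    H ⊗[k] (H ⊗[k] H) →ₗ[k] HeisenbergDouble k H ⊗[k] (H ⊗[k] H) :=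
  slotMap k a ∘ₗ TensorProduct.map LinearMap.id (TensorProduct.map LinearMap.id
    (LinearMap.mulLeft k P ∘ₗ AlgHom.toLinearMap Δ ∘ₗ S))

theorem twistedSlotMap_tmul (P : H ⊗[k] H) (a x y z : H) :
    twistedSlotMap P a (x ⊗ₜ (y ⊗ₜ z)) = slotMap k a (x ⊗ₜ (y ⊗ₜ (P * Δ (S z)))) := rfl

theorem twistedSlotMap_add (P P' : H ⊗[k] H) (a : H) :
    twistedSlotMap (P + P') a = twistedSlotMap P a + twistedSlotMap P' a := by
  ext x y z
  simp [twistedSlotMap_tmul, add_mul, TensorProduct.tmul_add]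

theorem twistedSlotMap_zero (a : H) : twistedSlotMap (0 : H ⊗[k] H) a = 0 := by
  ext x y z
  simp [twistedSlotMap_tmul]

/-- Covariance of `Ṽ`: the two halves of `Δ(b)` enclose it and become left multiplication by `S(b)`
in the second leg. -/
theorem twistedSlotMap_vElem_mul_comul (a b : H) (w : H ⊗[k] (H ⊗[k] H)) :
    twistedSlotMap V a (w * (1 ⊗ₜ Δ b)) = mulMid k (S b) (twistedSlotMap V a w) := by
  induction w using tensor_induction₃ with
  | zero => simp
  | add x y hx hy => simp only [map_add, add_mul, hx, hy]
  | tmul x y z =>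
    have h1 : ∀ D, twistedSlotMap V a ((x ⊗ₜ (y ⊗ₜ z)) * (1 ⊗ₜ D)) =
        slotMap k a (x ⊗ₜ (y ⊗ₜ (sandwich ι₂ Δ V D * Δ (S z)))) := by
      intro D
      induction D using TensorProduct.induction_on with
      | zero => simp
      | add x y hx hy =>
        simp only [map_add, TensorProduct.tmul_add, mul_add, add_mul, hx, hy]
      | tmul d d' =>
        rw [Algebra.TensorProduct.tmul_mul_tmul, Algebra.TensorProduct.tmul_mul_tmul,
          twistedSlotMap_tmul, slotMap_mul_right, antipode_mul, map_mul Δ, sandwich_tmul,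
          mul_one, mul_assoc, mul_assoc]
        rfl
    rw [h1, isCovariant_vElem, mul_assoc, twistedSlotMap_tmul]
    exact slotMap_tmul_one_mul a x y (S b) _

/-- Independent `P`, `Q`, `R` make the claim trilinear, so pure tensors suffice. For `P = Q = R = Ṽ`
the argument is `vProd k H` times `1 ⊗ Δ(b)`. -/
theorem evalAt₂₃_canonicalMap_left (P Q R : H ⊗[k] H) (a b : H) :
    evalAt₂₃ k a b (leg₁₂ (canonicalMap e P) * leg₁₃ (canonicalMap e Q) *
        leg₂₃ (canonicalMap e R)) =
      twistedSlotMap P a (padRight₂ k H Q * comulLeft k H R * Φi * (1 ⊗ₜ Δ b)) := by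
  induction P using TensorProduct.induction_on with
  | zero => simp [twistedSlotMap_zero]
  | add _ _ h h' => simp only [map_add, add_mul, h, h', twistedSlotMap_add, LinearMap.add_apply]
  | tmul p p' =>
  induction Q using TensorProduct.induction_on with
  | zero => simp
  | add _ _ h h' => simp only [map_add, add_mul, mul_add, h, h']
  | tmul q q' =>
  induction R using TensorProduct.induction_on with
  | zero => simp
  | add _ _ h h' => simp only [map_add, add_mul, mul_add, h, h']
  | tmul r r' =>
    have h0 : padRight₂ k H (q ⊗ₜ q') * comulLeft k H (r ⊗ₜ r') * Φi * (1 ⊗ₜ Δ b) =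
        (q ⊗ₜ (q' ⊗ₜ r')) * (comulLeft k H (r ⊗ₜ 1) * Φi * (1 ⊗ₜ Δ b)) := by
      have h1 : r ⊗ₜ[k] r' = (1 ⊗ₜ r') * (r ⊗ₜ 1) := by simp
      have h2 : q ⊗ₜ[k] (q' ⊗ₜ[k] r') = padRight₂ k H (q ⊗ₜ q') * (1 ⊗ₜ (1 ⊗ₜ r')) := by simp
      rw [h1, h2, map_mul (comulLeft k H), comulLeft_one_tmul]
      simp only [mul_assoc]
    rw [h0]
    have h1 : ∀ i j l, evalAt₂₃ k a b
        (leg₁₂ (smash (S (p' * e i)) 𝟙 ⊗ₜ smash p (e.coord i)) *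
          leg₁₃ (smash (S (q' * e j)) 𝟙 ⊗ₜ smash q (e.coord j)) *
          leg₂₃ (smash (S (r' * e l)) 𝟙 ⊗ₜ smash r (e.coord l))) =
        smash (S (p' * e i) * S (q' * e j)) 𝟙 ⊗ₜ
          (evalComul p a (e.coord i) (Δ (S (r' * e l))) ⊗ₜ
            pairing q (e.coord j) (e.coord l) (comulLeft k H (r ⊗ₜ 1) * Φi * (1 ⊗ₜ Δ b))) := by
      intro i j l
      simp only [leg₂₃, leg₁₃, leg₁₂, TensorProduct.map_tmul, LinearMap.id_apply,
        TensorProduct.mk_apply, LinearMap.flip_apply, Algebra.TensorProduct.tmul_mul_tmul,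
        unit_mul, mul_unit, smash_counitDual_mul_smash, evalAt₂₃_tmul]
      rw [evalAt_smash_mul_smash_counitDual, evalAt_smash_mul_smash]
    have h2 : ∀ ω, ∑ i, ∑ j, ∑ l, smash (S (p' * e i) * S (q' * e j)) 𝟙 ⊗ₜ[k]
          (evalComul p a (e.coord i) (Δ (S (r' * e l))) ⊗ₜ[k]
            pairing q (e.coord j) (e.coord l) ω) =
        twistedSlotMap (p ⊗ₜ p') a ((q ⊗ₜ (q' ⊗ₜ r')) * ω) := by
      intro ω
      induction ω using tensor_induction₃ with
      | zero => simp
      | add x y hx hy =>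
        simp only [map_add, mul_add, TensorProduct.tmul_add, Finset.sum_add_distrib, hx, hy]
      | tmul x y z =>
        have h3 : ∀ i, ∑ j, ∑ l, smash (S (p' * e i) * S (q' * e j)) 𝟙 ⊗ₜ[k]
            (evalComul p a (e.coord i) (Δ (S (r' * e l))) ⊗ₜ[k]
              ((e.coord j y * e.coord l z) • (q * x))) =
            smash (S (p' * e i) * S (q' * y)) 𝟙 ⊗ₜ[k]
              (evalComul p a (e.coord i) (Δ (S (r' * z))) ⊗ₜ[k] (q * x)) := by
          intro i
          simp only [TensorProduct.tmul_smul]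
          exact sum_sum_coord_smul_apply e ((TensorProduct.mk k (HeisenbergDouble k H) _).compl₁₂
            (smashLeft 𝟙 ∘ₗ LinearMap.mulLeft k (S (p' * e i)) ∘ₗ S ∘ₗ LinearMap.mulLeft k q')
            ((TensorProduct.mk k H H).flip (q * x) ∘ₗ evalComul p a (e.coord i) ∘ₗ
              AlgHom.toLinearMap Δ ∘ₗ S ∘ₗ LinearMap.mulLeft k r')) y z
        simp only [pairing_tmul, h3]
        rw [Algebra.TensorProduct.tmul_mul_tmul, Algebra.TensorProduct.tmul_mul_tmul,
          twistedSlotMap_tmul]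
        generalize Δ (S (r' * z)) = D
        induction D using TensorProduct.induction_on with
        | zero => simp
        | add x y hx hy =>
          simp only [map_add, mul_add, TensorProduct.tmul_add, TensorProduct.add_tmul,
            Finset.sum_add_distrib, hx, hy]
        | tmul d d' =>
          have h4 := sum_coord_smul_apply e ((TensorProduct.mk k (HeisenbergDouble k H) _).flip
            ((p * d) ⊗ₜ[k] (q * x)) ∘ₗ smashLeft 𝟙 ∘ₗ LinearMap.mulRight k (S (q' * y)) ∘ₗ
              S ∘ₗ LinearMap.mulLeft k p') (d' * a)
          simp only [evalComul_tmul, TensorProduct.tmul_smul, ← TensorProduct.smul_tmul']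
          have h5 : S (q' * y * (p' * d') * a) = S (p' * (d' * a)) * S (q' * y) := by
            rw [← antipode_mul]
            simp only [mul_assoc]
          rw [Algebra.TensorProduct.tmul_mul_tmul, slotMap_tmul, h5]
          exact h4
    rw [← h2]
    simp only [canonicalMap_tmul, ← h1, ← map_sum, ← Finset.mul_sum, ← Finset.sum_mul]

/-- `u ⊗ u' ↦ S(x T² a) # ε ⊗ S(u' b) T¹ ⊗ u`. -/
def contractSlotMap (a b x : H) (T : H ⊗[k] H) :
    H ⊗[k] H →ₗ[k] HeisenbergDouble k H ⊗[k] (H ⊗[k] H) :=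
  TensorProduct.lift ((mulMid k ∘ₗ S ∘ₗ LinearMap.mulRight k b).flip ∘ₗ slotMap k a ∘ₗ
    (TensorProduct.mk k H _).flip (x ⊗ₜ T))

theorem contractSlotMap_tmul (a b x : H) (T : H ⊗[k] H) (u u' : H) :
    contractSlotMap a b x T (u ⊗ₜ u') =
      mulMid k (S (u' * b)) (slotMap k a (u ⊗ₜ (x ⊗ₜ T))) := rfl

theorem contractSlotMap_add (a b x : H) (T T' : H ⊗[k] H) :
    contractSlotMap a b x (T + T') = contractSlotMap a b x T + contractSlotMap a b x T' := by
  ext u u'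
  simp [contractSlotMap_tmul, TensorProduct.tmul_add]

theorem contractSlotMap_zero (a b x : H) : contractSlotMap a b x (0 : H ⊗[k] H) = 0 := by
  ext u u'
  simp [contractSlotMap_tmul]

theorem evalAt₂₃_canonicalMap_right (P Q : H ⊗[k] H) (a b x y z : H) :
    evalAt₂₃ k a b (leg₂₃ (canonicalMap e P) * leg₁₂ (canonicalMap e Q) *
        smashLeft₃ k H (S x ⊗ₜ (S y ⊗ₜ S z))) =
      contractSlotMap a b x (Q * Δ (S y)) (P * Δ (S z)) := by
  induction P using TensorProduct.induction_on with
  | zero => simp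
  | add _ _ h h' => simp only [map_add, add_mul, h, h']
  | tmul p p' =>
  induction Q using TensorProduct.induction_on with
  | zero => simp [contractSlotMap_zero]
  | add _ _ h h' =>
    simp only [map_add, add_mul, mul_add, h, h', contractSlotMap_add, LinearMap.add_apply]
  | tmul q q' =>
    have h1 : ∀ i j, evalAt₂₃ k a b
        (leg₂₃ (smash (S (p' * e i)) 𝟙 ⊗ₜ smash p (e.coord i)) *
          leg₁₂ (smash (S (q' * e j)) 𝟙 ⊗ₜ smash q (e.coord j)) *
          smashLeft₃ k H (S x ⊗ₜ (S y ⊗ₜ S z))) =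
        smash (S (q' * e j) * S x) 𝟙 ⊗ₜ
          ((S (p' * e i) * evalComul q a (e.coord j) (Δ (S y))) ⊗ₜ
            evalComul p b (e.coord i) (Δ (S z))) := by
      intro i j
      simp only [leg₂₃, leg₁₂, smashLeft₃_tmul, TensorProduct.map_tmul, LinearMap.id_apply,
        TensorProduct.mk_apply, LinearMap.flip_apply, Algebra.TensorProduct.tmul_mul_tmul,
        unit_mul, mul_unit, smash_counitDual_mul_smash, evalAt₂₃_tmul,
        evalAt_smash_mul_smash_counitDual, evalComul_mul]
    have h2 : ∀ D D', ∑ i, ∑ j, smash (S (q' * e j) * S x) 𝟙 ⊗ₜ[k]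
          ((S (p' * e i) * evalComul q a (e.coord j) D') ⊗ₜ[k]
            evalComul p b (e.coord i) D) =
        contractSlotMap a b x ((q ⊗ₜ q') * D') ((p ⊗ₜ p') * D) := by
      intro D D'
      induction D using TensorProduct.induction_on with
      | zero => simp
      | add _ _ h h' =>
        simp only [map_add, mul_add, TensorProduct.tmul_add, Finset.sum_add_distrib, h, h']
      | tmul d c =>
      induction D' using TensorProduct.induction_on with
      | zero => simp [contractSlotMap_zero]
      | add _ _ h h' =>
        simp only [map_add, mul_add, TensorProduct.tmul_add, TensorProduct.add_tmul,
          Finset.sum_add_distrib, h, h', contractSlotMap_add, LinearMap.add_apply]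
      | tmul d' c' =>
        have h3 := sum_sum_coord_smul_apply e (LinearMap.flip
          ((TensorProduct.mk k (HeisenbergDouble k H) _).compl₁₂
            (smashLeft 𝟙 ∘ₗ LinearMap.mulRight k (S x) ∘ₗ S ∘ₗ LinearMap.mulLeft k q')
            ((TensorProduct.mk k H H).flip (p * d) ∘ₗ LinearMap.mulRight k (q * d') ∘ₗ
              S ∘ₗ LinearMap.mulLeft k p'))) (c * b) (c' * a)
        have h4 : S (x * (q' * c') * a) = S (q' * (c' * a)) * S x := by
          rw [← antipode_mul]
          simp only [mul_assoc]
        rw [Algebra.TensorProduct.tmul_mul_tmul, Algebra.TensorProduct.tmul_mul_tmul,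
          contractSlotMap_tmul, slotMap_tmul, mulMid_tmul, h4, mul_assoc p' c]
        refine Eq.trans ?_ h3
        simp only [evalComul_tmul, mul_smul_comm, TensorProduct.tmul_smul,
          ← TensorProduct.smul_tmul', smul_smul]
        rfl
    rw [← h2]
    simp only [canonicalMap_tmul, ← h1, ← map_sum, ← Finset.mul_sum, ← Finset.sum_mul]

/-- Matches the right side of the cocycle identity, with `U = Ṽ Δ(S(X³))`, against the evaluated
right side of the pentagon; covariance takes the coproduct of the second component of `U` out of the
twisted slot. -/
theorem mulMid_twistedSlotMap_comulRight (a b x y : H) (U : H ⊗[k] H) :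
    mulMid k (S b) (twistedSlotMap V a ((1 ⊗ₜ (x ⊗ₜ y)) * comulRight k H U)) =
      contractSlotMap a b x (V * Δ (S y)) U := by
  induction U using TensorProduct.induction_on with
  | zero => simp
  | add _ _ h h' => simp only [map_add, mul_add, h, h']
  | tmul u u' =>
    have h1 : ((1 : H) ⊗ₜ[k] (x ⊗ₜ[k] y)) * comulRight k H (u ⊗ₜ u') =
        (u ⊗ₜ (x ⊗ₜ y)) * (1 ⊗ₜ Δ u') := by simp
    rw [h1, twistedSlotMap_vElem_mul_comul, contractSlotMap_tmul, antipode_mul, mulMid_mul,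
      twistedSlotMap_tmul]

theorem phiBarS_eq : (phiBarS : HeisenbergDouble k H ⊗[k] _) =
    smashLeft₃ k H (TensorProduct.map S (TensorProduct.map S S) Φ) := by
  rw [smashLeft₃, ← LinearMap.comp_apply, ← TensorProduct.map_comp, ← TensorProduct.map_comp]
  rfl

theorem quasiPentagon_canonicalMap :
    leg₁₂ (canonicalMap e V) * leg₁₃ (canonicalMap e V) * leg₂₃ (canonicalMap e V) =
      leg₂₃ (canonicalMap e V) * leg₁₂ (canonicalMap e V) * phiBarS := by
  refine eq_of_evalAt₂₃ e fun a b => ?_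
  rw [evalAt₂₃_canonicalMap_left, twistedSlotMap_vElem_mul_comul]
  change mulMid k (S b) (twistedSlotMap V a (vProd k H)) = _
  -- After the cocycle identity both sides are linear in one explicit copy of `Φ`. It can be
  -- generalized and compared on pure tensors, since `Ṽ` stays packed in `vElem`.
  rw [vProd_eq_outerSandwich, phiBarS_eq]
  generalize Φ = Z
  induction Z using tensor_induction₃ with
  | zero => simp
  | add x y hx hy => simp only [map_add, mul_add, hx, hy]
  | tmul x y z =>
    rw [TensorProduct.map_tmul, TensorProduct.map_tmul, evalAt₂₃_canonicalMap_right,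
      outerSandwich_tmul, comulTwice_apply, ← map_mul, mulMid_twistedSlotMap_comulRight]

end QuasiPentagon

end HeisenbergDouble

end

/-- The quasi-Hopf equation for `W̄` and the quasi-pentagon equation for `Ŵ`. Since the product is
nonassociative, the statement includes that the bracketing of each triple product is irrelevant; it
also includes that the inverse `S⁻¹` used in `Ŵ` exists. -/
theorem theorem4p5 {k H ι : Type*} [Field k] [Ring H] [Algebra k H] [QuasiHopfAlgebra k H]
    [Fintype ι] (e : Module.Basis ι k H) :
    Function.Bijective (QuasiHopfAlgebra.antipode : H →ₗ[k] H) ∧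
    (open HeisenbergDouble in
      ((leg₂₃ (wBar e) * leg₁₃ (wBar e)) * leg₁₂ (wBar e) =
          (phiBarInv₃₂₁ * leg₁₂ (wBar e)) * leg₂₃ (wBar e) ∧
        (leg₂₃ (wBar e) * leg₁₃ (wBar e)) * leg₁₂ (wBar e) =
          leg₂₃ (wBar e) * (leg₁₃ (wBar e) * leg₁₂ (wBar e)) ∧
        (phiBarInv₃₂₁ * leg₁₂ (wBar e)) * leg₂₃ (wBar e) =
          phiBarInv₃₂₁ * (leg₁₂ (wBar e) * leg₂₃ (wBar e))) ∧
      ((leg₁₂ (wHat e) * leg₁₃ (wHat e)) * leg₂₃ (wHat e) =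
          (leg₂₃ (wHat e) * leg₁₂ (wHat e)) * phiBarS ∧
        (leg₁₂ (wHat e) * leg₁₃ (wHat e)) * leg₂₃ (wHat e) =
          leg₁₂ (wHat e) * (leg₁₃ (wHat e) * leg₂₃ (wHat e)) ∧
        (leg₂₃ (wHat e) * leg₁₂ (wHat e)) * phiBarS =
          leg₂₃ (wHat e) * (leg₁₂ (wHat e) * phiBarS))) := by
  have hS := QuasiHopf.antipode_bijective (k := k) e
  refine ⟨hS, ⟨?_, ?_, ?_⟩, ?_, ?_, ?_⟩
  · refine HeisenbergDouble.eq_of_evalAt₂₃ e fun a b => ?_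
    rw [HeisenbergDouble.evalAt₂₃_leg₂₃_mul_leg₁₃_mul_leg₁₂_wBar,
      HeisenbergDouble.evalAt₂₃_phiBarInv₃₂₁_mul_leg₁₂_mul_leg₂₃_wBar]
  · exact HeisenbergDouble.leg₂₃_mul_leg₁₃_mul_leg₁₂ _ _ _
  · rw [HeisenbergDouble.phiBarInv₃₂₁_eq]
    exact HeisenbergDouble.smashLeft₃_mul_leg₁₂_mul_leg₂₃ _ _ _
  · rw [HeisenbergDouble.wHat_eq_canonicalMap, QuasiHopf.vTilde_eq hS]
    exact HeisenbergDouble.quasiPentagon_canonicalMap e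
  · exact HeisenbergDouble.leg₁₂_mul_leg₁₃_mul_leg₂₃ _ _ _
  · rw [HeisenbergDouble.phiBarS_eq, HeisenbergDouble.wHat_eq_canonicalMap]
    -- Only the two copies of `Ŵ` placed in legs 2, 3 must show their first entry in `H # ε`; these
    -- are the occurrences selected here.
    nth_rewrite 1 [HeisenbergDouble.canonicalMap_eq_map_smashLeft]
    nth_rewrite 2 [HeisenbergDouble.canonicalMap_eq_map_smashLeft]
    exact HeisenbergDouble.leg₂₃_mul_leg₁₂_mul_smashLeft₃ _ _ _
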